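/- Let $p$ be a prime, $L$ a finite extension of $\mathbb{Q}_p$ with ring of integers $\mathcal{O}$, uniformizer $\varpi$ and residue field $k$. Let $(R,\mathfrak{m})$ be a complete local noetherian $\mathcal{O}$-algebra with residue field $k$ which is reduced and $\mathcal{O}$-torsion free. Let $\mathfrak{X}^{\mathrm{rig}}$ be the rigid analytic space over $L$ attached by Berthelot to the formal scheme $\mathrm{Spf}\,R$ (with ideal of definition $\mathfrak{m}$): it is the increasing union over $n\ge 1$ of the affinoids $\mathrm{Sp}\,C_n$, where $C_n=B_n[1/\varpi]$ and $B_n$ is the $\varpi$-adic completion of the $R$-subalgebra $R[\mathfrak{m}^n/\varpi]$ of $R[1/\varpi]$ generated by the elements $i/\varpi$ with $i\in\mathfrak{m}^n$. Let $R^{\mathrm{rig}}=\varprojlim_n C_n$ be its ring of global functions, and for a point $x$ of $\mathfrak{X}^{\mathrm{rig}}$, that is, a maximal ideal of some $C_n$, let $\kappa(x)$ be its residue field. Let $M$ be a faithful, finitely generated, Cohen–Macaulay $R$-module, and put $M^{\mathrm{rig}}=M\otimes_R R^{\mathrm{rig}}$. Then the natural map $$M^{\mathrm{rig}}\longrightarrow\prod_{x\in\mathfrak{X}^{\mathrm{rig}}}M^{\mathrm{rig}}\otimes_{R^{\mathrm{rig}}}\kappa(x)$$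 is injective. -/

import Mathlib

open scoped TensorProduct

noncomputable section

/-! ### Depth and Cohen–Macaulay modules over a local ring -/

section CohenMacaulay

variable (R : Type*) [CommRing R] [IsLocalRing R] (M : Type*) [AddCommGroup M] [Module R M]

/-- The depth of a module over a local ring: the supremum of the lengths of the `M`-regular
sequences contained in the maximal ideal. -/
def localDepth : ℕ∞ :=
  ⨆ (rs : List R) (_ : (∀ r ∈ rs, r ∈ IsLocalRing.maximalIdeal R) ∧
    RingTheory.Sequence.IsRegular M rs), (rs.length : ℕ∞)

/-- A (finite) module over a (noetherian) local ring is Cohen–Macaulay if it is zero or if its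
depth is equal to the dimension of its support. -/
def IsCohenMacaulayModule : Prop :=
  Subsingleton M ∨ ((localDepth R M : ℕ∞) : WithBot ℕ∞) = Module.supportDim R M

end CohenMacaulay

/-! ### Functoriality of adic completions of algebras -/

section Completion

variable {R A A' : Type*} [CommRing R] [CommRing A] [CommRing A'] [Algebra R A] [Algebra R A']

/-- The homomorphism `A / J ^ k → A' / J' ^ k` induced by `f : A → A'` with `f(J) ⊆ J'`, composed
with the projection of the completion of `A` onto `A / J ^ k`. -/
def completionMapAux (J : Ideal A) (J' : Ideal A') (f : A →ₐ[R] A') (h : J ≤ J'.comap f) (k : ℕ) :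
    AdicCompletion J A →ₐ[R] A' ⧸ J' ^ k :=
  (Ideal.quotientMapₐ (J' ^ k) f
    ((Ideal.pow_right_mono h k).trans (Ideal.le_comap_pow _ k))).comp
      ((AdicCompletion.evalₐ J k).restrictScalars R)

theorem completionMapAux_compat (J : Ideal A) (J' : Ideal A') (f : A →ₐ[R] A')
    (h : J ≤ J'.comap f) {k l : ℕ} (hkl : k ≤ l) :
    (Ideal.Quotient.factorₐ R (Ideal.pow_le_pow_right hkl)).comp (completionMapAux J J' f h l) =
      completionMapAux J J' f h k := by
  ext x
  obtain ⟨y, rfl⟩ := AdicCompletion.mk_surjective _ _ x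
  have h1 : Ideal.Quotient.mk (J' ^ k) (f (y.val l)) =
      Ideal.Quotient.mk (J' ^ k) (f (y.val k)) := by
    rw [Ideal.Quotient.eq, ← map_sub]
    refine ((Ideal.pow_right_mono h k).trans (Ideal.le_comap_pow _ k)) ?_
    rw [← Ideal.Quotient.eq]
    exact AdicCompletion.Ideal.mk_eq_mk J hkl y
  simp only [completionMapAux, AlgHom.comp_apply, AlgHom.restrictScalars_apply,
    AdicCompletion.evalₐ_mk, Ideal.quotient_map_mkₐ]
  exact h1

/-- The algebra homomorphism between adic completions induced by a homomorphism `f : A → A'` with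
`f(J) ⊆ J'`. -/
def completionMap (J : Ideal A) (J' : Ideal A') (f : A →ₐ[R] A') (h : J ≤ J'.comap f) :
    AdicCompletion J A →ₐ[R] AdicCompletion J' A' :=
  AdicCompletion.liftAlgHom J' (completionMapAux J J' f h) (completionMapAux_compat J J' f h)

/-- The map between completions extends the given map. -/
theorem completionMap_of (J : Ideal A) (J' : Ideal A') (f : A →ₐ[R] A') (h : J ≤ J'.comap f)
    (a : A) : completionMap J J' f h (AdicCompletion.of J A a) = AdicCompletion.of J' A' (f a) := by
  refine AdicCompletion.ext_evalₐ fun k => ?_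
  refine (AdicCompletion.evalₐ_liftAlgHom _ _ (completionMapAux_compat J J' f h) k _).trans ?_
  simp [completionMapAux]

end Completion

/-! ### The rigid generic fibre of an affine formal scheme

Let `R` be a noetherian adic ring over a complete discrete valuation ring, `I` an ideal of
definition of `R` and `π` the image in `R` of a uniformizer. Berthelot's rigid generic fibre of
`Spf R` is the increasing union of the affinoid spaces `Sp C n`, where `C n = B n[1/π]` and `B n`
is the completion of the subring of `R[1/π]` generated by `R` and by the `i / π` for `i` in
`I ^ (n + 1)`. -/

namespace RigidFibre

variable {R : Type*} [CommRing R] (I : Ideal R) (π : R)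

/-- The subalgebra `R[I ^ (n + 1) / π]` of `R[1/π]`, generated over `R` by the elements `i / π`
with `i ∈ I ^ (n + 1)`. -/
def blowup (n : ℕ) : Subalgebra R (Localization.Away π) :=
  Algebra.adjoin R {x | ∃ i ∈ I ^ (n + 1),
    algebraMap R (Localization.Away π) π * x = algebraMap R (Localization.Away π) i}

/-- The ideal of `R[I ^ (n + 1) / π]` generated by `π`. -/
def piIdeal (n : ℕ) : Ideal (blowup I π n) :=
  Ideal.span {algebraMap R (blowup I π n) π}

/-- One has `I ^ (n + 1) ⊆ (π)` in `R[I ^ (n + 1) / π]`. If `π ∈ I`, then also `(π) ⊆ I`, so that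
the `π`-adic topology of this ring is its `I`-adic topology. -/
theorem map_pow_le_piIdeal (n : ℕ) :
    (I.map (algebraMap R (blowup I π n))) ^ (n + 1) ≤ piIdeal I π n := by
  rw [← Ideal.map_pow, Ideal.map_le_iff_le_comap]
  intro i hi
  have hu : IsUnit (algebraMap R (Localization.Away π) π) :=
    IsLocalization.Away.algebraMap_isUnit π
  obtain ⟨u, hu⟩ := hu
  have key : algebraMap R (Localization.Away π) π *
      (((u⁻¹ : (Localization.Away π)ˣ) : Localization.Away π) *
        algebraMap R (Localization.Away π) i) = algebraMap R (Localization.Away π) i := by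
    rw [← hu, Units.mul_inv_cancel_left]
  refine Ideal.mem_span_singleton.2 ⟨⟨_, Algebra.subset_adjoin ⟨i, hi, key⟩⟩, ?_⟩
  exact Subtype.ext key.symm

theorem blowup_anti {m n : ℕ} (h : n ≤ m) : blowup I π m ≤ blowup I π n := by
  refine Algebra.adjoin_mono ?_
  rintro x ⟨i, hi, hx⟩
  exact ⟨i, Ideal.pow_le_pow_right (by omega) hi, hx⟩

/-- `B n`: the completion of `R[I ^ (n + 1) / π]` (for its `π`-adic topology, which for `π ∈ I`
is its `I`-adic topology). -/
abbrev B (n : ℕ) : Type _ := AdicCompletion (piIdeal I π n) (blowup I π n)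

/-- The affinoid algebra `C n = B n[1/π]`. -/
abbrev C (n : ℕ) : Type _ := Localization.Away (algebraMap R (B I π n) π)

theorem piIdeal_le {m n : ℕ} (h : n ≤ m) :
    piIdeal I π m ≤ (piIdeal I π n).comap (Subalgebra.inclusion (blowup_anti I π h)) := by
  rw [piIdeal, Ideal.span_singleton_le_iff_mem, Ideal.mem_comap, AlgHom.commutes]
  exact Ideal.mem_span_singleton_self _

/-- The map `B m → B n`, for `n ≤ m`, induced by the inclusion
`R[I ^ (m + 1) / π] ⊆ R[I ^ (n + 1) / π]`. -/
def transitionB {m n : ℕ} (h : n ≤ m) : B I π m →ₐ[R] B I π n :=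
  completionMap (piIdeal I π m) (piIdeal I π n) (Subalgebra.inclusion (blowup_anti I π h))
    (piIdeal_le I π h)

/-- The restriction map `C m → C n`, for `n ≤ m`, corresponding to `Sp C n ⊆ Sp C m`. -/
def transition {m n : ℕ} (h : n ≤ m) : C I π m →ₐ[R] C I π n :=
  IsLocalization.liftAlgHom (M := Submonoid.powers (algebraMap R (B I π m) π))
    (f := (IsScalarTower.toAlgHom R (B I π n) (C I π n)).comp (transitionB I π h))
    (by
      rintro ⟨_, k, rfl⟩
      rw [map_pow, AlgHom.commutes, IsScalarTower.algebraMap_apply R (B I π n) (C I π n)]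
      exact (IsLocalization.Away.algebraMap_isUnit _).pow k)

/-- The ring `R^rig` of global functions on the generic fibre of `Spf R`: the inverse limit of the
affinoid algebras `C n`. -/
def Rrig : Subalgebra R (∀ n, C I π n) where
  carrier := {f | ∀ (m n : ℕ) (h : n ≤ m), transition I π h (f m) = f n}
  mul_mem' hf hg m n h := by simp [hf m n h, hg m n h]
  add_mem' hf hg m n h := by simp [hf m n h, hg m n h]
  algebraMap_mem' r m n h := by simp

/-- Restriction of functions from the generic fibre to `Sp C n`. -/
def restrict (n : ℕ) : Rrig I π →ₐ[R] C I π n :=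
  (Pi.evalAlgHom R (fun n => C I π n) n).comp (Rrig I π).val

instance (n : ℕ) : Algebra (Rrig I π) (C I π n) := (restrict I π n).toRingHom.toAlgebra

/-- `(m, x)` and `(n, y)` with `m ≥ n` are the same point if `y ∈ Sp C n` is mapped to `x` by
`Sp C n ⊆ Sp C m`. -/
def SamePoint (x y : Σ n, MaximalSpectrum (C I π n)) : Prop :=
  ∃ h : y.1 ≤ x.1, x.2.asIdeal = y.2.asIdeal.comap (transition I π h)

/-- The set of points of the generic fibre: the union (that is, the direct limit along the
inclusions) of the sets `Sp C n` of maximal ideals of the `C n`. -/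
def Point : Type _ := Quot (SamePoint I π)

variable {I π}

/-- The residue field `κ(x)` of the generic fibre at a point `x`: the field `C n / x`, where `Sp C n`
is a chosen affinoid that contains `x`. -/
def Kappa (x : Point I π) : Type _ := C I π (Quot.out x).1 ⧸ (Quot.out x).2.asIdeal

instance (x : Point I π) : Field (Kappa x) :=
  letI := (Quot.out x).2.isMaximal
  Ideal.Quotient.field (Quot.out x).2.asIdeal

/-- The value of a global function at a point. -/
def evalAt (x : Point I π) : Rrig I π →+* Kappa x :=
  (Ideal.Quotient.mk (Quot.out x).2.asIdeal).comp (restrict I π (Quot.out x).1).toRingHom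

instance (x : Point I π) : Algebra (Rrig I π) (Kappa x) := (evalAt x).toAlgebra

variable (I π) (M : Type*) [AddCommGroup M] [Module R M]

/-- The module `M^rig = R^rig ⊗[R] M` over `R^rig`. -/
abbrev Mrig : Type _ := Rrig I π ⊗[R] M

/-- The natural map from `M^rig` to the product of its fibres `κ(x) ⊗ M^rig` (over `R^rig`) at all
the points `x` of the generic fibre, which sends `m` to the family of the `1 ⊗ m`. -/
def toFibres : Mrig I π M →ₗ[Rrig I π] ∀ x : Point I π, Kappa x ⊗[Rrig I π] Mrig I π M :=
  LinearMap.pi fun x => TensorProduct.mk (Rrig I π) (Kappa x) (Mrig I π M) 1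

end RigidFibre

end

/-! A global function on the generic fibre is a series `∑ π ^ (-j) F j` with `F j ∈ R`, where the
order of `F j` for the maximal ideal grows faster than any linear function of `j` (`IsEntire`). Such
a series converges on every `Sp C n`, and every element of `R^rig` arises in this way
(`exists_isEntire_represents`). A series counts as zero (`IsNull`) when its scaled partial sums
`∑_{i ≤ j} π ^ (j - i) F i` are again entire. This condition makes sense for sequences in any
`R`-module. By Artin–Rees it is reflected by injections into finite modules (`IsNull.of_map`), and
an element of `M^rig` whose sequence in `M` is null is zero (`sum_tmul_eq_zero_of_isNull`); this
takes the place of flatness of `R → R^rig`.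

Reduction to functions. The associated primes of a faithful Cohen–Macaulay module are minimal primes
of `R`. As `R` is reduced, its localizations there are fields, so linear forms separate the elements
of `M`, and `M` embeds into some `R ^ N` (`IsCohenMacaulayModule.exists_injective_pi`). It remains
to show that a function vanishing at all points has a null series. Since `R` embeds into the product
of the `R ⧸ p` with `p` minimal, and `π ∉ p`, this can be checked in the complete local domains `D =
R ⧸ p`.

Functions on a domain. `D` is finite over a power series ring `S = O[[X_1, ..., X_d]]`
(`MvPowerSeries.exists_finite_injective`). If `θ ∈ D` is a primitive element and `Δ D ⊆ S[θ]`, then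
the traces of the `Δ x θ ^ i` embed `D` into a power of `S`. At an `O`-point of `S`, such a trace is
a sum of values at points of `D` above it. These are points of the generic fibre, where the function
vanishes, so the traces of the partial sums are highly divisible by `ϖ` (`eventually_dvd_trace`).
Hence the trace sequences are null at all `O`-points of `S` with coordinates in `(ϖ)`, and the
identity theorem `MvPowerSeries.isNull_of_forall_eval` makes them null. -/

open scoped TensorProduct

noncomputable section

section

/-! ### Entire sequences -/

section EntireSequences

open Filter

variable {R : Type*} [CommRing R] (I : Ideal R) (π : R)
variable {N : Type*} [AddCommGroup N] [Module R N] {N' : Type*} [AddCommGroup N'] [Module R N']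

/-- The coefficients of a power series in `1 / π` that converges on all of the generic fibre:
the `j`-th coefficient is divisible by a power of `I` that grows faster than linearly in `j`. -/
def IsEntire (F : ℕ → N) : Prop :=
  ∀ s : ℕ, ∀ᶠ j in atTop, F j ∈ (I ^ (s * j) • ⊤ : Submodule R N)

/-- `π ^ j` times the `j`-th partial sum of `∑ π ^ (-j) F j`. -/
def psum (F : ℕ → N) : ℕ → N
  | 0 => F 0
  | j + 1 => π • psum F j + F (j + 1)

/-- The formal sum `∑ π ^ (-j) F j` is zero. -/
def IsNull (F : ℕ → N) : Prop := IsEntire I (psum π F)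

/-- The sequence whose scaled partial sums are `G`. -/
def pdiff (G : ℕ → N) : ℕ → N
  | 0 => G 0
  | j + 1 => G (j + 1) - π • G j

variable {I π}

theorem pow_smul_top_anti {a b : ℕ} (h : a ≤ b) :
    (I ^ b • ⊤ : Submodule R N) ≤ I ^ a • ⊤ :=
  Submodule.smul_mono_left (Ideal.pow_le_pow_right h)

theorem map_mem_pow_smul_top (f : N →ₗ[R] N') {a : ℕ} {x : N}
    (h : x ∈ (I ^ a • ⊤ : Submodule R N)) : f x ∈ (I ^ a • ⊤ : Submodule R N') := by
  have := Submodule.mem_map_of_mem (f := f) h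
  rw [Submodule.map_smul''] at this
  exact Submodule.smul_mono le_rfl le_top this

theorem mem_pow_smul_top_self {a : ℕ} {x : R} :
    x ∈ (I ^ a • ⊤ : Submodule R R) ↔ x ∈ I ^ a := by
  simp

theorem IsEntire.add {F G : ℕ → N} (hF : IsEntire I F) (hG : IsEntire I G) :
    IsEntire I (F + G) := fun s => by
  filter_upwards [hF s, hG s] with j h1 h2 using add_mem h1 h2

theorem IsEntire.neg {F : ℕ → N} (hF : IsEntire I F) : IsEntire I (-F) := fun s => by
  filter_upwards [hF s] with j h1 using neg_mem h1

theorem IsEntire.sub {F G : ℕ → N} (hF : IsEntire I F) (hG : IsEntire I G) :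
    IsEntire I (F - G) := by
  rw [sub_eq_add_neg]; exact hF.add hG.neg

theorem IsEntire.zero : IsEntire I (0 : ℕ → N) := fun s => by simp

theorem IsEntire.map (f : N →ₗ[R] N') {F : ℕ → N} (hF : IsEntire I F) :
    IsEntire I (f ∘ F) := fun s => by
  filter_upwards [hF s] with j h1 using map_mem_pow_smul_top f h1

theorem IsEntire.smul (r : R) {F : ℕ → N} (hF : IsEntire I F) : IsEntire I (r • F) :=
  hF.map (LinearMap.lsmul R N r)

theorem IsEntire.sum {ι : Type*} (s : Finset ι) {F : ι → ℕ → N}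
    (hF : ∀ i ∈ s, IsEntire I (F i)) : IsEntire I (∑ i ∈ s, F i) := by
  classical
  induction s using Finset.induction_on with
  | empty => simpa using IsEntire.zero
  | insert a s ha ih =>
    rw [Finset.sum_insert ha]
    exact (hF a (Finset.mem_insert_self _ _)).add
      (ih fun i hi => hF i (Finset.mem_insert_of_mem hi))

theorem isEntire_pi {ι : Type*} [Finite ι] {N : ι → Type*} [∀ i, AddCommGroup (N i)]
    [∀ i, Module R (N i)] {F : ℕ → ∀ i, N i}
    (hF : ∀ i, IsEntire I fun j => F j i) : IsEntire I F := by
  classical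
  cases nonempty_fintype ι
  have : F = ∑ i, (LinearMap.single R N i) ∘ fun j => F j i := by
    ext j i
    simp
  rw [this]
  exact IsEntire.sum _ fun i _ => (hF i).map _

theorem psum_map (f : N →ₗ[R] N') (F : ℕ → N) : psum π (f ∘ F) = f ∘ psum π F := by
  ext j
  induction j with
  | zero => rfl
  | succ j ih => simp [psum, ih]

theorem psum_add (F G : ℕ → N) : psum π (F + G) = psum π F + psum π G := by
  ext j
  induction j with
  | zero => rfl
  | succ j ih => simp [psum, ih]; abel

theorem psum_smul (r : R) (F : ℕ → N) : psum π (r • F) = r • psum π F :=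
  psum_map (LinearMap.lsmul R N r) F

theorem psum_zero : psum π (0 : ℕ → N) = 0 := by
  simpa using psum_smul (π := π) 0 (0 : ℕ → N)

theorem psum_pdiff (G : ℕ → N) : psum π (pdiff π G) = G := by
  ext j
  induction j with
  | zero => rfl
  | succ j ih => simp [psum, pdiff, ih]

theorem pdiff_psum (G : ℕ → N) : pdiff π (psum π G) = G := by
  ext j
  cases j <;> simp [psum, pdiff]

theorem pdiff_map (f : N →ₗ[R] N') (F : ℕ → N) : pdiff π (f ∘ F) = f ∘ pdiff π F := by
  ext j
  cases j <;> simp [pdiff]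

theorem IsEntire.pdiff {G : ℕ → N} (hG : IsEntire I G) : IsEntire I (pdiff π G) := fun s => by
  -- `G i` reappears at index `i + 1`; the doubled slope absorbs the shift, since `2 * s * i ≥ s *
  -- (i + 1)` for `i ≥ 1`.
  have h := hG (2 * s)
  obtain ⟨J, hJ⟩ := eventually_atTop.1 h
  filter_upwards [eventually_ge_atTop (J + 2)] with j hj
  obtain ⟨i, rfl⟩ : ∃ i, j = i + 1 := ⟨j - 1, by omega⟩
  refine sub_mem (pow_smul_top_anti ?_ (hJ (i + 1) (by omega)))
    (Submodule.smul_mem _ _ (pow_smul_top_anti ?_ (hJ i (by omega))))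
  · nlinarith
  · nlinarith

/-- The shifted sequence starts with `0` because `F j` is already counted in `psum π F j`. -/
theorem psum_add_index (F : ℕ → N) (j l : ℕ) :
    psum π F (j + l) = π ^ l • psum π F j + psum π (fun i => if i = 0 then 0 else F (j + i)) l := by
  induction l with
  | zero => simp [psum]
  | succ l ih =>
    rw [← add_assoc, psum, ih, psum]
    simp only [smul_add, pow_succ', mul_smul, Nat.add_eq_zero_iff, one_ne_zero, and_false, if_false,
      add_assoc]

variable (I) in
/-- A consequence of the Artin–Rees lemma. -/
theorem exists_mem_pow_of_map_mem [IsNoetherianRing R] [Module.Finite R N'] (f : N →ₗ[R] N')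
    (hf : Function.Injective f) :
    ∃ c : ℕ, ∀ (n : ℕ) (x : N), f x ∈ (I ^ (n + c) • ⊤ : Submodule R N') →
      x ∈ (I ^ n • ⊤ : Submodule R N) := by
  obtain ⟨c, hc⟩ := I.exists_pow_inf_eq_pow_smul (LinearMap.range f)
  refine ⟨c, fun n x hx => ?_⟩
  have h1 : f x ∈ (I ^ (n + c) • ⊤ ⊓ LinearMap.range f : Submodule R N') := ⟨hx, x, rfl⟩
  rw [hc _ (Nat.le_add_left _ _), Nat.add_sub_cancel] at h1
  have h2 := Submodule.smul_mono (le_refl (I ^ n))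
    (inf_le_right : I ^ c • ⊤ ⊓ LinearMap.range f ≤ _) h1
  rw [← Submodule.map_top, ← Submodule.map_smul''] at h2
  obtain ⟨y, hy, hxy⟩ := h2
  rwa [← hf hxy]

/-- Artin–Rees loses a constant number `c` of powers of `I`; raising the slope from `s` to `s + c`
pays for it as soon as `j ≥ 1`. -/
theorem IsEntire.of_map [IsNoetherianRing R] [Module.Finite R N'] (f : N →ₗ[R] N')
    (hf : Function.Injective f) {F : ℕ → N} (hF : IsEntire I (f ∘ F)) : IsEntire I F := by
  obtain ⟨c, hc⟩ := exists_mem_pow_of_map_mem I f hf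
  intro s
  filter_upwards [hF (s + c), eventually_ge_atTop 1] with j hj h1
  exact hc _ _ (pow_smul_top_anti (by nlinarith) hj)

theorem IsNull.of_map [IsNoetherianRing R] [Module.Finite R N'] (f : N →ₗ[R] N')
    (hf : Function.Injective f) {F : ℕ → N} (hF : IsNull I π (f ∘ F)) : IsNull I π F := by
  rw [IsNull, psum_map] at hF
  exact hF.of_map f hf

/-- Entire sequences can be lifted along surjective linear maps. -/
theorem IsEntire.exists_lift (f : N →ₗ[R] N') (hf : Function.Surjective f) {F : ℕ → N'}
    (hF : IsEntire I F) : ∃ G : ℕ → N, IsEntire I G ∧ f ∘ G = F := by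
  classical
  -- A single lift of `F j` must serve all slopes, so it is taken in the largest power `I ^ (s * j)`
  -- that works. The cap `s ≤ j` makes a largest one exist and does not matter for large `j`.
  have key : ∀ j, ∃ x : N, f x = F j ∧ ∀ s ≤ j, F j ∈ (I ^ (s * j) • ⊤ : Submodule R N') →
      x ∈ (I ^ (s * j) • ⊤ : Submodule R N) := by
    intro j
    set P : ℕ → Prop := fun s => F j ∈ (I ^ (s * j) • ⊤ : Submodule R N')
    have h0 : P 0 := by simp [P]
    have hP : P (Nat.findGreatest P j) := Nat.findGreatest_spec (Nat.zero_le _) h0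
    have : F j ∈ Submodule.map f (I ^ (Nat.findGreatest P j * j) • ⊤) := by
      rw [Submodule.map_smul'', Submodule.map_top, LinearMap.range_eq_top.2 hf]
      exact hP
    obtain ⟨x, hx, hxF⟩ := this
    refine ⟨x, hxF, fun s hs h => pow_smul_top_anti ?_ hx⟩
    exact Nat.mul_le_mul_right _ (Nat.le_findGreatest hs h)
  choose G hG1 hG2 using key
  refine ⟨G, fun s => ?_, funext hG1⟩
  filter_upwards [hF s, eventually_ge_atTop s] with j h1 h2 using hG2 j s h2 h1

end EntireSequences

end

/-! ### Numerators of the elements of `R[I ^ (n + 1) / π]` -/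

section

namespace RigidFibre

open Filter

section Blowup

variable {R : Type*} [CommRing R] {I : Ideal R} {π : R}

/-- The ideal `I ^ (n + 1) + (π)`. -/
def num (I : Ideal R) (π : R) (n : ℕ) : Ideal R := I ^ (n + 1) ⊔ Ideal.span {π}

theorem pi_mem_num (n : ℕ) : π ∈ num I π n :=
  Ideal.mem_sup_right (Ideal.mem_span_singleton_self π)

/-- A product of `q + 1` factors from `I ^ (n + 1)` or `(π)` either contains a factor `π` or lies in
`I ^ ((n + 1) * (q + 1))`. -/
theorem num_pow_succ_le (n q : ℕ) :
    num I π n ^ (q + 1) ≤ Ideal.span {π} * num I π n ^ q ⊔ I ^ ((n + 1) * (q + 1)) := by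
  induction q with
  | zero => simp [num, sup_comm]
  | succ q ih =>
    calc num I π n ^ (q + 1 + 1) = num I π n ^ (q + 1) * I ^ (n + 1) ⊔
          num I π n ^ (q + 1) * Ideal.span {π} := by
            rw [pow_succ _ (q + 1), ← Ideal.mul_sup]; rfl
      _ ≤ _ := by
        refine sup_le ?_ (by rw [mul_comm]; exact le_sup_left)
        refine (Ideal.mul_mono_left ih).trans ?_
        rw [Ideal.sup_mul]
        refine sup_le_sup ?_ ?_
        · rw [mul_assoc]
          refine Ideal.mul_mono_right ?_
          rw [pow_succ]
          exact Ideal.mul_mono_right le_sup_left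
        · rw [← pow_add]
          exact Ideal.pow_le_pow_right (by ring_nf; omega)

/-- Peeling off the part without a factor `π` repeatedly writes `x / π ^ K` as a finite series `∑ π
^ (-k) i k` with controlled coefficients. -/
theorem exists_psum_of_mem_num_pow {n : ℕ} (K : ℕ) {x : R} (hx : x ∈ num I π n ^ K) :
    ∃ i : ℕ → R, (∀ k, i k ∈ I ^ ((n + 1) * k)) ∧ (∀ k, K < k → i k = 0) ∧ psum π i K = x := by
  induction K generalizing x with
  | zero =>
    refine ⟨fun k => if k = 0 then x else 0, fun k => ?_, fun k hk => ?_, by simp [psum]⟩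
    · by_cases h : k = 0 <;> simp [h]
    · simp [hk.ne']
  | succ K ih =>
    obtain ⟨y, hy, z, hz, rfl⟩ := Submodule.mem_sup.1 (num_pow_succ_le n K hx)
    obtain ⟨w, hw, rfl⟩ := Ideal.mem_span_singleton_mul.1 hy
    obtain ⟨i, h1, h2, h3⟩ := ih hw
    refine ⟨fun k => if k = K + 1 then z else i k, fun k => ?_, fun k hk => ?_, ?_⟩
    · by_cases h : k = K + 1
      · simpa [h] using hz
      · simpa [h] using h1 k
    · simp only [hk.ne', if_false]; exact h2 k (by omega)
    · have : ∀ k ≤ K, psum π (fun k => if k = K + 1 then z else i k) k = psum π i k := by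
        intro k hk
        induction k with
        | zero => simp [psum]
        | succ k ihk => simp [psum, ihk (by omega), show k ≠ K by omega]
      simp [psum, this K le_rfl, h3]

/-- Numerators are brought to a common denominator by multiplying with powers of `π`; this is why
`π` is included in `num`. -/
theorem mem_blowup {n : ℕ} {x : Localization.Away π} (hx : x ∈ blowup I π n) :
    ∃ K, ∃ y ∈ num I π n ^ K, algebraMap R (Localization.Away π) (π ^ K) * x =
      algebraMap R (Localization.Away π) y := by
  induction hx using Algebra.adjoin_induction with
  | mem x hx =>
    obtain ⟨i, hi, h⟩ := hx
    exact ⟨1, i, by rw [pow_one]; exact Ideal.mem_sup_left hi, by simpa using h⟩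
  | algebraMap r => exact ⟨0, r, by simp, by simp⟩
  | add x y _ _ hx hy =>
    obtain ⟨K, a, ha, h1⟩ := hx
    obtain ⟨K', b, hb, h2⟩ := hy
    refine ⟨K + K', π ^ K' * a + π ^ K * b, ?_, ?_⟩
    · refine add_mem ?_ ?_
      · rw [add_comm, pow_add]
        exact Ideal.mul_mem_mul (Ideal.pow_mem_pow (pi_mem_num n) _) ha
      · rw [pow_add]
        exact Ideal.mul_mem_mul (Ideal.pow_mem_pow (pi_mem_num n) _) hb
    · simp only [map_add, map_mul, pow_add, ← h1, ← h2]; ring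
  | mul x y _ _ hx hy =>
    obtain ⟨K, a, ha, h1⟩ := hx
    obtain ⟨K', b, hb, h2⟩ := hy
    refine ⟨K + K', a * b, ?_, ?_⟩
    · rw [pow_add]; exact Ideal.mul_mem_mul ha hb
    · simp only [map_mul, pow_add, ← h1, ← h2]; ring

theorem isUnit_pi (π : R) : IsUnit (algebraMap R (Localization.Away π) π) :=
  IsLocalization.Away.algebraMap_isUnit π

theorem exists_pow_mul_of_mem_pow (n t : ℕ) {r : R} (hr : r ∈ I ^ ((n + 1) * t)) :
    ∃ a : blowup I π n, algebraMap R (blowup I π n) r =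
      algebraMap R (blowup I π n) (π ^ t) * a := by
  have h := Ideal.mem_map_of_mem (algebraMap R (blowup I π n)) hr
  rw [Ideal.map_pow, pow_mul] at h
  have h' := Ideal.pow_right_mono (map_pow_le_piIdeal I π n) t h
  rw [piIdeal, Ideal.span_singleton_pow, Ideal.mem_span_singleton] at h'
  obtain ⟨a, ha⟩ := h'
  exact ⟨a, by rw [map_pow]; exact ha⟩

theorem algebraMap_blowup_mem_nonZeroDivisors (n : ℕ) :
    algebraMap R (blowup I π n) π ∈ nonZeroDivisors (blowup I π n) := by
  rw [mem_nonZeroDivisors_iff_right]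
  intro x hx
  have h := congrArg (Subalgebra.val _) hx
  rw [map_mul, AlgHom.commutes, map_zero] at h
  exact Subtype.ext ((isUnit_pi π).mul_left_eq_zero.1 h)

variable (hreg : π ∈ nonZeroDivisors R)
include hreg

theorem algebraMap_away_injective : Function.Injective (algebraMap R (Localization.Away π)) :=
  IsLocalization.injective _ (Submonoid.powers_le.2 hreg)

end Blowup

end RigidFibre

end

/-! ### Completion along a principal ideal, and inversion of its generator -/

section

set_option linter.unusedSectionVars false

namespace CompletedLocalization

variable {R A : Type*} [CommRing R] [CommRing A] [Algebra R A] {J : Ideal A} {π : R}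

theorem pow_eq_span (hJ : J = Ideal.span {algebraMap R A π}) (t : ℕ) :
    J ^ t = Ideal.span {algebraMap R A (π ^ t)} := by
  rw [hJ, Ideal.span_singleton_pow, map_pow]

theorem algebraMap_comp (r : R) :
    algebraMap A (AdicCompletion J A) (algebraMap R A r) = algebraMap R (AdicCompletion J A) r :=
  rfl

theorem mem_pow_smul_top_iff (hJ : J = Ideal.span {algebraMap R A π}) {t : ℕ}
    {b : AdicCompletion J A} : b ∈ (J ^ t • ⊤ : Submodule A (AdicCompletion J A)) ↔
      ∃ b', b = algebraMap R (AdicCompletion J A) (π ^ t) * b' := by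
  rw [pow_eq_span hJ, Submodule.ideal_span_singleton_smul, Submodule.mem_smul_pointwise_iff_exists]
  constructor
  · rintro ⟨b', -, rfl⟩
    exact ⟨b', by rw [Algebra.smul_def, algebraMap_comp]⟩
  · rintro ⟨b', rfl⟩
    exact ⟨b', trivial, by rw [Algebra.smul_def, algebraMap_comp]⟩

theorem fg (hJ : J = Ideal.span {algebraMap R A π}) : J.FG :=
  ⟨{algebraMap R A π}, by simp [hJ]⟩

/-- As `J` is finitely generated, the kernel of the projection to `A / J ^ t` is `J ^ t` times the
completion. -/
theorem evalₐ_eq_zero_iff (hJ : J = Ideal.span {algebraMap R A π}) (t : ℕ)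
    (b : AdicCompletion J A) :
    AdicCompletion.evalₐ J t b = 0 ↔ ∃ b', b = algebraMap R (AdicCompletion J A) (π ^ t) * b' := by
  rw [← mem_pow_smul_top_iff hJ, AdicCompletion.pow_smul_top_eq_ker_eval (fg hJ), LinearMap.mem_ker]
  have e1 := AdicCompletion.factor_evalₐ_eq_eval J b (n := t) (by simp)
  have e2 := AdicCompletion.factor_eval_eq_evalₐ J b (n := t) (by simp)
  constructor
  · intro h
    rw [← e1, h, map_zero]
  · intro h
    rw [← e2, h]
    exact map_zero _

theorem evalₐ_algebraMap (t : ℕ) (a : A) :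
    AdicCompletion.evalₐ J t (algebraMap A (AdicCompletion J A) a) = Ideal.Quotient.mk _ a :=
  AdicCompletion.evalₐ_of J t a

theorem algebraMap_eq_pow_mul (hJ : J = Ideal.span {algebraMap R A π}) {t : ℕ} {a : A}
    {b : AdicCompletion J A}
    (h : algebraMap A (AdicCompletion J A) a = algebraMap R (AdicCompletion J A) (π ^ t) * b) :
    ∃ a', a = algebraMap R A (π ^ t) * a' := by
  have h1 := (evalₐ_eq_zero_iff hJ t _).2 ⟨b, h⟩
  rw [evalₐ_algebraMap, Ideal.Quotient.eq_zero_iff_mem, pow_eq_span hJ,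
    Ideal.mem_span_singleton] at h1
  exact h1

theorem exists_algebraMap_add (hJ : J = Ideal.span {algebraMap R A π}) (t : ℕ)
    (b : AdicCompletion J A) :
    ∃ a b', b = algebraMap A (AdicCompletion J A) a +
      algebraMap R (AdicCompletion J A) (π ^ t) * b' := by
  obtain ⟨a, ha⟩ := Ideal.Quotient.mk_surjective (AdicCompletion.evalₐ J t b)
  have : AdicCompletion.evalₐ J t (b - algebraMap A (AdicCompletion J A) a) = 0 := by
    rw [map_sub, evalₐ_algebraMap, ha, sub_self]
  obtain ⟨b', hb'⟩ := (evalₐ_eq_zero_iff hJ t _).1 this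
  exact ⟨a, b', by rw [← hb']; ring⟩

theorem eq_zero_of_forall_pow_mul (hJ : J = Ideal.span {algebraMap R A π}) {b : AdicCompletion J A}
    (h : ∀ t, ∃ b', b = algebraMap R (AdicCompletion J A) (π ^ t) * b') : b = 0 :=
  AdicCompletion.ext_evalₐ fun t => by rw [(evalₐ_eq_zero_iff hJ t b).2 (h t), map_zero]

theorem exists_limit (hJ : J = Ideal.span {algebraMap R A π}) (a : ℕ → AdicCompletion J A) :
    ∃ β : AdicCompletion J A, ∀ m, ∃ b,
      β - ∑ j ∈ Finset.range m, algebraMap R (AdicCompletion J A) (π ^ j) * a j =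
      algebraMap R (AdicCompletion J A) (π ^ m) * b := by
  have := AdicCompletion.isAdicComplete (M := A) (fg hJ)
  obtain ⟨β, hβ⟩ := IsPrecomplete.prec' (I := J) (M := AdicCompletion J A)
    (fun m => ∑ j ∈ Finset.range m, algebraMap R (AdicCompletion J A) (π ^ j) * a j) (by
      intro k m hkm
      rw [SModEq.comm, SModEq.sub_mem, mem_pow_smul_top_iff hJ,
        ← Finset.sum_range_add_sum_Ico _ hkm, add_sub_cancel_left]
      refine ⟨∑ j ∈ Finset.Ico k m, algebraMap R (AdicCompletion J A) (π ^ (j - k)) * a j, ?_⟩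
      rw [Finset.mul_sum]
      refine Finset.sum_congr rfl fun j hj => ?_
      rw [← mul_assoc, ← map_mul, ← pow_add, Nat.add_sub_cancel' (Finset.mem_Ico.1 hj).1])
  refine ⟨β, fun m => (mem_pow_smul_top_iff hJ).1 ?_⟩
  rw [← SModEq.sub_mem]
  exact (hβ m).symm

variable (hA : algebraMap R A π ∈ nonZeroDivisors A)

-- Approximate `b` by `a ∈ A` modulo `π ^ t`. Then `π a` is divisible by `π ^ (t + 1)` in the
-- completion, hence in `A`, so `a` is divisible by `π ^ t`. Thus `b` is divisible by all powers of
-- `π`.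
include hA in
theorem pi_mul_eq_zero (hJ : J = Ideal.span {algebraMap R A π}) {b : AdicCompletion J A}
    (h : algebraMap R (AdicCompletion J A) π * b = 0) : b = 0 := by
  refine eq_zero_of_forall_pow_mul hJ fun t => ?_
  obtain ⟨a, b', rfl⟩ := exists_algebraMap_add hJ t b
  have h1 : algebraMap A (AdicCompletion J A) (algebraMap R _ π * a) =
      algebraMap R (AdicCompletion J A) (π ^ (t + 1)) * (-b') := by
    rw [map_mul, algebraMap_comp, eq_neg_of_add_eq_zero_left ((mul_add _ _ _).symm.trans h),
      pow_succ', map_mul]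
    ring
  obtain ⟨a', ha'⟩ := algebraMap_eq_pow_mul hJ h1
  rw [pow_succ', map_mul, mul_assoc] at ha'
  have ha := (mul_cancel_left_mem_nonZeroDivisors hA).1 ha'
  exact ⟨algebraMap A _ a' + b', by rw [ha, map_mul, algebraMap_comp, mul_add]⟩

/-! ### The filtration of the localization by multiples of powers of `π` -/

variable (J π) {C : Type*} [CommRing C] [Algebra R C] [Algebra (AdicCompletion J A) C]
  [IsScalarTower R (AdicCompletion J A) C]

section

variable (C)

/-- The submodule `π ^ t B` of `B[1 / π]`. -/
def ball (t : ℕ) : Submodule R C :=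
  LinearMap.range (LinearMap.lsmul R C (π ^ t) ∘ₗ
    (IsScalarTower.toAlgHom R (AdicCompletion J A) C).toLinearMap)

end

variable {J π}

theorem mem_ball {t : ℕ} {c : C} :
    c ∈ ball J π C t ↔ ∃ b : AdicCompletion J A, c = π ^ t • algebraMap (AdicCompletion J A) C b := by
  constructor
  · rintro ⟨b, rfl⟩; exact ⟨b, rfl⟩
  · rintro ⟨b, rfl⟩; exact ⟨b, rfl⟩

theorem smul_algebraMap (r : R) (b : AdicCompletion J A) :
    r • algebraMap (AdicCompletion J A) C b =
      algebraMap (AdicCompletion J A) C (algebraMap R (AdicCompletion J A) r * b) := by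
  rw [map_mul, ← IsScalarTower.algebraMap_apply, Algebra.smul_def]

theorem ball_anti {a b : ℕ} (h : a ≤ b) : ball J π C b ≤ ball J π C a := by
  intro c hc
  obtain ⟨x, rfl⟩ := mem_ball.1 hc
  obtain ⟨k, rfl⟩ := Nat.exists_eq_add_of_le h
  exact mem_ball.2 ⟨algebraMap R _ (π ^ k) * x, by rw [← smul_algebraMap, pow_add, mul_smul]⟩

variable [IsLocalization.Away (algebraMap R (AdicCompletion J A) π) C]

include hA in
theorem algebraMap_injective (hJ : J = Ideal.span {algebraMap R A π}) :
    Function.Injective (algebraMap (AdicCompletion J A) C) := by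
  refine IsLocalization.injective (M := Submonoid.powers (algebraMap R (AdicCompletion J A) π)) _
    (Submonoid.powers_le.2 ?_)
  rw [mem_nonZeroDivisors_iff_right]
  intro b hb
  rw [mul_comm] at hb
  exact pi_mul_eq_zero hA hJ hb

omit [IsScalarTower R (AdicCompletion J A) C] in
theorem exists_mul_eq (c : C) : ∃ (k : ℕ) (b : AdicCompletion J A),
    algebraMap (AdicCompletion J A) C (algebraMap R _ (π ^ k)) * c =
      algebraMap (AdicCompletion J A) C b := by
  obtain ⟨k, b, h⟩ := IsLocalization.Away.surj (algebraMap R (AdicCompletion J A) π) c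
  exact ⟨k, b, by rw [← h, map_pow, map_pow, mul_comm]⟩

variable (J) in
include J in
theorem isUnit_pi : IsUnit (algebraMap R C π) := by
  rw [IsScalarTower.algebraMap_apply R (AdicCompletion J A) C]
  exact IsLocalization.Away.algebraMap_isUnit _

variable (J) in
include J in
theorem pow_smul_cancel {t : ℕ} {c c' : C} (h : π ^ t • c = π ^ t • c') : c = c' := by
  rw [Algebra.smul_def, Algebra.smul_def, map_pow] at h
  exact ((isUnit_pi J).pow t).mul_left_cancel h

theorem pow_smul_mem_ball {a t : ℕ} {c : C} :
    π ^ a • c ∈ ball J π C (a + t) ↔ c ∈ ball J π C t := by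
  rw [mem_ball, mem_ball]
  constructor
  · rintro ⟨b, h⟩
    exact ⟨b, pow_smul_cancel J (t := a) (by rw [h, pow_add, mul_smul])⟩
  · rintro ⟨b, rfl⟩
    exact ⟨b, by rw [pow_add, mul_smul]⟩

include hA in
theorem eq_zero_of_forall_mem_ball (hJ : J = Ideal.span {algebraMap R A π}) {c : C}
    (h : ∀ t, c ∈ ball J π C t) : c = 0 := by
  choose b hb using fun t => mem_ball.1 (h t)
  have h0 : b 0 = 0 := by
    refine eq_zero_of_forall_pow_mul hJ fun t => ⟨b t, algebraMap_injective (C := C) hA hJ ?_⟩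
    rw [← smul_algebraMap, ← hb t, hb 0, pow_zero, one_smul]
  rw [hb 0, h0, map_zero, smul_zero]

-- The multiples of `π ^ t` in the completion meet `A` in `π ^ t A`, so divisibility can be tested
-- before completing.
include hA in
theorem algebraMap_mem_ball_iff (hJ : J = Ideal.span {algebraMap R A π}) {t : ℕ} {r : R} :
    algebraMap R C r ∈ ball J π C t ↔
      ∃ a, algebraMap R A r = algebraMap R A (π ^ t) * a := by
  rw [mem_ball]
  constructor
  · rintro ⟨b, hb⟩
    refine algebraMap_eq_pow_mul hJ (b := b) (algebraMap_injective (C := C) hA hJ ?_)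
    rw [algebraMap_comp, ← IsScalarTower.algebraMap_apply, hb, smul_algebraMap]
  · rintro ⟨a, ha⟩
    refine ⟨algebraMap A _ a, ?_⟩
    rw [smul_algebraMap, ← algebraMap_comp, ← map_mul, ← ha, algebraMap_comp,
      ← IsScalarTower.algebraMap_apply]

-- The fractions `r / π ^ k` are dense in the localized completion. The error is stated after
-- multiplication by `π ^ k`, so that only elements of `R` occur.
variable (J) in
theorem exists_pow_smul_sub_mem_ball (hJ : J = Ideal.span {algebraMap R A π})
    (hA' : ∀ a : A, ∃ (k : ℕ) (r : R), algebraMap R A (π ^ k) * a = algebraMap R A r)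
    (c : C) (t : ℕ) :
    ∃ (k : ℕ) (r : R), π ^ k • c - algebraMap R C r ∈ ball J π C (k + t) := by
  obtain ⟨k, b, h⟩ := exists_mul_eq (J := J) (π := π) c
  obtain ⟨a, b', rfl⟩ := exists_algebraMap_add hJ (k + t) b
  obtain ⟨K, y, hy⟩ := hA' a
  have h' : π ^ k • c = algebraMap (AdicCompletion J A) C (algebraMap A _ a) +
      π ^ (k + t) • algebraMap (AdicCompletion J A) C b' := by
    rw [smul_algebraMap, ← map_add, ← h, ← IsScalarTower.algebraMap_apply, Algebra.smul_def]
  refine ⟨K + k, y, mem_ball.2 ⟨b', ?_⟩⟩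
  rw [pow_add, mul_smul, h', smul_add, smul_algebraMap _ (algebraMap A _ a), ← algebraMap_comp,
    ← map_mul, hy, algebraMap_comp, ← IsScalarTower.algebraMap_apply, add_sub_cancel_left,
    add_assoc]
  simp only [pow_add, mul_smul]

-- With slope `2`, `π ^ (-j) F j` is `π ^ j` times an element of `A` for large `j`, so the tail
-- converges in the completion. The finitely many earlier terms are summed in `C`, where `π` is
-- invertible.
include hA in
theorem exists_series_limit (hJ : J = Ideal.span {algebraMap R A π}) (F : ℕ → R) 
    (hF : ∀ s : ℕ, ∀ᶠ j in Filter.atTop,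
      ∃ a, algebraMap R A (F j) = algebraMap R A (π ^ (s * j)) * a) :
    ∃ c : C, ∀ s : ℕ, ∀ᶠ j in Filter.atTop,
      π ^ j • c - algebraMap R C (psum π F j) ∈ ball J π C (s * j) := by
  classical
  obtain ⟨J₀, hJ₀⟩ := Filter.eventually_atTop.1 (hF 2)
  have hex : ∀ j, ∃ a, J₀ ≤ j → algebraMap R A (F j) = algebraMap R A (π ^ (2 * j)) * a := by
    intro j
    by_cases h : J₀ ≤ j
    · obtain ⟨a, ha⟩ := hJ₀ j h; exact ⟨a, fun _ => ha⟩
    · exact ⟨0, fun h' => absurd h' h⟩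
  choose a ha using hex
  obtain ⟨β, hβ⟩ := exists_limit hJ
    (fun j => if J₀ < j then algebraMap A (AdicCompletion J A) (a j) else 0)
  set u : ℕ → AdicCompletion J A := fun j => algebraMap R (AdicCompletion J A) (π ^ j) *
    (if J₀ < j then algebraMap A (AdicCompletion J A) (a j) else 0) with hu
  set S : ℕ → AdicCompletion J A := fun m => ∑ j ∈ Finset.range m, u j with hS
  have hS0 : S (J₀ + 1) = 0 := by
    refine Finset.sum_eq_zero fun j hj => ?_
    simp [hu, Nat.lt_succ_iff.1 (Finset.mem_range.1 hj)]
  obtain ⟨v, hv⟩ := (isUnit_pi (C := C) J (π := π)).pow J₀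
  set c : C := (↑v⁻¹ : C) * algebraMap R C (psum π F J₀) + algebraMap (AdicCompletion J A) C β
    with hc
  have hu' : ∀ j, J₀ < j → π ^ j • algebraMap (AdicCompletion J A) C (u j) =
      algebraMap R C (F j) := by
    intro j hj
    have h1 : algebraMap R (AdicCompletion J A) (F j) =
        algebraMap R (AdicCompletion J A) (π ^ j) * u j := by
      rw [← algebraMap_comp, ha j hj.le, map_mul, algebraMap_comp, two_mul, pow_add, map_mul]
      simp only [hu, hj, if_true, mul_assoc]
    rw [smul_algebraMap, ← h1, ← IsScalarTower.algebraMap_apply]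
  have key : ∀ j ≥ J₀, π ^ j • c - algebraMap R C (psum π F j) =
      π ^ j • algebraMap (AdicCompletion J A) C (β - S (j + 1)) := by
    intro j hj
    induction j, hj using Nat.le_induction with
    | base =>
      rw [hS0, sub_zero, hc, smul_add, Algebra.smul_def, map_pow, ← hv, Units.mul_inv_cancel_left,
        add_sub_cancel_left]
    | succ j hj ih =>
      have e : S (j + 1 + 1) = S (j + 1) + u (j + 1) := Finset.sum_range_succ _ _
      rw [e, psum, map_add, ← hu' (j + 1) (by omega), smul_eq_mul, map_mul, ← Algebra.smul_def,
        ← sub_sub, pow_succ', mul_smul, mul_smul, mul_smul, ← smul_sub, ih, ← sub_sub]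
      simp only [map_sub, smul_sub]
  refine ⟨c, fun s => ?_⟩
  -- Division by `π ^ i` turns slope `s + 2` for `F i` into slope `s + 1` for the summand `u i`.
  obtain ⟨J₁, hJ₁⟩ := Filter.eventually_atTop.1 (hF (s + 2))
  filter_upwards [Filter.eventually_ge_atTop (J₀ + J₁ + 1)] with j hj
  rw [key j (by omega)]
  have hu'' : ∀ i > j, algebraMap (AdicCompletion J A) C (u i) ∈ ball J π C (s * j) := by
    intro i hi
    have h1 := (algebraMap_mem_ball_iff (C := C) hA hJ (r := F i)).2 (hJ₁ i (by omega))
    rw [← hu' i (by omega), show (s + 2) * i = i + (s + 1) * i by ring, pow_smul_mem_ball] at h1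
    exact ball_anti (by nlinarith) h1
  obtain ⟨b, hb⟩ := hβ (j + 1 + s * j)
  have h2 : β - S (j + 1) = algebraMap R (AdicCompletion J A) (π ^ (j + 1 + s * j)) * b +
      ∑ i ∈ Finset.Ico (j + 1) (j + 1 + s * j), u i := by
    rw [← hb]
    have := Finset.sum_range_add_sum_Ico u (show j + 1 ≤ j + 1 + s * j by omega)
    simp only [hS]
    rw [← this]
    ring
  refine Submodule.smul_mem _ _ ?_
  rw [h2, map_add, map_sum, ← smul_algebraMap]
  refine add_mem (ball_anti (by omega) (mem_ball.2 ⟨b, rfl⟩)) (Submodule.sum_mem _ fun i hi => ?_)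
  exact hu'' i (by have := (Finset.mem_Ico.1 hi).1; omega)

end CompletedLocalization

end

/-! ### Convergence of series `∑ π ^ (-j) F j` on the affinoids -/

section

namespace RigidFibre

open Filter CompletedLocalization

section Represents

variable {R : Type*} [CommRing R] {I : Ideal R} {π : R} {n : ℕ}

instance instSMulC (n : ℕ) : SMul R (C I π n) := Algebra.toSMul

instance instModuleC (n : ℕ) : Module R (C I π n) := Algebra.toModule

variable (I π n) in
/-- The submodule `π ^ t B n` of `C n`. -/
def ballC (t : ℕ) : Submodule R (C I π n) := ball (piIdeal I π n) π (C I π n) t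

theorem mem_ballC {t : ℕ} {c : C I π n} :
    c ∈ ballC I π n t ↔ ∃ b : B I π n, c = π ^ t • algebraMap (B I π n) (C I π n) b :=
  mem_ball (A := blowup I π n) (J := piIdeal I π n) (C := C I π n)

theorem ballC_anti {a b : ℕ} (h : a ≤ b) : ballC I π n b ≤ ballC I π n a :=
  ball_anti (A := blowup I π n) (J := piIdeal I π n) (C := C I π n) h

theorem pow_smul_mem_ballC_iff {a t : ℕ} {c : C I π n} :
    π ^ a • c ∈ ballC I π n (a + t) ↔ c ∈ ballC I π n t :=
  pow_smul_mem_ball (A := blowup I π n) (J := piIdeal I π n) (C := C I π n)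

theorem piIdeal_eq (n : ℕ) :
    piIdeal I π n = Ideal.span {algebraMap R (blowup I π n) π} := rfl

theorem algebraMap_mem_ballC_iff {t : ℕ} {r : R} :
    algebraMap R (C I π n) r ∈ ballC I π n t ↔
      ∃ a, algebraMap R (blowup I π n) r = algebraMap R (blowup I π n) (π ^ t) * a :=
  algebraMap_mem_ball_iff (A := blowup I π n) (J := piIdeal I π n) (C := C I π n)
    (algebraMap_blowup_mem_nonZeroDivisors n) (piIdeal_eq n)

theorem algebraMap_mem_ballC {t : ℕ} {r : R} (hr : r ∈ I ^ ((n + 1) * t)) :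
    algebraMap R (C I π n) r ∈ ballC I π n t :=
  algebraMap_mem_ballC_iff.2 (exists_pow_mul_of_mem_pow n t hr)

theorem eq_zero_of_forall_mem_ballC {c : C I π n} (h : ∀ t, c ∈ ballC I π n t) : c = 0 :=
  eq_zero_of_forall_mem_ball (A := blowup I π n) (J := piIdeal I π n) (C := C I π n)
    (algebraMap_blowup_mem_nonZeroDivisors n) (piIdeal_eq n) h

theorem exists_approx_C (c : C I π n) (t : ℕ) :
    ∃ (k : ℕ) (r : R), π ^ k • c - algebraMap R (C I π n) r ∈ ballC I π n (k + t) :=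
  exists_pow_smul_sub_mem_ball (A := blowup I π n) (piIdeal I π n) (C := C I π n) (piIdeal_eq n)
    (fun a => by
      obtain ⟨K, y, -, hy⟩ := mem_blowup a.2
      exact ⟨K, y, Subtype.ext hy⟩) _ _

theorem transition_mem_ballC {m n t : ℕ} (h : n ≤ m) {c : C I π m} (hc : c ∈ ballC I π m t) :
    transition I π h c ∈ ballC I π n t := by
  obtain ⟨b, hb⟩ := mem_ballC.1 hc
  refine mem_ballC.2 ⟨transitionB I π h b, ?_⟩
  rw [hb, map_smul]
  congr 1
  simp [transition, IsLocalization.liftAlgHom]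

variable (I π n) in
/-- The formal sum `∑ π ^ (-j) F j` converges to `c`. -/
def Represents (F : ℕ → R) (c : C I π n) : Prop :=
  ∀ s : ℕ, ∀ᶠ j in atTop, π ^ j • c - algebraMap R (C I π n) (psum π F j) ∈ ballC I π n (s * j)

theorem Represents.add {F G : ℕ → R} {c d : C I π n} (hF : Represents I π n F c)
    (hG : Represents I π n G d) : Represents I π n (F + G) (c + d) := fun s => by
  filter_upwards [hF s, hG s] with j h1 h2
  have := add_mem h1 h2
  rwa [← add_sub_add_comm, ← smul_add, ← map_add, ← Pi.add_apply (psum π F), ← psum_add] at this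

theorem Represents.smul (r : R) {F : ℕ → R} {c : C I π n} (hF : Represents I π n F c) :
    Represents I π n (r • F) (r • c) := fun s => by
  filter_upwards [hF s] with j h1
  have := Submodule.smul_mem _ r h1
  rw [smul_sub, smul_comm] at this
  rw [psum_smul, Pi.smul_apply, smul_eq_mul, map_mul, ← Algebra.smul_def]
  exact this

theorem Represents.sub {F G : ℕ → R} {c d : C I π n} (hF : Represents I π n F c)
    (hG : Represents I π n G d) : Represents I π n (F - G) (c - d) := by
  simpa [sub_eq_add_neg] using hF.add (hG.smul (-1))

theorem Represents.zero : Represents I π n 0 0 := fun s => by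
  simp [psum_zero]

theorem Represents.sum {ι : Type*} (s : Finset ι) {F : ι → ℕ → R} {c : ι → C I π n}
    (hF : ∀ i ∈ s, Represents I π n (F i) (c i)) :
    Represents I π n (∑ i ∈ s, F i) (∑ i ∈ s, c i) := by
  classical
  induction s using Finset.induction_on with
  | empty => simpa using Represents.zero
  | insert a s ha ih =>
    rw [Finset.sum_insert ha, Finset.sum_insert ha]
    exact (hF a (Finset.mem_insert_self _ _)).add
      (ih fun i hi => hF i (Finset.mem_insert_of_mem hi))

theorem Represents.transition {m : ℕ} (h : n ≤ m) {F : ℕ → R} {c : C I π m}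
    (hF : Represents I π m F c) : Represents I π n F (transition I π h c) := fun s => by
  filter_upwards [hF s] with j h1
  have h2 := transition_mem_ballC h h1
  rwa [map_sub, map_smul, AlgHom.commutes] at h2

/-- `π ^ j c` agrees with the scaled partial sum modulo `π ^ ((t + 1) * j)`. The partial sum is
itself divisible by this power, because `I ^ ((n + 1) * k) ⊆ π ^ k B n`. Cancelling `π ^ j` leaves
`c` divisible by `π ^ (t * j)`. -/
theorem IsNull.eq_zero {F : ℕ → R} (hF : IsNull I π F) {c : C I π n}
    (h : Represents I π n F c) : c = 0 := by
  refine eq_zero_of_forall_mem_ballC fun t => ?_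
  obtain ⟨j, h1, h2, h3⟩ := ((h (t + 1)).and ((hF ((n + 1) * (t + 1))).and
    (eventually_ge_atTop 1))).exists
  rw [mem_pow_smul_top_self, mul_assoc] at h2
  have h4 := add_mem h1 (algebraMap_mem_ballC h2)
  rw [sub_add_cancel, add_mul, one_mul, add_comm, pow_smul_mem_ballC_iff] at h4
  exact ballC_anti (by nlinarith) h4

theorem Represents.unique {F : ℕ → R} {c d : C I π n} (hc : Represents I π n F c)
    (hd : Represents I π n F d) : c = d := by
  have h := hc.sub hd
  rw [sub_self] at h
  refine sub_eq_zero.1 (IsNull.eq_zero ?_ h)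
  rw [IsNull, psum_zero]
  exact IsEntire.zero

theorem IsEntire.exists_represents {F : ℕ → R} (hF : IsEntire I F) (n : ℕ) :
    ∃ c, Represents I π n F c := by
  refine exists_series_limit (A := blowup I π n) (J := piIdeal I π n) (C := C I π n)
    (algebraMap_blowup_mem_nonZeroDivisors n) (piIdeal_eq n) F fun s => ?_
  filter_upwards [hF ((n + 1) * s)] with j hj
  rw [mem_pow_smul_top_self, mul_assoc] at hj
  exact exists_pow_mul_of_mem_pow n _ hj

variable (π) in
/-- Every entire sequence converges to a global function. -/
theorem IsEntire.exists_Rrig {F : ℕ → R} (hF : IsEntire I F) :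
    ∃ f : Rrig I π, ∀ n, Represents I π n F (restrict I π n f) := by
  choose c hc using fun n => IsEntire.exists_represents (π := π) hF n
  exact ⟨⟨c, fun m n h => ((hc m).transition h).unique (hc n)⟩, hc⟩

theorem Rrig_ext {f g : Rrig I π} (h : ∀ n, restrict I π n f = restrict I π n g) : f = g :=
  Subtype.ext (funext h)

theorem transition_restrict {m n : ℕ} (h : n ≤ m) (f : Rrig I π) :
    transition I π h (restrict I π m f) = restrict I π n f := f.2 m n h

end Represents

end RigidFibre

end

/-! ### Series expansions of global functions -/

section

theorem psum_mem_pow {R : Type*} [CommRing R] {I : Ideal R} {π : R} (hπ : π ∈ I) {i : ℕ → R} (n : ℕ)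
    (hi : ∀ k ≤ n, i k ∈ I ^ k) : psum π i n ∈ I ^ n := by
  induction n with
  | zero => simp
  | succ n ih =>
    refine add_mem ?_ (hi _ le_rfl)
    rw [smul_eq_mul, pow_succ']
    exact Ideal.mul_mem_mul hπ (ih fun k hk => hi k (by omega))

theorem psum_add_of_eq_zero {R : Type*} [CommRing R] {π : R} {i : ℕ → R} {K : ℕ}
    (hi : ∀ k, K < k → i k = 0) (l : ℕ) : psum π i (K + l) = π ^ l * psum π i K := by
  induction l with
  | zero => simp
  | succ l ih => rw [← add_assoc, psum, ih, hi _ (by omega), add_zero, smul_eq_mul]; ring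

theorem exists_sum_limit {R : Type*} [CommRing R] (I : Ideal R) [IsAdicComplete I R] (a : ℕ → R)
    (ha : ∀ n, a n ∈ I ^ n) : ∃ L, ∀ m, L - ∑ n ∈ Finset.range m, a n ∈ I ^ m := by
  obtain ⟨L, hL⟩ := IsPrecomplete.prec' (I := I) (M := R) (fun m => ∑ n ∈ Finset.range m, a n) (by
    intro k m hkm
    rw [SModEq.comm, SModEq.sub_mem, ← Finset.sum_range_add_sum_Ico _ hkm, add_sub_cancel_left,
      mem_pow_smul_top_self]
    exact Ideal.sum_mem _ fun n hn => Ideal.pow_le_pow_right (Finset.mem_Ico.1 hn).1 (ha n))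
  refine ⟨L, fun m => ?_⟩
  rw [← mem_pow_smul_top_self, ← SModEq.sub_mem]
  exact (hL m).symm

open Filter in
/-- The sum of a sequence of finite sequences that tend to zero quickly is entire. -/
theorem exists_entire_series {R : Type*} [CommRing R] {I : Ideal R} {π : R} [IsAdicComplete I R]
    (hreg : π ∈ nonZeroDivisors R) (κ : ℕ → ℕ) (ρ : ℕ → R) (K : ℕ → ℕ) (D : ℕ → ℕ → R)
    (hD0 : ∀ n, D n 0 ∈ I ^ n) (hD1 : ∀ n, ∀ j ≥ 1, D n j ∈ I ^ ((n + 1) * (j + n)))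
    (hDK : ∀ n j, K n < j → D n j = 0)
    (hDx : ∀ n, ∀ j ≥ K n, π ^ j * (π ^ κ n * ρ (n + 1) - π ^ κ (n + 1) * ρ n) =
      π ^ (κ n + κ (n + 1)) * psum π (D n) j) :
    ∃ F : ℕ → R, IsEntire I F ∧ ∀ N, ∃ T : ℕ → R, T 0 ∈ I ^ N ∧
      (∀ j ≥ 1, T j ∈ I ^ ((N + 1) * (j + N))) ∧
      ∀ᶠ j in atTop, π ^ κ N * psum π F j = π ^ j * ρ N + π ^ κ N * psum π T j := by
  have hDn : ∀ n j, D n j ∈ I ^ n := by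
    intro n j
    rcases Nat.eq_zero_or_pos j with rfl | hj
    · exact hD0 n
    · exact Ideal.pow_le_pow_right (by nlinarith) (hD1 n j hj)
  choose L hL using fun j => exists_sum_limit I (fun n => D n j) (fun n => hDn n j)
  -- `H` is the one-term series for `ρ 0 / π ^ κ 0`, and `D n` is a series for the difference of the
  -- fractions `ρ (n + 1) / π ^ κ (n + 1)` and `ρ n / π ^ κ n`. By telescoping, `P N` is a finite
  -- series for `ρ N / π ^ κ N`.
  set H : ℕ → R := fun j => if j = κ 0 then ρ 0 else 0 with hH
  set P : ℕ → ℕ → R := fun N => H + ∑ n ∈ Finset.range N, D n with hP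
  have hP0 : ∀ N, ∀ᶠ j in atTop, P N j = 0 := by
    intro N
    induction N with
    | zero =>
      filter_upwards [eventually_gt_atTop (κ 0)] with j hj
      simp [hP, hH, hj.ne']
    | succ N ih =>
      filter_upwards [ih, eventually_gt_atTop (K N)] with j h1 h2
      simp only [hP, Finset.sum_range_succ] at h1 ⊢
      rw [← add_assoc, Pi.add_apply, h1, hDK N j h2, add_zero]
  have hPsum : ∀ N, ∀ᶠ j in atTop, π ^ κ N * psum π (P N) j = π ^ j * ρ N := by
    intro N
    induction N with
    | zero =>
      have hlt : ∀ j < κ 0, psum π H j = 0 := by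
        intro j hj
        induction j with
        | zero => simp [psum, hH, hj.ne]
        | succ j ih => rw [psum, ih (by omega)]; simp [hH, hj.ne]
      have heq : psum π H (κ 0) = ρ 0 := by
        rcases h : κ 0 with _ | k
        · simp [psum, hH, h]
        · rw [psum, hlt k (by omega)]; simp [hH, h]
      filter_upwards [eventually_ge_atTop (κ 0)] with j hj
      obtain ⟨l, rfl⟩ := Nat.exists_eq_add_of_le hj
      simp only [hP, Finset.range_zero, Finset.sum_empty, add_zero]
      rw [psum_add_of_eq_zero (fun k hk => by simp [hH, hk.ne']), heq]
      ring
    | succ N ih =>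
      filter_upwards [ih, eventually_ge_atTop (K N)] with j h1 h2
      have h3 := hDx N j h2
      have h4 : P (N + 1) = P N + D N := by
        simp only [hP, Finset.sum_range_succ, add_assoc]
      rw [h4, psum_add, Pi.add_apply]
      refine (mul_cancel_left_mem_nonZeroDivisors (pow_mem hreg (κ N))).1 ?_
      linear_combination π ^ κ (N + 1) * h1 - h3
  set F : ℕ → R := H + L with hF
  set T : ℕ → ℕ → R := fun N => F - P N with hT
  have hTL : ∀ N j, T N j = L j - ∑ n ∈ Finset.range N, D n j := by
    intro N j
    simp [hT, hF, hP]
  have hT0 : ∀ N, T N 0 ∈ I ^ N := fun N => by rw [hTL]; exact hL 0 N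
  -- `L j` is compared with its partial sum of length `(N + 1) * (j + N)`: the remainder lies in
  -- that power of `I` by the choice of `L`, and so does each summand with index at least `N`.
  have hT1 : ∀ N, ∀ j ≥ 1, T N j ∈ I ^ ((N + 1) * (j + N)) := by
    intro N j hj
    have hle : N ≤ (N + 1) * (j + N) := by nlinarith
    have h1 := hL j ((N + 1) * (j + N))
    rw [← Finset.sum_range_add_sum_Ico _ hle, ← sub_sub, ← hTL] at h1
    have h2 : ∑ n ∈ Finset.Ico N ((N + 1) * (j + N)), D n j ∈ I ^ ((N + 1) * (j + N)) := by
      refine Ideal.sum_mem _ fun n hn => Ideal.pow_le_pow_right ?_ (hD1 n j hj)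
      have := (Finset.mem_Ico.1 hn).1
      gcongr
    simpa using add_mem h1 h2
  -- For a given slope `s`, the finite part `P s` has died out for large `j`, and only the tail `T
  -- s` is left.
  have hFent : IsEntire I F := by
    intro s
    filter_upwards [hP0 s, eventually_ge_atTop 1] with j h1 h2
    rw [mem_pow_smul_top_self]
    have h3 : F j = T s j := by simp [hT, h1]
    rw [h3]
    exact Ideal.pow_le_pow_right (by nlinarith) (hT1 s j h2)
  refine ⟨F, hFent, fun N => ⟨T N, hT0 N, hT1 N, ?_⟩⟩
  filter_upwards [hPsum N] with j h2
  have e4 : psum π F j = psum π (P N) j + psum π (T N) j := by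
    rw [← Pi.add_apply, ← psum_add]; simp [hT]
  rw [e4, mul_add, h2]

namespace RigidFibre

open Filter CompletedLocalization

section Expansion

variable {R : Type*} [CommRing R] {I : Ideal R} {π : R} {n : ℕ}

theorem pow_smul_mem_ballC {a t : ℕ} {c : C I π n} (h : c ∈ ballC I π n t) :
    π ^ a • c ∈ ballC I π n (a + t) :=
  pow_smul_mem_ballC_iff.2 h

/-- `x / π ^ e` is `π ^ n` times a finite series `∑ π ^ (-k) i k` with `i k ∈ I ^ ((n + 1) * k)`.
The factor `π ^ n` shifts the index by `n`; the terms with `k ≤ n` become integral and are collected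
into the coefficient of index `0`, which lies in `I ^ n` because `π ∈ I`. -/
theorem exists_finite_expansion (hreg : π ∈ nonZeroDivisors R) (hπ : π ∈ I) {e : ℕ} {x : R}
    (hx : algebraMap R (C I π n) x ∈ ballC I π n (e + n)) :
    ∃ (K : ℕ) (D : ℕ → R), D 0 ∈ I ^ n ∧ (∀ j ≥ 1, D j ∈ I ^ ((n + 1) * (j + n))) ∧
      (∀ j, K < j → D j = 0) ∧ ∀ j ≥ K, π ^ j * x = π ^ e * psum π D j := by
  obtain ⟨a, ha⟩ := algebraMap_mem_ballC_iff.1 hx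
  obtain ⟨K, y, hy, hay⟩ := mem_blowup a.2
  have hxy : π ^ K * x = π ^ (e + n) * y := by
    apply algebraMap_away_injective hreg
    have h' := congrArg (Subalgebra.val _) ha
    simp only [map_mul, AlgHom.commutes] at h' ⊢
    rw [h', ← hay]
    simp only [Subalgebra.coe_val]
    ring
  obtain ⟨i, h1, h2, rfl⟩ := exists_psum_of_mem_num_pow K hy
  have hD : ∀ j, psum π (fun j => if j = 0 then psum π i n else i (j + n)) j =
      psum π i (j + n) := by
    intro j
    induction j with
    | zero => simp [psum]
    | succ j ih => simp only [psum, ih]; rw [show j + 1 + n = j + n + 1 by ring, psum]; simp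
  refine ⟨K, fun j => if j = 0 then psum π i n else i (j + n), ?_, ?_, ?_, ?_⟩
  · simp only [if_true]
    exact psum_mem_pow hπ n fun k _ => Ideal.pow_le_pow_right (by nlinarith) (h1 k)
  · intro j hj
    simp only [show j ≠ 0 by omega, if_false]
    exact h1 _
  · intro j hj
    simp only [show j ≠ 0 by omega, if_false]
    exact h2 _ (by omega)
  · intro j hj
    obtain ⟨l, rfl⟩ := Nat.exists_eq_add_of_le hj
    rw [hD, add_assoc, psum_add_of_eq_zero h2]
    linear_combination π ^ l * hxy

theorem algebraMap_sub_mem_ballC {f : Rrig I π} {k l : ℕ} {r r' : R}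
    (h : π ^ k • restrict I π n f - algebraMap R (C I π n) r ∈ ballC I π n (k + n))
    (h' : π ^ l • restrict I π (n + 1) f - algebraMap R (C I π (n + 1)) r' ∈
      ballC I π (n + 1) (l + (n + 1))) :
    algebraMap R (C I π n) (π ^ k * r' - π ^ l * r) ∈ ballC I π n (k + l + n) := by
  have h1 := transition_mem_ballC (Nat.le_add_right n 1) h'
  rw [map_sub, map_smul, AlgHom.commutes, transition_restrict] at h1
  have h1' := ballC_anti (show k + l + n ≤ k + (l + (n + 1)) by omega)
    (pow_smul_mem_ballC (a := k) h1)
  have h2' := ballC_anti (show k + l + n ≤ l + (k + n) by omega)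
    (pow_smul_mem_ballC (a := l) h)
  have h3 := sub_mem h2' h1'
  rw [smul_sub, smul_sub, smul_comm, sub_sub_sub_cancel_left] at h3
  rw [map_sub, map_mul, map_mul, ← Algebra.smul_def, ← Algebra.smul_def]
  exact h3

theorem sub_mem_ballC_of_represents {F T : ℕ → R} {c d : C I π n} {N k t : ℕ} {r : R}
    (hN : N = n + (n + 1) * t + t) (hc : Represents I π n F c)
    (hd : π ^ k • d - algebraMap R (C I π n) r ∈ ballC I π n (k + N))
    (hT0 : T 0 ∈ I ^ N) (hT1 : ∀ j ≥ 1, T j ∈ I ^ ((N + 1) * (j + N)))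
    (hF : ∀ᶠ j in atTop, π ^ k * psum π F j = π ^ j * r + π ^ k * psum π T j) :
    c - d ∈ ballC I π n t := by
  -- The three summands of `N` are used here: `N ≥ (n + 1) * t` for `T 0`, and `N ≥ n`, `N ≥ t` for
  -- the later coefficients.
  have hTball : ∀ j, algebraMap R (C I π n) (psum π T j) ∈ ballC I π n (j + t) := by
    intro j
    induction j with
    | zero =>
      rw [zero_add]
      exact algebraMap_mem_ballC (Ideal.pow_le_pow_right (by omega) hT0)
    | succ j ih =>
      rw [psum, map_add, smul_eq_mul, map_mul, ← Algebra.smul_def]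
      refine add_mem ?_ (algebraMap_mem_ballC (Ideal.pow_le_pow_right ?_ (hT1 _ (by omega))))
      · have := pow_smul_mem_ballC (a := 1) ih
        rw [pow_one] at this
        exact ballC_anti (by omega) this
      · exact Nat.mul_le_mul (by omega) (by omega)
  obtain ⟨j, h1, h2, h3⟩ := ((hc 2).and (hF.and (eventually_ge_atTop t))).exists
  refine (pow_smul_mem_ballC_iff (a := k + j)).1 ?_
  have e1 := ballC_anti (show k + j + t ≤ k + 2 * j by omega) (pow_smul_mem_ballC (a := k) h1)
  have e2 := ballC_anti (show k + j + t ≤ k + (j + t) by omega)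
    (pow_smul_mem_ballC (a := k) (hTball j))
  have e3 := ballC_anti (show k + j + t ≤ j + (k + N) by omega)
    (pow_smul_mem_ballC (a := j) hd)
  have e5 := congrArg (algebraMap R (C I π n)) h2
  have e6 := sub_mem (add_mem e1 e2) e3
  convert e6 using 1
  simp only [Algebra.smul_def, map_mul, map_add, map_pow, pow_add] at e5 ⊢
  linear_combination e5

/-- Every global function is the sum of a series `∑ π ^ (-j) F j` with entire coefficients. -/
theorem exists_isEntire_represents [IsAdicComplete I R] (hreg : π ∈ nonZeroDivisors R)
    (hπ : π ∈ I) (f : Rrig I π) :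
    ∃ F : ℕ → R, IsEntire I F ∧ ∀ n, Represents I π n F (restrict I π n f) := by
  -- The precision grows with the level, so that the fractions approximating `f` on consecutive
  -- affinoids differ on the smaller one by an element of `π ^ n B n`.
  choose κ ρ hρ using fun n => exists_approx_C (restrict I π n f) n
  choose K D hD0 hD1 hDK hDx using fun n =>
    exists_finite_expansion hreg hπ (algebraMap_sub_mem_ballC (hρ n) (hρ (n + 1)))
  obtain ⟨F, hF, hFT⟩ := exists_entire_series hreg κ ρ K D hD0 hD1 hDK hDx
  obtain ⟨g, hg⟩ := IsEntire.exists_Rrig π hF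
  refine ⟨F, hF, ?_⟩
  suffices g = f from this ▸ hg
  refine Rrig_ext fun n => sub_eq_zero.1 (eq_zero_of_forall_mem_ballC fun t => ?_)
  obtain ⟨T, hT0, hT1, hT⟩ := hFT (n + (n + 1) * t + t)
  -- Restriction to the fixed `Sp C n` keeps the precision of an approximation made at a much higher
  -- level.
  have hf := transition_mem_ballC (show n ≤ n + (n + 1) * t + t by omega)
    (hρ (n + (n + 1) * t + t))
  rw [map_sub, map_smul, AlgHom.commutes, transition_restrict] at hf
  exact sub_mem_ballC_of_represents rfl (hg n) hf hT0 hT1 hT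

end Expansion

end RigidFibre

end

/-! ### From null sequences in `M` to zero elements of `M^rig` -/

section

namespace RigidFibre

open Filter

section Flatness

variable {R : Type*} [CommRing R] {I : Ideal R} {π : R}
variable {M : Type*} [AddCommGroup M] [Module R M]

variable (I π) in
/-- `∑ π ^ (-j) F j` converges to the global function `f`. -/
def GlobRep (F : ℕ → R) (f : Rrig I π) : Prop := ∀ n, Represents I π n F (restrict I π n f)

theorem GlobRep.smul (r : R) {F : ℕ → R} {f : Rrig I π} (h : GlobRep I π F f) :
    GlobRep I π (r • F) (r • f) := fun n => by
  rw [map_smul]; exact (h n).smul r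

theorem GlobRep.sum {ι : Type*} (s : Finset ι) {F : ι → ℕ → R} {f : ι → Rrig I π}
    (h : ∀ i ∈ s, GlobRep I π (F i) (f i)) : GlobRep I π (∑ i ∈ s, F i) (∑ i ∈ s, f i) := fun n => by
  rw [map_sum]; exact Represents.sum s fun i hi => h i hi n

theorem GlobRep.eq_of_isNull_sub {F G : ℕ → R} {f g : Rrig I π} (hf : GlobRep I π F f)
    (hg : GlobRep I π G g) (h : IsNull I π (F - G)) : f = g :=
  Rrig_ext fun n => sub_eq_zero.1 (IsNull.eq_zero h ((hf n).sub (hg n)))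

/-- If a sequence of combinations of the `m i` with entire coefficients has sum zero, then up to
sequences with sum zero the coefficients are combinations of relations among the `m i`. -/
theorem IsNull.exists_relations [IsNoetherianRing R] {b : ℕ}
    (m : Fin b → M) (hm : Submodule.span R (Set.range m) = ⊤)
    (F : Fin b → ℕ → R) (hF : ∀ i, IsEntire I (F i))
    (hnull : IsNull I π (fun j => ∑ i, F i j • m i)) :
    ∃ (l : ℕ) (h : Fin l → ℕ → R) (k : Fin l → Fin b → R), (∀ a, IsEntire I (h a)) ∧
      (∀ a, ∑ i, k a i • m i = 0) ∧ ∀ i, IsNull I π (F i - ∑ a, k a i • h a) := by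
  set φ : (Fin b → R) →ₗ[R] M := Fintype.linearCombination R m with hφ
  have hφs : Function.Surjective φ := by
    rw [← LinearMap.range_eq_top, Fintype.range_linearCombination, hm]
  -- Lifting the partial sums, rather than the sequence, yields the null sequence `pdiff π H` in `R
  -- ^ b` with the same image in `M` as the coefficients. The difference is then a sequence of
  -- relations.
  obtain ⟨H, hH, hHφ⟩ := IsEntire.exists_lift φ hφs hnull
  set Ft : ℕ → Fin b → R := fun j i => F i j with hFt
  have hFtent : IsEntire I Ft := isEntire_pi fun i => hF i
  have hφF : φ ∘ (Ft - pdiff π H) = 0 := by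
    have h1 : φ ∘ pdiff π H = φ ∘ Ft := by
      rw [← pdiff_map, hHφ, pdiff_psum]
      ext j
      simp [hφ, hFt, Fintype.linearCombination_apply]
    ext j
    have := congrFun h1 j
    simp only [Function.comp_apply, Pi.sub_apply, map_sub, Pi.zero_apply] at this ⊢
    rw [this, sub_self]
  -- The sequence of relations is entire in the kernel itself by Artin–Rees, hence lifts to entire
  -- coefficients on finitely many generating relations.
  obtain ⟨l, κ, hκ⟩ := Module.Finite.exists_fin' R (LinearMap.ker φ)
  set E : ℕ → LinearMap.ker φ := fun j => ⟨(Ft - pdiff π H) j, congrFun hφF j⟩ with hE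
  have hEent : IsEntire I E :=
    IsEntire.of_map (LinearMap.ker φ).subtype Subtype.val_injective (hFtent.sub hH.pdiff)
  obtain ⟨h, hh, hhE⟩ := IsEntire.exists_lift κ hκ hEent
  have hhent : ∀ a, IsEntire I (fun j => h j a) := fun a => hh.map (LinearMap.proj a : (Fin l → R) →ₗ[R] R)
  set k : Fin l → Fin b → R := fun a => (κ (Pi.single a 1) : LinearMap.ker φ) with hk
  have hkφ : ∀ a, ∑ i, k a i • m i = 0 := by
    intro a
    have := (κ (Pi.single a 1)).2
    rw [LinearMap.mem_ker] at this
    exact this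
  have hEk : ∀ j, (Ft - pdiff π H) j = ∑ a, h j a • k a := by
    intro j
    have h1 := congrArg Subtype.val (congrFun hhE j)
    have h2 : κ (h j) = ∑ a, h j a • κ (Pi.single a 1) := by
      conv_lhs => rw [← LinearMap.sum_single_apply (φ := fun _ => R) (h j)]
      rw [map_sum]
      refine Finset.sum_congr rfl fun a _ => ?_
      rw [← map_smul]
      congr 1
      rw [← Pi.single_smul, smul_eq_mul, mul_one]
    rw [Function.comp_apply, h2] at h1
    simpa [hE, hk] using h1.symm
  refine ⟨l, fun a j => h j a, k, hhent, hkφ, fun i => ?_⟩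
  have : F i - ∑ a, k a i • (fun j => h j a) =
      (LinearMap.proj i : (Fin b → R) →ₗ[R] R) ∘ pdiff π H := by
    ext j
    have := congrFun (hEk j) i
    simp only [hFt, Pi.sub_apply, Finset.sum_apply, Pi.smul_apply, smul_eq_mul] at this
    simp only [Pi.sub_apply, Finset.sum_apply, Pi.smul_apply, smul_eq_mul, Function.comp_apply,
      LinearMap.proj_apply]
    rw [sub_eq_iff_eq_add, ← sub_eq_iff_eq_add', this]
    exact Finset.sum_congr rfl fun a _ => mul_comm _ _
  change IsNull I π (F i - ∑ a, k a i • (fun j => h j a))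
  rw [this, IsNull, psum_map, psum_pdiff]
  exact hH.map _

/-- An element of `M^rig` vanishes if the sequence in `M` that represents it has sum zero. -/
theorem sum_tmul_eq_zero_of_isNull [IsNoetherianRing R] {b : ℕ}
    (m : Fin b → M) (hm : Submodule.span R (Set.range m) = ⊤) (f : Fin b → Rrig I π)
    (F : Fin b → ℕ → R) (hF : ∀ i, IsEntire I (F i)) (hFf : ∀ i, GlobRep I π (F i) (f i))
    (hnull : IsNull I π (fun j => ∑ i, F i j • m i)) :
    ∑ i, f i ⊗ₜ[R] m i = 0 := by
  obtain ⟨l, h, k, hh, hk, hnull'⟩ := IsNull.exists_relations m hm F hF hnull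
  choose g hg using fun a => IsEntire.exists_Rrig π (hh a)
  have hf : ∀ i, f i = ∑ a, k a i • g a := fun i =>
    (hFf i).eq_of_isNull_sub (GlobRep.sum Finset.univ fun a _ => GlobRep.smul (k a i) (hg a))
      (hnull' i)
  simp_rw [hf, TensorProduct.sum_tmul, TensorProduct.smul_tmul]
  rw [Finset.sum_comm]
  refine Finset.sum_eq_zero fun a _ => ?_
  rw [← TensorProduct.tmul_sum, hk, TensorProduct.tmul_zero]

end Flatness

theorem exists_eq_sum_tmul {R : Type*} [CommRing R] {S : Type*} [CommRing S] [Algebra R S]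
    {M : Type*} [AddCommGroup M] [Module R M] {b : ℕ} (m : Fin b → M)
    (hm : Submodule.span R (Set.range m) = ⊤) (z : S ⊗[R] M) :
    ∃ f : Fin b → S, ∑ i, f i ⊗ₜ[R] m i = z := by
  induction z using TensorProduct.induction_on with
  | zero => exact ⟨0, by simp⟩
  | tmul x y =>
    have hy : y ∈ Submodule.span R (Set.range m) := hm ▸ trivial
    obtain ⟨c, rfl⟩ := (Submodule.mem_span_range_iff_exists_fun R).1 hy
    exact ⟨fun i => c i • x, by simp [TensorProduct.tmul_sum, TensorProduct.smul_tmul]⟩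
  | add x y hx hy =>
    obtain ⟨f, rfl⟩ := hx
    obtain ⟨g, rfl⟩ := hy
    exact ⟨f + g, by simp [TensorProduct.add_tmul, Finset.sum_add_distrib]⟩

/-- An element of `M^rig` vanishes as soon as all its images in `R^rig` under linear forms on `M`
vanish, provided that `M` embeds into a free module. -/
theorem eq_zero_of_forall_lTensor {R : Type*} [CommRing R] [IsNoetherianRing R] {I : Ideal R}
    [IsAdicComplete I R] {π : R} (hreg : π ∈ nonZeroDivisors R) (hπ : π ∈ I)
    {M : Type*} [AddCommGroup M] [Module R M] [Module.Finite R M] {N : ℕ}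
    (ψ : M →ₗ[R] Fin N → R) (hψ : Function.Injective ψ) (z : Mrig I π M)
    (hz : ∀ φ : M →ₗ[R] R, ∀ F : ℕ → R, IsEntire I F →
      GlobRep I π F (TensorProduct.rid R (Rrig I π) (φ.lTensor (Rrig I π) z)) → IsNull I π F) :
    z = 0 := by
  obtain ⟨b, m, hm⟩ := Module.Finite.exists_fin (R := R) (M := M)
  obtain ⟨f, rfl⟩ := exists_eq_sum_tmul m hm z
  choose F hF hFf using fun i => exists_isEntire_represents hreg hπ (f i)
  refine sum_tmul_eq_zero_of_isNull m hm f F hF hFf (IsNull.of_map ψ hψ ?_)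
  rw [IsNull]
  refine isEntire_pi fun a => ?_
  have h1 := hz ((LinearMap.proj a : (Fin N → R) →ₗ[R] R) ∘ₗ ψ) (∑ i, ψ (m i) a • F i)
    (IsEntire.sum _ fun i _ => (hF i).smul _) (by
      simp only [map_sum, LinearMap.lTensor_tmul, TensorProduct.rid_tmul]
      exact GlobRep.sum _ fun i _ => GlobRep.smul _ (hFf i))
  have h2 : (fun j => psum π (ψ ∘ fun j => ∑ i, F i j • m i) j a) =
      (LinearMap.proj a : (Fin N → R) →ₗ[R] R) ∘ psum π (ψ ∘ fun j => ∑ i, F i j • m i) := rfl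
  rw [h2, ← psum_map]
  have h3 : (LinearMap.proj a : (Fin N → R) →ₗ[R] R) ∘ (ψ ∘ fun j => ∑ i, F i j • m i) =
      ∑ i, ψ (m i) a • F i := by
    ext j
    simp [mul_comm]
  rw [h3]
  exact h1

end RigidFibre

end

section

/-! ### Cohen–Macaulay modules are torsionless -/

section Torsionless

open Submodule

/-- The first member `r` of the sequence is not in `p`. The submodule `K` killed by `p` is not
contained in `r M`: otherwise regularity of `r` gives `K = r K`, and Nakayama gives `K = 0`. An
element of `K` outside `r M` yields an associated prime of `M / r M` containing `p` and `r`, which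
lowers the dimension by at least one. -/
theorem IsAssociatedPrime.length_le_ringKrullDim {R : Type*} [CommRing R] [IsLocalRing R]
    [IsNoetherianRing R] (rs : List R) :
    ∀ {M : Type*} [AddCommGroup M] [Module R M] [Module.Finite R M],
      (∀ r ∈ rs, r ∈ IsLocalRing.maximalIdeal R) → RingTheory.Sequence.IsRegular M rs →
      ∀ {p : Ideal R}, IsAssociatedPrime p M → (rs.length : WithBot ℕ∞) ≤ ringKrullDim (R ⧸ p) := by
  induction rs with
  | nil =>
    intro M _ _ _ _ _ p hp
    have := hp.isPrime
    simpa using ringKrullDim_nonneg_of_nontrivial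
  | cons r rs ih =>
    intro M _ _ _ hrs hreg p hp
    rw [RingTheory.Sequence.isRegular_cons_iff] at hreg
    obtain ⟨hp', x, hx⟩ := isAssociatedPrime_iff.1 hp
    have hrm : r ∈ IsLocalRing.maximalIdeal R := hrs r (by simp)
    have hrp : r ∉ p := fun h => by
      rw [hx, mem_colon_singleton, mem_bot] at h
      have hx0 : x = 0 := hreg.1 (by simpa using h)
      exact hp'.ne_top (by rw [hx, hx0]; ext; simp [mem_colon_singleton])
    -- the submodule of elements killed by `p`
    let K : Submodule R M :=
      { carrier := {m | ∀ a ∈ p, a • m = 0}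
        add_mem' := fun {u v} hu hv a ha => by rw [smul_add, hu a ha, hv a ha, add_zero]
        zero_mem' := fun a _ => smul_zero a
        smul_mem' := fun c m hm a ha => by rw [smul_comm, hm a ha, smul_zero] }
    have hK : ∃ m ∈ K, ¬ ∃ m' : M, m = r • m' := by
      by_contra! hcon
      have hle : K ≤ ⊥ ⊔ Ideal.span {r} • K := by
        intro m hm
        obtain ⟨m', rfl⟩ := hcon m hm
        refine mem_sup_right (smul_mem_smul (Ideal.mem_span_singleton_self r) fun a ha => ?_)
        have h1 := hm a ha
        rw [smul_comm] at h1
        exact hreg.1 (by simpa using h1)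
      have hbot := le_of_le_smul_of_le_jacobson_bot (IsNoetherian.noetherian K)
        (by rw [IsLocalRing.jacobson_eq_maximalIdeal _ bot_ne_top, Ideal.span_singleton_le_iff_mem]
            exact hrm) hle
      have hxK : x ∈ K := fun a ha => by
        rwa [hx, mem_colon_singleton, mem_bot] at ha
      have hx0 : x = 0 := by simpa using hbot hxK
      exact hp'.ne_top (by rw [hx, hx0]; ext; simp [mem_colon_singleton])
    obtain ⟨m, hmK, hm⟩ := hK
    have hm0 : (Submodule.Quotient.mk m : QuotSMulTop r M) ≠ 0 := fun h => hm <| by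
      rw [Submodule.Quotient.mk_eq_zero, mem_smul_pointwise_iff_exists] at h
      obtain ⟨m', -, h⟩ := h
      exact ⟨m', h.symm⟩
    obtain ⟨p', hp1, hp2⟩ := exists_le_isAssociatedPrime_of_isNoetherianRing R _ hm0
    have hpp : p ≤ p' := fun a ha => hp2 <| by
      rw [mem_colon_singleton, mem_bot, ← Submodule.Quotient.mk_smul, hmK a ha,
        Submodule.Quotient.mk_zero]
    have hrp' : r ∈ p' := hp2 <| by
      rw [mem_colon_singleton, mem_bot, ← Submodule.Quotient.mk_smul, Submodule.Quotient.mk_eq_zero]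
      exact smul_mem_pointwise_smul _ _ _ mem_top
    have h1 := ih (fun s hs => hrs s (by simp [hs])) hreg.2 hp1
    have h2 : ringKrullDim (R ⧸ p') + 1 ≤ ringKrullDim (R ⧸ p) :=
      ringKrullDim_succ_le_of_surjective (Ideal.Quotient.factor hpp)
        (Ideal.Quotient.factor_surjective hpp) (r := Ideal.Quotient.mk p r)
        (mem_nonZeroDivisors_of_ne_zero fun h => hrp (Ideal.Quotient.eq_zero_iff_mem.1 h))
        (by rw [Ideal.Quotient.factor_mk]; exact Ideal.Quotient.eq_zero_iff_mem.2 hrp')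
    refine le_trans ?_ h2
    rw [List.length_cons, Nat.cast_add, Nat.cast_one]
    gcongr

/-- A strict inclusion of a minimal prime in `p` would force `dim R + 1 ≤ dim R`, and `dim R` is
finite. -/
theorem Ideal.mem_minimalPrimes_of_ringKrullDim_le {R : Type*} [CommRing R] [IsLocalRing R]
    [IsNoetherianRing R] {p : Ideal R} [hp : p.IsPrime]
    (h : ringKrullDim R ≤ ringKrullDim (R ⧸ p)) : p ∈ minimalPrimes R := by
  obtain ⟨q, hq, hqp⟩ := Ideal.exists_minimalPrimes_le (bot_le : ⊥ ≤ p)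
  have := hq.1.1
  by_contra hne
  have hlt : ∃ r ∈ p, r ∉ q := by
    by_contra! hcon
    exact hne (le_antisymm hqp hcon ▸ hq)
  obtain ⟨r, hrp, hrq⟩ := hlt
  have h2 : ringKrullDim (R ⧸ p) + 1 ≤ ringKrullDim (R ⧸ q) :=
    ringKrullDim_succ_le_of_surjective (Ideal.Quotient.factor hqp)
      (Ideal.Quotient.factor_surjective hqp) (r := Ideal.Quotient.mk q r)
      (mem_nonZeroDivisors_of_ne_zero fun h => hrq (Ideal.Quotient.eq_zero_iff_mem.1 h))
      (by rw [Ideal.Quotient.factor_mk]; exact Ideal.Quotient.eq_zero_iff_mem.2 hrp)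
  have h3 : ringKrullDim (R ⧸ q) ≤ ringKrullDim R :=
    ringKrullDim_le_of_surjective _ Ideal.Quotient.mk_surjective
  have h4 : ringKrullDim R + 1 ≤ ringKrullDim R := ((add_le_add_left h 1).trans h2).trans h3
  have h5 := ringKrullDim_lt_top (R := R)
  have h6 := ringKrullDim_nonneg_of_nontrivial (R := R)
  revert h4 h5 h6
  generalize ringKrullDim R = d
  induction d with
  | bot => simp
  | coe d =>
    induction d with
    | top => simp
    | coe d => intro h _ _; norm_cast at h; omega

/-- Faithfulness makes the dimension of the support equal to `dim R`, and the depth is at most `dim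
R ⧸ p` for every associated prime `p`. -/
theorem IsCohenMacaulayModule.mem_minimalPrimes {R : Type*} [CommRing R] [IsLocalRing R]
    [IsNoetherianRing R] {M : Type*} [AddCommGroup M] [Module R M] [Module.Finite R M]
    [FaithfulSMul R M] (hM : IsCohenMacaulayModule R M) {p : Ideal R}
    (hp : IsAssociatedPrime p M) : p ∈ minimalPrimes R := by
  rcases hM with hM | hM
  · exact absurd hp not_isAssociatedPrime_of_subsingleton
  have := hp.isPrime
  refine Ideal.mem_minimalPrimes_of_ringKrullDim_le ?_
  have h1 : Module.supportDim R M = ringKrullDim R := by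
    rw [Module.supportDim_eq_ringKrullDim_quotient_annihilator,
      Module.annihilator_eq_bot.2 inferInstance]
    exact (ringKrullDim_eq_of_ringEquiv (RingEquiv.quotientBot R))
  rw [← h1, ← hM, localDepth]
  have h2 := ringKrullDim_nonneg_of_nontrivial (R := R ⧸ p)
  generalize hd : ringKrullDim (R ⧸ p) = d at h2
  induction d with
  | bot => simp at h2
  | coe d =>
    refine WithBot.coe_le_coe.2 (iSup₂_le fun rs hrs => ?_)
    have := IsAssociatedPrime.length_le_ringKrullDim rs hrs.1 hrs.2 hp
    rw [hd] at this
    exact WithBot.coe_le_coe.1 this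

theorem Ideal.exists_mul_eq_zero_of_mem_minimalPrimes {R : Type*} [CommRing R] [IsReduced R]
    {p : Ideal R} (hp : p ∈ minimalPrimes R) {x : R} (hx : x ∈ p) : ∃ s ∉ p, s * x = 0 := by
  have := hp.1.1
  have hle : p.map (algebraMap R (Localization.AtPrime p)) ≤ nilradical _ := by
    rw [nilradical_eq_sInf, le_sInf_iff]
    intro q hq
    obtain ⟨h₁, h₂⟩ := ((IsLocalization.AtPrime.orderIsoOfPrime _ p) ⟨q, hq⟩).2
    rw [Ideal.map_le_iff_le_comap]
    exact hp.2 ⟨h₁, bot_le⟩ h₂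
  obtain ⟨n, hn⟩ := mem_nilradical.1 (hle (Ideal.mem_map_of_mem _ hx))
  rw [← map_pow, IsLocalization.map_eq_zero_iff p.primeCompl] at hn
  obtain ⟨s, hs⟩ := hn
  refine ⟨s, s.2, IsNilpotent.eq_zero ⟨n + 1, ?_⟩⟩
  linear_combination (s : R) ^ n * x * hs

/-- Some multiple `c • m` has annihilator a prime `p`, which is minimal, so `R_p` is a field and `c
• m` survives in the vector space `M_p`. A linear form on `M_p` not killing it comes from `M → R`
after clearing a denominator, as `M` is finitely presented. -/
theorem exists_dual_ne_zero_of_isAssociatedPrime {R : Type*} [CommRing R] [IsNoetherianRing R]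
    [IsReduced R] {M : Type*} [AddCommGroup M] [Module R M] [Module.Finite R M]
    (hM : ∀ p : Ideal R, IsAssociatedPrime p M → p ∈ minimalPrimes R) {m : M} (hm : m ≠ 0) :
    ∃ φ : M →ₗ[R] R, φ m ≠ 0 := by
  have : Nontrivial (span R {m}) := nontrivial_span_singleton hm
  obtain ⟨p, hp⟩ := associatedPrimes.nonempty R (span R {m})
  have hpM := hp.map_of_injective (span R {m}).subtype (subtype_injective _)
  have hmin := hM p hpM
  obtain ⟨hp', ⟨x, hxm⟩, hx⟩ := isAssociatedPrime_iff.1 hp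
  obtain ⟨c, rfl⟩ := mem_span_singleton.1 hxm
  have hx' : ∀ a : R, a • c • m = 0 → a ∈ p := fun a ha => by
    rw [hx, mem_colon_singleton, mem_bot]
    exact Subtype.ext ha
  suffices h : ∃ φ : M →ₗ[R] R, φ (c • m) ≠ 0 by
    obtain ⟨φ, hφ⟩ := h
    exact ⟨φ, fun h => hφ (by rw [map_smul, h, smul_zero])⟩
  have hfield : IsField (Localization.AtPrime p) := by
    rw [IsLocalRing.isField_iff_maximalIdeal_eq, ← Localization.AtPrime.map_eq_maximalIdeal,
      Ideal.map_eq_bot_iff_le_ker]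
    intro y hy
    obtain ⟨s, hs, hsy⟩ := Ideal.exists_mul_eq_zero_of_mem_minimalPrimes hmin hy
    rw [RingHom.mem_ker, IsLocalization.map_eq_zero_iff p.primeCompl]
    exact ⟨⟨s, hs⟩, hsy⟩
  let := hfield.toField
  let f := LocalizedModule.mkLinearMap p.primeCompl M
  have hne : f (c • m) ≠ 0 := fun h => by
    rw [IsLocalizedModule.eq_zero_iff p.primeCompl f] at h
    obtain ⟨s, hs⟩ := h
    exact s.2 (hx' _ hs)
  obtain ⟨ℓ, hℓ⟩ := Module.Projective.exists_dual_ne_zero (Localization.AtPrime p) hne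
  have : Module.FinitePresentation R M := Module.finitePresentation_of_finite R M
  obtain ⟨φ, s, hφ⟩ := Module.FinitePresentation.exists_lift_of_isLocalizedModule p.primeCompl
    (Algebra.linearMap R (Localization.AtPrime p)) ((ℓ.restrictScalars R) ∘ₗ f)
  refine ⟨φ, fun h => hℓ ?_⟩
  have h1 := LinearMap.congr_fun hφ (c • m)
  rw [LinearMap.comp_apply, h, map_zero] at h1
  have h2 : (algebraMap R (Localization.AtPrime p) s) * ℓ (f (c • m)) = 0 := by
    rw [h1, ← Algebra.smul_def]; rfl
  exact ((IsLocalization.map_units (Localization.AtPrime p) s).mul_right_eq_zero).1 h2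

/-- The dual of `M` is finitely generated, and finitely many generators of it already separate the
elements of `M`. -/
theorem exists_injective_pi {R : Type*} [CommRing R] [IsNoetherianRing R]
    {M : Type*} [AddCommGroup M] [Module R M] [Module.Finite R M]
    (h : ∀ m : M, m ≠ 0 → ∃ φ : M →ₗ[R] R, φ m ≠ 0) :
    ∃ (N : ℕ) (ψ : M →ₗ[R] Fin N → R), Function.Injective ψ := by
  obtain ⟨N, s, hs⟩ := Module.Finite.exists_fin (R := R) (M := M →ₗ[R] R)
  refine ⟨N, LinearMap.pi s, (injective_iff_map_eq_zero _).2 fun m hm => ?_⟩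
  by_contra hne
  obtain ⟨φ, hφ⟩ := h m hne
  have hmem : φ ∈ span R (Set.range s) := hs ▸ mem_top
  suffices h0 : φ m = 0 from hφ h0
  clear hφ
  induction hmem using span_induction with
  | mem φ h =>
    obtain ⟨i, rfl⟩ := h
    exact congrFun hm i
  | zero => rfl
  | add u v _ _ hu hv => rw [LinearMap.add_apply, hu, hv, add_zero]
  | smul a u _ hu => rw [LinearMap.smul_apply, hu, smul_zero]

theorem IsCohenMacaulayModule.exists_injective_pi {R : Type*} [CommRing R] [IsLocalRing R]
    [IsNoetherianRing R] [IsReduced R] {M : Type*} [AddCommGroup M] [Module R M]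
    [Module.Finite R M] [FaithfulSMul R M] (hM : IsCohenMacaulayModule R M) :
    ∃ (N : ℕ) (ψ : M →ₗ[R] Fin N → R), Function.Injective ψ :=
  _root_.exists_injective_pi fun _ => exists_dual_ne_zero_of_isAssociatedPrime
    fun _ => hM.mem_minimalPrimes

end Torsionless


end

section

/-! ### Power series rings over a complete ring -/

namespace MvPowerSeries

open Finsupp

section Eval

variable {σ O A : Type*} [Finite σ] [CommRing O] [CommRing A]

theorem exists_eval (I : Ideal A) [IsAdicComplete I A] (φ : O →+* A) (x : σ → A)
    (hx : ∀ i, x i ∈ I) :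
    ∃ e : MvPowerSeries σ O →+* A, (∀ p : MvPolynomial σ O, e p = MvPolynomial.eval₂Hom φ x p) ∧
      ∀ n r, e r - MvPolynomial.eval₂Hom φ x (truncTotal n r) ∈ I ^ n := by
  have hle : ∀ n, MvPolynomial.idealOfVars σ O ^ n ≤
      (I ^ n).comap (MvPolynomial.eval₂Hom φ x) := fun n => by
    refine le_trans (Ideal.pow_right_mono ?_ n) (Ideal.le_comap_pow _ n)
    rw [MvPolynomial.idealOfVars, Ideal.span_le]
    rintro _ ⟨i, rfl⟩
    simpa using hx i
  let f : (n : ℕ) → MvPowerSeries σ O →+* A ⧸ I ^ n := fun n =>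
    (Ideal.quotientMap (I ^ n) (MvPolynomial.eval₂Hom φ x) (hle n)).comp
      (truncTotalAlgHom σ O n).toRingHom
  have hfa : ∀ n r, f n r = Ideal.Quotient.mk (I ^ n)
      (MvPolynomial.eval₂Hom φ x (truncTotal n r)) := fun n r => rfl
  have hf : ∀ {m n : ℕ} (h : m ≤ n), (Ideal.Quotient.factorPow I h).comp (f n) = f m := by
    intro m n h
    ext r
    rw [RingHom.comp_apply, hfa, hfa]
    refine Ideal.Quotient.eq.2 ?_
    rw [← map_sub]
    exact hle m (truncTotal_sub_truncTotal_mem_pow_idealOfVars h le_rfl r)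
  have hmk := IsAdicComplete.mk_liftRingHom I f hf
  have h2 : ∀ n r, IsAdicComplete.liftRingHom I f hf r -
      MvPolynomial.eval₂Hom φ x (truncTotal n r) ∈ I ^ n := fun n r => by
    rw [← Ideal.Quotient.eq, hmk, hfa]
  refine ⟨IsAdicComplete.liftRingHom I f hf, fun p => ?_, h2⟩
  have := (inferInstance : IsAdicComplete I A).toIsHausdorff
  rw [← sub_eq_zero]
  refine this.haus _ fun n => ?_
  rw [SModEq.zero, smul_eq_mul, Ideal.mul_top]
  have h3 : MvPolynomial.eval₂Hom φ x (truncTotal n (p : MvPowerSeries σ O)) -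
      MvPolynomial.eval₂Hom φ x p ∈ I ^ n := by
    rw [← map_sub]
    refine hle n ((MvPolynomial.mem_pow_idealOfVars_iff' ..).mpr fun y hy => ?_)
    rw [MvPolynomial.coeff_sub, coeff_truncTotal _ hy, MvPolynomial.coeff_coe, sub_self]
  have := add_mem (h2 n p) h3
  rwa [sub_add_sub_cancel] at this

end Eval

section Ideal

variable {σ O : Type*} [CommRing O] (ϖ : O)

variable (σ) in
/-- The ideal `(ϖ, X)` of the power series ring. -/
def varIdeal : Ideal (MvPowerSeries σ O) := Ideal.span {C ϖ} ⊔ Ideal.span (Set.range X)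

variable {ϖ}

/-- The series with this divisibility form ideals `K b` with `K a * K b ≤ K (a + b)`, and `K 1`
contains `ϖ` and the variables. -/
theorem dvd_coeff_of_mem_varIdeal_pow {b : ℕ} {r : MvPowerSeries σ O}
    (hr : r ∈ varIdeal σ ϖ ^ b) (α : σ →₀ ℕ) : ϖ ^ (b - degree α) ∣ coeff α r := by
  classical
  let K : ℕ → Ideal (MvPowerSeries σ O) := fun b =>
    { carrier := {r | ∀ α, ϖ ^ (b - degree α) ∣ coeff α r}
      add_mem' := fun hx hy α => by rw [map_add]; exact dvd_add (hx α) (hy α)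
      zero_mem' := fun α => by simp
      smul_mem' := fun c x hx α => by
        rw [smul_eq_mul, coeff_mul]
        refine Finset.dvd_sum fun p hp => Dvd.dvd.mul_left ((pow_dvd_pow _ ?_).trans (hx p.2)) _
        rw [Finset.HasAntidiagonal.mem_antidiagonal] at hp
        rw [← hp, map_add]
        omega }
  have h1 : varIdeal σ ϖ ≤ K 1 := by
    refine sup_le ?_ (Ideal.span_le.2 ?_)
    · rw [Ideal.span_singleton_le_iff_mem]
      intro α
      rw [coeff_C]
      split_ifs with h
      · exact (pow_dvd_pow ϖ (Nat.sub_le 1 _)).trans (pow_one ϖ).dvd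
      · exact dvd_zero _
    · rintro _ ⟨i, rfl⟩ α
      rw [coeff_X]
      split_ifs with h
      · simp [h]
      · exact dvd_zero _
  have hmul : ∀ a b, K a * K b ≤ K (a + b) := fun a b => by
    rw [Ideal.mul_le]
    intro u hu v hv α
    rw [coeff_mul]
    refine Finset.dvd_sum fun p hp => ?_
    refine (pow_dvd_pow ϖ ?_).trans ((pow_add ϖ (a - degree p.1) (b - degree p.2)).dvd.trans
      (mul_dvd_mul (hu p.1) (hv p.2)))
    rw [Finset.HasAntidiagonal.mem_antidiagonal] at hp
    rw [← hp, map_add]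
    omega
  have hle : ∀ b, varIdeal σ ϖ ^ b ≤ K b := fun b => by
    induction b with
    | zero => intro r _ α; simp
    | succ b ih => rw [pow_succ]; exact (Ideal.mul_mono ih h1).trans (hmul b 1)
  exact hle b hr α

theorem C_mem_varIdeal : C ϖ ∈ varIdeal σ ϖ :=
  Ideal.mem_sup_left (Ideal.mem_span_singleton_self _)

theorem X_mem_varIdeal (i : σ) : X i ∈ varIdeal σ ϖ :=
  Ideal.mem_sup_right (Ideal.subset_span ⟨i, rfl⟩)

theorem monomial_one_mem_varIdeal_pow (α : σ →₀ ℕ) :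
    monomial α (1 : O) ∈ varIdeal σ ϖ ^ degree α := by
  rw [monomial_one_eq, Finsupp.prod, degree_apply, ← Finset.prod_pow_eq_pow_sum]
  exact Ideal.prod_mem_prod fun i _ => Ideal.pow_mem_pow (X_mem_varIdeal i) _

theorem exists_le_degree_eq (β : σ →₀ ℕ) (b : ℕ) (h : b ≤ degree β) :
    ∃ α ≤ β, degree α = b := by
  obtain ⟨m, hm⟩ := exists_add_of_le h
  clear h
  induction m generalizing β with
  | zero => exact ⟨β, le_rfl, hm⟩
  | succ m ih =>
    have hβ : β ≠ 0 := by
      rintro rfl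
      simp at hm
    obtain ⟨i, hi⟩ := Finsupp.ne_iff.1 hβ
    have hle : single i 1 ≤ β := single_le_iff.2 (Nat.one_le_iff_ne_zero.2 hi)
    obtain ⟨γ, rfl⟩ := exists_add_of_le hle
    rw [map_add, degree_single] at hm
    obtain ⟨α, h1, h2⟩ := ih γ (by omega)
    exact ⟨α, h1.trans le_add_self, h2⟩

/-- Each exponent `β` is assigned to some `g β ≤ β`, namely `β` itself in degree at most `b` and one
of degree `b` above that. Grouping the terms by `g β` writes `r` as a finite sum of multiples of `ϖ
^ (b - |α|) X ^ α`. -/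
theorem mem_varIdeal_pow [Finite σ] {b : ℕ} {r : MvPowerSeries σ O}
    (h : ∀ α, ϖ ^ (b - degree α) ∣ coeff α r) : r ∈ varIdeal σ ϖ ^ b := by
  classical
  have hfin : {α : σ →₀ ℕ | degree α ≤ b}.Finite := by
    have := finite_of_degree_le (σ := σ) b
    exact this
  choose c hc using h
  have hg : ∀ β : σ →₀ ℕ, ∃ α ≤ β, degree α ≤ b ∧ (degree β ≤ b → α = β) ∧
      (b ≤ degree β → degree α = b) := fun β => by
    rcases le_total (degree β) b with h | h
    · exact ⟨β, le_rfl, h, fun _ => rfl, fun h' => le_antisymm h h'⟩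
    · obtain ⟨α, h1, h2⟩ := exists_le_degree_eq β b h
      refine ⟨α, h1, h2.le, fun h' => ?_, fun _ => h2⟩
      obtain ⟨γ, rfl⟩ := exists_add_of_le h1
      rw [map_add] at h'
      have : degree γ = 0 := by omega
      rw [(degree_eq_zero_iff γ).1 this, add_zero]
  choose g hg1 hg2 hg3 hg4 using hg
  let q : (σ →₀ ℕ) → MvPowerSeries σ O := fun α γ => if g (α + γ) = α then c (α + γ) else 0
  have key : r = ∑ α ∈ hfin.toFinset, C (ϖ ^ (b - degree α)) * (monomial α 1 * q α) := by
    ext β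
    rw [map_sum]
    simp_rw [coeff_C_mul, coeff_monomial_mul, one_mul]
    rw [Finset.sum_eq_single (g β)]
    · rw [if_pos (hg1 β)]
      change _ = _ * ite _ _ _
      rw [add_tsub_cancel_of_le (hg1 β), if_pos rfl, hc β]
      congr 2
      rcases le_total (degree β) b with h | h
      · rw [hg3 β h]
      · rw [hg4 β h]; omega
    · intro α _ hα
      split_ifs with hle
      · change _ * ite _ _ _ = _
        rw [add_tsub_cancel_of_le hle, if_neg (Ne.symm hα), mul_zero]
      · rw [mul_zero]
    · intro h
      exact absurd (hfin.mem_toFinset.2 (hg2 β)) h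
  rw [key]
  refine sum_mem fun α hα => ?_
  have hα' : degree α ≤ b := hfin.mem_toFinset.1 hα
  rw [← mul_assoc, map_pow]
  refine Ideal.mul_mem_right _ _ ?_
  have := Ideal.mul_mem_mul (Ideal.pow_mem_pow (C_mem_varIdeal (σ := σ) (ϖ := ϖ)) (b - degree α))
    (monomial_one_mem_varIdeal_pow (ϖ := ϖ) α)
  rwa [← pow_add, Nat.sub_add_cancel hα'] at this

/-- The coefficientwise description of the powers reduces this to `O`: a congruence modulo the power
`k + |α|` gives one modulo `ϖ ^ k` for the coefficient of `X ^ α`. -/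
instance isAdicComplete_varIdeal [Finite σ] [IsAdicComplete (Ideal.span {ϖ}) O] :
    IsAdicComplete (varIdeal σ ϖ) (MvPowerSeries σ O) where
  haus' r hr := by
    ext α
    refine IsHausdorff.haus (inferInstance : IsHausdorff (Ideal.span {ϖ}) O) _ fun n => ?_
    have h := hr (n + degree α)
    rw [SModEq.zero, smul_eq_mul, Ideal.mul_top] at h ⊢
    have h1 := dvd_coeff_of_mem_varIdeal_pow h α
    rw [Nat.add_sub_cancel] at h1
    rwa [Ideal.span_singleton_pow, Ideal.mem_span_singleton]
  prec' f hf := by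
    have hf' : ∀ {m n : ℕ}, m ≤ n → ∀ α, ϖ ^ (m - degree α) ∣ coeff α (f m) - coeff α (f n) := by
      intro m n hmn α
      have := hf hmn
      rw [SModEq.sub_mem, smul_eq_mul, Ideal.mul_top] at this
      simpa using dvd_coeff_of_mem_varIdeal_pow this α
    have hL : ∀ α, ∃ L : O, ∀ k, ϖ ^ k ∣ coeff α (f (k + degree α)) - L := fun α => by
      obtain ⟨L, hL⟩ := IsPrecomplete.prec (inferInstance : IsPrecomplete (Ideal.span {ϖ}) O)
        (f := fun k => coeff α (f (k + degree α))) (by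
          intro m n hmn
          rw [SModEq.sub_mem, smul_eq_mul, Ideal.mul_top, Ideal.span_singleton_pow,
            Ideal.mem_span_singleton]
          simpa using hf' (Nat.add_le_add_right hmn (degree α)) α)
      refine ⟨L, fun k => ?_⟩
      have := hL k
      rwa [SModEq.sub_mem, smul_eq_mul, Ideal.mul_top, Ideal.span_singleton_pow,
            Ideal.mem_span_singleton] at this
    choose L hL using hL
    let L' : MvPowerSeries σ O := L
    refine ⟨L', fun n => ?_⟩
    rw [SModEq.sub_mem, smul_eq_mul, Ideal.mul_top]
    refine mem_varIdeal_pow fun α => ?_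
    rcases le_total (degree α) n with h | h
    · have := hL α (n - degree α)
      rwa [Nat.sub_add_cancel h] at this
    · rw [Nat.sub_eq_zero_of_le h, pow_zero]
      exact one_dvd _

end Ideal

end MvPowerSeries

end

section

/-! ### The identity theorem on the open polydisc -/

section Divisibility

open Filter

theorem psum_eq_sum {R : Type*} [CommRing R] (π : R) (F : ℕ → R) (j : ℕ) :
    psum π F j = ∑ i ∈ Finset.range (j + 1), π ^ (j - i) * F i := by
  induction j with
  | zero => simp [psum]
  | succ j ih =>
    rw [psum, ih, Finset.sum_range_succ _ (j + 1), Nat.sub_self, pow_zero, one_mul, smul_eq_mul,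
      Finset.mul_sum]
    congr 1
    refine Finset.sum_congr rfl fun i hi => ?_
    rw [Nat.sub_add_comm (Nat.lt_succ_iff.1 (Finset.mem_range.1 hi)), pow_succ', mul_assoc]

theorem dvd_psum {R : Type*} [CommRing R] {π b : R} {F : ℕ → R} {j : ℕ}
    (h : ∀ i ≤ j, b ∣ π ^ (j - i) * F i) : b ∣ psum π F j := by
  rw [psum_eq_sum]
  exact Finset.dvd_sum fun i hi => h i (Nat.lt_succ_iff.1 (Finset.mem_range.1 hi))

theorem psum_comp_apply {R R' : Type*} [CommRing R] [CommRing R'] (e : R →+ R') {π : R} {π' : R'}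
    (h : ∀ x, e (π * x) = π' * e x) (F : ℕ → R) (j : ℕ) :
    psum π' (e ∘ F) j = e (psum π F j) := by
  induction j with
  | zero => rfl
  | succ j ih => rw [psum, psum, ih, map_add, smul_eq_mul, smul_eq_mul, h]; rfl

variable {O : Type*} [CommRing O] {ϖ : O}

theorem mem_span_singleton_pow_smul_top {n : ℕ} {x : O} :
    x ∈ (Ideal.span {ϖ} ^ n • ⊤ : Submodule O O) ↔ ϖ ^ n ∣ x := by
  rw [smul_eq_mul, Ideal.mul_top, Ideal.span_singleton_pow, Ideal.mem_span_singleton]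

/-- A nonzero sum has finite valuation: once a partial sum fails slope `s` at an index where the
terms already have slope `s + 1`, later terms cannot repair it. -/
theorem exists_eventually_not_dvd_psum [IsDomain O] (hϖ : ϖ ≠ 0) {u : ℕ → O}
    (hu : IsEntire (Ideal.span {ϖ}) u) (hn : ¬ IsNull (Ideal.span {ϖ}) ϖ u) :
    ∃ A, ∀ᶠ j in atTop, ¬ ϖ ^ (j + A) ∣ psum ϖ u j := by
  simp only [IsNull, IsEntire, mem_span_singleton_pow_smul_top, not_forall,
    not_eventually] at hn hu
  obtain ⟨s, hs⟩ := hn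
  obtain ⟨J, hJ⟩ := eventually_atTop.1 (hu (s + 1))
  obtain ⟨j₀, hj₀, hs⟩ := frequently_atTop.1 hs J
  refine ⟨s * j₀, eventually_atTop.2 ⟨j₀, fun j hj => ?_⟩⟩
  have key : ∀ l, ¬ ϖ ^ (s * j₀ + l) ∣ psum ϖ u (j₀ + l) := fun l => by
    induction l with
    | zero => exact hs
    | succ l ih =>
      intro h
      rw [← add_assoc j₀, psum] at h
      have h1 : ϖ ^ (s * j₀ + (l + 1)) ∣ u (j₀ + l + 1) :=
        (pow_dvd_pow _ (by nlinarith)).trans (hJ _ (by omega))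
      rw [dvd_add_left h1, ← add_assoc, pow_succ', smul_eq_mul] at h
      exact ih ((mul_dvd_mul_iff_left hϖ).1 h)
  obtain ⟨l, rfl⟩ := exists_add_of_le hj
  exact fun h => key l ((pow_dvd_pow _ (by omega)).trans h)

/-- The weights are built from the last variable backwards, so that one extra power of a variable
outweighs, by at least `B`, all that `α` contains in later variables. -/
theorem exists_weights (d : ℕ) (α : Fin d → ℕ) (B : ℕ) :
    ∃ k : Fin d → ℕ, (∀ i, 1 ≤ k i) ∧ ∀ i, B + ∑ l, (if i < l then k l * α l else 0) ≤ k i := by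
  induction d with
  | zero => exact ⟨0, fun i => i.elim0, fun i => i.elim0⟩
  | succ d ih =>
    obtain ⟨k, hk1, hk2⟩ := ih (fun i => α i.succ)
    refine ⟨Fin.cons (1 + B + ∑ l, k l * α l.succ) k, Fin.cases ?_ ?_, Fin.cases ?_ ?_⟩
    · simp only [Fin.cons_zero]; omega
    · simpa using hk1
    · rw [Fin.sum_univ_succ]
      simp only [lt_self_iff_false, if_false, Fin.succ_pos, if_true, Fin.cons_succ, Fin.cons_zero]
      omega
    · intro i
      rw [Fin.sum_univ_succ]
      simpa using hk2 i

theorem weights_lt {d : ℕ} {α β : Fin d → ℕ} {B : ℕ} {k : Fin d → ℕ}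
    (hk : ∀ i, B + ∑ l, (if i < l then k l * α l else 0) ≤ k i) {i : Fin d}
    (h1 : ∀ l < i, α l = β l) (h2 : α i < β i) : B + ∑ l, k l * α l ≤ ∑ l, k l * β l := by
  have h3 : ∑ l, k l * α l + k i ≤ ∑ l, (if i < l then k l * α l else 0) + ∑ l, k l * β l := by
    rw [← Finset.sum_add_distrib, ← Finset.sum_ite_eq_of_mem Finset.univ i k (Finset.mem_univ i),
      ← Finset.sum_add_distrib]
    refine Finset.sum_le_sum fun l _ => ?_
    rcases lt_trichotomy l i with h | rfl | h
    · rw [if_neg h.ne', if_neg h.not_gt, h1 l h]; omega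
    · rw [if_pos rfl, if_neg (lt_irrefl _)]; nlinarith
    · rw [if_neg h.ne, if_pos h]; omega
  have := hk i
  omega

end Divisibility

namespace MvPowerSeries

open Filter Finsupp

variable {O : Type*} [CommRing O] {ϖ : O}

section Coefficients

variable {σ : Type*}

theorem coeff_psum (h : ℕ → MvPowerSeries σ O) (α : σ →₀ ℕ) (j : ℕ) :
    psum ϖ (coeff α ∘ h) j = coeff α (psum (C ϖ : MvPowerSeries σ O) h j) :=
  psum_comp_apply (coeff α).toAddMonoidHom (fun x => by simp) h j

theorem isEntire_coeff {h : ℕ → MvPowerSeries σ O} (hh : IsEntire (varIdeal σ ϖ) h)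
    (α : σ →₀ ℕ) : IsEntire (Ideal.span {ϖ}) (coeff α ∘ h) := fun s => by
  filter_upwards [hh (s + 1), eventually_ge_atTop (degree α)] with j hj hα
  rw [mem_span_singleton_pow_smul_top]
  rw [mem_pow_smul_top_self] at hj
  refine (pow_dvd_pow _ ?_).trans (dvd_coeff_of_mem_varIdeal_pow hj α)
  rw [Nat.add_mul, one_mul]
  omega

/-- When the coefficient series sums to zero, a partial sum is minus its tail, and the tail is
bounded by the entire sequence `h` uniformly in `α`. The uniform threshold for `j` is what
reassembling the coefficients needs. -/
theorem eventually_dvd_coeff_psum_of_isNull {h : ℕ → MvPowerSeries σ O} [IsDomain O] (hϖ : ϖ ≠ 0)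
    (hh : IsEntire (varIdeal σ ϖ) h) (s : ℕ) :
    ∀ᶠ j in atTop, ∀ α, IsNull (Ideal.span {ϖ}) ϖ (coeff α ∘ h) →
      ϖ ^ (s * j - degree α) ∣ coeff α (psum (C ϖ : MvPowerSeries σ O) h j) := by
  obtain ⟨J, hJ⟩ := eventually_atTop.1 (hh (s + 1))
  refine eventually_atTop.2 ⟨J, fun j hj α hα => ?_⟩
  rcases le_total (s * j) (degree α) with hle | hle
  · rw [Nat.sub_eq_zero_of_le hle, pow_zero]
    exact one_dvd _
  obtain ⟨m, hm, hjm⟩ := ((hα (s + 1)).and (eventually_ge_atTop j)).exists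
  obtain ⟨m, rfl⟩ := exists_add_of_le hjm
  rw [mem_span_singleton_pow_smul_top, psum_add_index] at hm
  have h1 : ϖ ^ (m + (s * j - degree α)) ∣
      psum ϖ (fun i => if i = 0 then 0 else (coeff α ∘ h) (j + i)) m := by
    refine dvd_psum fun i hi => ?_
    split_ifs with h0
    · simp
    · have h2 := hJ (j + i) (by omega)
      rw [mem_pow_smul_top_self] at h2
      refine (pow_dvd_pow _ ?_).trans ((pow_add ϖ (m - i) _).dvd.trans
        (mul_dvd_mul_left _ (dvd_coeff_of_mem_varIdeal_pow h2 α)))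
      have : (s + 1) * (j + i) = s * j + s * i + j + i := by ring
      omega
  have h3 : ϖ ^ (m + (s * j - degree α)) ∣ ϖ ^ ((s + 1) * (j + m)) := pow_dvd_pow _ (by
    have : (s + 1) * (j + m) = s * j + s * m + j + m := by ring
    omega)
  have h4 := (dvd_add_left h1).1 (h3.trans hm)
  rw [pow_add, smul_eq_mul, coeff_psum] at h4
  exact (mul_dvd_mul_iff_left (pow_ne_zero _ hϖ)).1 h4

/-- This bounds the denominators of all coefficients of the sum: at most `ϖ ^ (J + |α|)` at `X ^ α`.
-/
theorem exists_dvd_coeff_psum {h : ℕ → MvPowerSeries σ O} (hh : IsEntire (varIdeal σ ϖ) h) :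
    ∃ J, ∀ j α, ϖ ^ (j - (J + degree α)) ∣ coeff α (psum (C ϖ : MvPowerSeries σ O) h j) := by
  obtain ⟨J, hJ⟩ := eventually_atTop.1 (hh 1)
  refine ⟨J, fun j α => ?_⟩
  rw [← coeff_psum]
  refine dvd_psum fun i hi => ?_
  rcases le_total J i with h1 | h1
  · have h2 := hJ i h1
    rw [mem_pow_smul_top_self] at h2
    refine (pow_dvd_pow _ ?_).trans ((pow_add ϖ (j - i) _).dvd.trans
        (mul_dvd_mul_left _ (dvd_coeff_of_mem_varIdeal_pow h2 α)))
    omega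
  · exact Dvd.dvd.mul_right (pow_dvd_pow _ (by omega)) _

theorem isNull_of_coeff [Finite σ] {h : ℕ → MvPowerSeries σ O} [IsDomain O] (hϖ : ϖ ≠ 0)
    (hh : IsEntire (varIdeal σ ϖ) h) (hn : ∀ α, IsNull (Ideal.span {ϖ}) ϖ (coeff α ∘ h)) :
    IsNull (varIdeal σ ϖ) (C ϖ) h := fun s => by
  filter_upwards [eventually_dvd_coeff_psum_of_isNull hϖ hh s] with j hj
  rw [mem_pow_smul_top_self]
  exact mem_varIdeal_pow fun α => hj α (hn α)

end Coefficients

theorem dvd_eval {d : ℕ} {a : Fin d → O} {e : MvPowerSeries (Fin d) O →+* O}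
    (he : ∀ n r, e r - MvPolynomial.eval₂Hom (RingHom.id O) a (truncTotal n r) ∈
      Ideal.span {ϖ} ^ n)
    {B : ℕ} {r : MvPowerSeries (Fin d) O}
    (h : ∀ α, ϖ ^ B ∣ coeff α r * ∏ i, a i ^ α i) : ϖ ^ B ∣ e r := by
  have h1 := he B r
  rw [Ideal.span_singleton_pow, Ideal.mem_span_singleton] at h1
  refine (dvd_sub_right ?_).1 ((dvd_neg.2 h1).trans (neg_sub _ _).dvd) |> fun h => h
  rw [MvPolynomial.coe_eval₂Hom, MvPolynomial.eval₂_eq']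
  refine Finset.dvd_sum fun α _ => ?_
  rw [coeff_truncTotal_eq_ite]
  split_ifs
  · exact h α
  · simp

/-- If some coefficient is not null, take the lexicographically smallest such exponent `α` and
evaluate at powers of `ϖ` weighted so that the term of `X ^ α` strictly dominates. The value there
is then not null. -/
theorem isNull_of_forall_eval [IsDomain O] (hϖ : ϖ ≠ 0) [IsAdicComplete (Ideal.span {ϖ}) O]
    {d : ℕ} {h : ℕ → MvPowerSeries (Fin d) O} (hh : IsEntire (varIdeal (Fin d) ϖ) h)
    (hn : ∀ e : MvPowerSeries (Fin d) O →+* O, (∀ c, e (C c) = c) →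
      (∀ i, e (X i) ∈ Ideal.span {ϖ}) → IsNull (Ideal.span {ϖ}) ϖ (e ∘ h)) :
    IsNull (varIdeal (Fin d) ϖ) (C ϖ) h := by
  by_contra hcon
  have hex : ∃ α : Lex (Fin d →₀ ℕ), ¬ IsNull (Ideal.span {ϖ}) ϖ (coeff (ofLex α) ∘ h) := by
    by_contra! hall
    exact hcon (isNull_of_coeff hϖ hh hall)
  have hwf := (Finsupp.Lex.wellFoundedLT_of_finite (α := Fin d) (N := ℕ)).wf
  obtain ⟨α', hα', hmin⟩ := hwf.has_min {α | ¬ IsNull (Ideal.span {ϖ}) ϖ (coeff (ofLex α) ∘ h)} hex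
  set α := ofLex α' with hαdef
  obtain ⟨A, hA⟩ := exists_eventually_not_dvd_psum hϖ (isEntire_coeff hh α) hα'
  obtain ⟨J, hJ⟩ := exists_dvd_coeff_psum hh
  obtain ⟨k, hk1, hk2⟩ := exists_weights d α (J + A + degree α + 1)
  -- The additional `1` contributes `|β|` to the valuation of `X ^ β`, which cancels the loss `|β|`
  -- in both coefficient bounds.
  let a : Fin d → O := fun i => ϖ ^ (k i + 1)
  have hprod : ∀ β : Fin d →₀ ℕ, ∏ i, a i ^ β i = ϖ ^ (∑ i, k i * β i + degree β) := fun β => by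
    simp only [a, ← pow_mul]
    rw [Finset.prod_pow_eq_pow_sum, degree_eq_sum, ← Finset.sum_add_distrib]
    congr 1
    exact Finset.sum_congr rfl fun i _ => by ring
  obtain ⟨e, he1, he2⟩ := exists_eval (Ideal.span {ϖ}) (RingHom.id O) a fun i =>
    Ideal.mem_span_singleton.2 (dvd_pow_self ϖ (Nat.succ_ne_zero _))
  have heC : ∀ c, e (C c) = c := fun c => by
    have := he1 (MvPolynomial.C c)
    simpa using this
  have heX : ∀ i, e (X i) = a i := fun i => by
    have := he1 (MvPolynomial.X i)
    simpa using this
  have hnull := hn e heC fun i => by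
    rw [heX]
    exact Ideal.mem_span_singleton.2 (dvd_pow_self ϖ (Nat.succ_ne_zero _))
  set w := ∑ i, k i * α i + degree α with hw
  obtain ⟨j, h1, h2, h3, h4⟩ := ((hnull 2).and (hA.and
    ((eventually_dvd_coeff_psum_of_isNull hϖ hh 2).and (eventually_ge_atTop (A + w))))).exists
  rw [mem_span_singleton_pow_smul_top] at h1
  have hpe : psum ϖ (e ∘ h) j = e (psum (C ϖ : MvPowerSeries (Fin d) O) h j) :=
    psum_comp_apply e.toAddMonoidHom (fun x => by simp [heC]) h j
  rw [hpe] at h1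
  set G := psum (C ϖ : MvPowerSeries (Fin d) O) h j
  -- Null coefficients are divisible enough by the uniform bound, at slope `2`. The other exponents
  -- are lexicographically larger than `α` and are handled by the weights, whose margin covers the
  -- denominators and `A`.
  have hrest : ϖ ^ (j + A + w) ∣ e (G - monomial α (coeff α G)) := by
    refine dvd_eval he2 fun β => ?_
    rw [hprod, map_sub, coeff_monomial]
    split_ifs with hβ
    · rw [hβ, sub_self, zero_mul]; exact dvd_zero _
    rw [sub_zero]
    by_cases hβn : IsNull (Ideal.span {ϖ}) ϖ (coeff β ∘ h)
    · refine (pow_dvd_pow _ ?_).trans ((pow_add ϖ _ _).dvd.trans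
        (mul_dvd_mul_right (h3 β hβn) _))
      omega
    · have hlt : α' < toLex β := by
        have h5 : ¬ toLex β < α' := hmin (toLex β) hβn
        refine lt_of_le_of_ne (not_lt.1 h5) fun h6 => hβ ?_
        rw [hαdef, h6]; rfl
      obtain ⟨i, hi1, hi2⟩ := Finsupp.Lex.lt_iff.1 hlt
      have h6 : J + A + degree α + 1 + ∑ l, k l * α l ≤ ∑ l, k l * β l := weights_lt hk2 hi1 hi2
      refine (pow_dvd_pow _ ?_).trans ((pow_add ϖ _ _).dvd.trans
        (mul_dvd_mul_right (hJ j β) _))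
      omega
  have hmon : e (monomial α (coeff α G)) = coeff α G * ϖ ^ w := by
    have := he1 (MvPolynomial.monomial α (coeff α G))
    rw [MvPolynomial.coe_monomial] at this
    rw [this, MvPolynomial.coe_eval₂Hom, MvPolynomial.eval₂_monomial, Finsupp.prod_fintype _ _
      (fun i => pow_zero _), hprod]
    rfl
  have hfin : ϖ ^ (j + A + w) ∣ coeff α G * ϖ ^ w := by
    rw [← hmon]
    have : e (monomial α (coeff α G)) = e G - e (G - monomial α (coeff α G)) := by
      rw [map_sub, sub_sub_cancel]
    rw [this]
    exact dvd_sub ((pow_dvd_pow _ (by omega)).trans h1) hrest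
  rw [pow_add] at hfin
  apply h2
  rw [coeff_psum]
  exact (mul_dvd_mul_iff_right (pow_ne_zero _ hϖ)).1 hfin

end MvPowerSeries

end

section

/-! ### Complete modules and systems of parameters -/

section Complete

open Submodule

theorem IsPrecomplete.pi {R : Type*} [CommRing R] (I : Ideal R) {ι : Type*} [Finite ι]
    {M : Type*} [AddCommGroup M] [Module R M] [h : IsPrecomplete I M] :
    IsPrecomplete I (ι → M) where
  prec' f hf := by
    classical
    cases nonempty_fintype ι
    have h1 : ∀ i, ∃ L, ∀ n, f n i ≡ L [SMOD (I ^ n • ⊤ : Submodule R M)] := fun i =>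
      h.prec fun {m n} hmn => by
        have := hf hmn
        rw [SModEq.sub_mem] at this ⊢
        exact map_mem_pow_smul_top (LinearMap.proj i : (ι → M) →ₗ[R] M) this
    choose L hL using h1
    refine ⟨L, fun n => ?_⟩
    rw [SModEq.sub_mem]
    have : f n - L = ∑ i, LinearMap.single R (fun _ : ι => M) i (f n i - L i) := by
      ext i
      simp [Finset.sum_apply, Pi.single_apply]
    rw [this]
    refine sum_mem fun i _ => map_mem_pow_smul_top _ ?_
    rw [← SModEq.sub_mem]
    exact hL i n

/-- Complete Nakayama: generators modulo `I` generate, by successive approximation. -/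
theorem Module.Finite.of_span_sup_eq_top {R : Type*} [CommRing R] (I : Ideal R)
    [IsPrecomplete I R] {M : Type*} [AddCommGroup M] [Module R M] [IsHausdorff I M]
    (t : Finset M) (h : span R (t : Set M) ⊔ I • ⊤ = ⊤) : Module.Finite R M := by
  let f : (t → R) →ₗ[R] M := Fintype.linearCombination R (fun x : t => (x : M))
  have hf : LinearMap.range f = span R (t : Set M) := by
    rw [Fintype.range_linearCombination]
    simp
  have := IsPrecomplete.pi (M := R) I (ι := t)
  refine Module.Finite.of_surjective f (surjective_of_mkQ_comp_surjective (I := I) ?_)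
  rw [← LinearMap.range_eq_top, LinearMap.range_comp, hf,
    Submodule.map_mkQ_eq_top, sup_comm, h]

theorem IsAdicComplete.of_finite {R : Type*} [CommRing R] [IsNoetherianRing R] (I : Ideal R)
    [h : IsAdicComplete I R] (M : Type*) [AddCommGroup M] [Module R M] [Module.Finite R M] :
    IsAdicComplete I M := by
  have h1 := IsHausdorff.of_le_jacobson I M (IsAdicComplete.le_jacobson_bot I)
  obtain ⟨n, f, hf⟩ := Module.Finite.exists_fin' R M
  have := IsPrecomplete.pi (M := R) I (ι := Fin n)
  have h2 : IsPrecomplete I M := by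
    rw [← AdicCompletion.of_surjective_iff]
    intro y
    obtain ⟨z, rfl⟩ := AdicCompletion.map_surjective I hf y
    obtain ⟨x, rfl⟩ := AdicCompletion.of_surjective I _ z
    exact ⟨f x, by rw [AdicCompletion.map_of]⟩
  exact { h1, h2 with }

theorem IsAdicComplete.map_of_finite {R : Type*} [CommRing R] [IsNoetherianRing R] (I : Ideal R)
    [h : IsAdicComplete I R] (A : Type*) [CommRing A] [Algebra R A] [Module.Finite R A] :
    IsAdicComplete (I.map (algebraMap R A)) A :=
  (IsAdicComplete.map_algebraMap_iff I A).2 (IsAdicComplete.of_finite I A)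

end Complete

section Parameters

open IsLocalRing

variable {A : Type*} [CommRing A] [IsLocalRing A]

theorem IsLocalRing.exists_pow_le_of_mem_minimalPrimes [IsNoetherianRing A] {J : Ideal A}
    (h : maximalIdeal A ∈ J.minimalPrimes) : ∃ N, maximalIdeal A ^ N ≤ J := by
  refine Ideal.exists_pow_le_of_le_radical_of_fg ?_ (IsNoetherian.noetherian _)
  rw [Ideal.radical_eq_sInf, le_sInf_iff]
  rintro q ⟨hJq, hq⟩
  exact h.2 ⟨hq, hJq⟩ (le_maximalIdeal hq.ne_top)

theorem IsLocalRing.mem_minimalPrimes_of_pow_le {J : Ideal A} {N : ℕ} (h : J ≤ maximalIdeal A)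
    (hN : maximalIdeal A ^ N ≤ J) : maximalIdeal A ∈ J.minimalPrimes :=
  ⟨⟨inferInstance, h⟩, fun _ hq _ => hq.1.le_of_pow_le (hN.trans hq.2)⟩

/-- The `x i` lift a system of parameters of `A / ϖ`, and dividing by a nonzerodivisor lowers the
dimension by at least one. -/
theorem IsLocalRing.exists_parameters [IsNoetherianRing A] {ϖ : A} (hϖ : ϖ ∈ nonZeroDivisors A)
    (hm : ϖ ∈ maximalIdeal A) :
    ∃ (d : ℕ) (x : Fin d → A), (∀ i, x i ∈ maximalIdeal A) ∧
      (∃ N, maximalIdeal A ^ N ≤ Ideal.span {ϖ} ⊔ Ideal.span (Set.range x)) ∧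
      ((d + 1 : ℕ) : WithBot ℕ∞) ≤ ringKrullDim A := by
  have hne : Ideal.span {ϖ} ≠ ⊤ := fun h => by
    rw [Ideal.span_singleton_eq_top] at h
    exact (mem_maximalIdeal _).1 hm h
  have := Ideal.Quotient.nontrivial_iff.2 hne
  have hsurj : Function.Surjective (Ideal.Quotient.mk (Ideal.span {ϖ})) :=
    Ideal.Quotient.mk_surjective
  have := IsLocalRing.of_surjective' _ hsurj
  obtain ⟨s, hs, hcard⟩ := Ideal.exists_finset_card_eq_height_of_isNoetherianRing
    (maximalIdeal (A ⧸ Ideal.span {ϖ}))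
  choose y hy using fun i => hsurj (s.equivFin.symm i : A ⧸ Ideal.span {ϖ})
  have hmap : Ideal.map (Ideal.Quotient.mk (Ideal.span {ϖ})) (Ideal.span (Set.range y)) =
      Ideal.span s := by
    rw [Ideal.map_span, ← Set.range_comp]
    congr 1
    ext a
    simp only [Set.mem_range, Function.comp_apply, hy]
    constructor
    · rintro ⟨i, rfl⟩
      exact (s.equivFin.symm i).2
    · intro ha
      exact ⟨s.equivFin ⟨a, ha⟩, by simp⟩
  have hloc : ∀ a, Ideal.Quotient.mk (Ideal.span {ϖ}) a ∈ maximalIdeal (A ⧸ Ideal.span {ϖ}) ↔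
      a ∈ maximalIdeal A := fun a => by
    have : IsLocalHom (Ideal.Quotient.mk (Ideal.span {ϖ})) :=
      IsLocalHom.of_surjective _ hsurj
    rw [mem_maximalIdeal, mem_maximalIdeal, mem_nonunits_iff, mem_nonunits_iff, isUnit_map_iff]
  refine ⟨s.card, y, fun i => ?_, ?_, ?_⟩
  · rw [← hloc, hy]
    exact hs.1.2 (Ideal.subset_span (s.equivFin.symm i).2)
  · obtain ⟨N, hN⟩ := IsLocalRing.exists_pow_le_of_mem_minimalPrimes hs
    refine ⟨N, fun a ha => ?_⟩
    have h1 : Ideal.Quotient.mk (Ideal.span {ϖ}) a ∈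
        Ideal.map (Ideal.Quotient.mk (Ideal.span {ϖ})) (Ideal.span (Set.range y)) := by
      rw [hmap]
      refine hN ?_
      have h2 := Ideal.mem_map_of_mem (Ideal.Quotient.mk (Ideal.span {ϖ})) ha
      rw [Ideal.map_pow] at h2
      rwa [IsLocalRing.map_maximalIdeal_of_surjective _ hsurj] at h2
    rw [← Ideal.mem_comap, Ideal.comap_map_of_surjective' _ hsurj, Ideal.mk_ker] at h1
    rwa [sup_comm]
  · have h1 := ringKrullDim_quotient_succ_le_of_nonZeroDivisor hϖ
    rw [← IsLocalRing.maximalIdeal_height_eq_ringKrullDim, ← hcard] at h1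
    refine le_trans (le_of_eq ?_) h1
    push_cast
    rfl

end Parameters

namespace MvPowerSeries

open IsLocalRing

section Local

variable {O : Type*} [CommRing O] [IsLocalRing O] {ϖ : O}

theorem maximalIdeal_eq_varIdeal {σ : Type*} [Finite σ] (hϖ : maximalIdeal O = Ideal.span {ϖ}) :
    maximalIdeal (MvPowerSeries σ O) = varIdeal σ ϖ := by
  ext r
  rw [mem_maximalIdeal, mem_nonunits_iff, isUnit_iff_constantCoeff, ← mem_nonunits_iff,
    ← mem_maximalIdeal, hϖ, Ideal.mem_span_singleton]
  constructor
  · intro h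
    rw [← pow_one (varIdeal σ ϖ)]
    refine mem_varIdeal_pow fun α => ?_
    by_cases hα : Finsupp.degree α = 0
    · rw [(Finsupp.degree_eq_zero_iff α).1 hα]
      simpa using h
    · rw [Nat.sub_eq_zero_of_le (by omega), pow_zero]
      exact one_dvd _
  · intro h
    rw [← pow_one (varIdeal σ ϖ)] at h
    simpa using dvd_coeff_of_mem_varIdeal_pow h 0

theorem ringKrullDim_le_succ [IsNoetherianRing O] (hϖ : maximalIdeal O = Ideal.span {ϖ}) (d : ℕ) :
    ringKrullDim (MvPowerSeries (Fin d) O) ≤ ((d + 1 : ℕ) : WithBot ℕ∞) := by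
  refine (ringKrullDim_le_spanFinrank_maximalIdeal _).trans ?_
  rw [maximalIdeal_eq_varIdeal hϖ, varIdeal, ← Ideal.span_union]
  norm_cast
  refine (Submodule.spanFinrank_span_le_ncard_of_finite
    ((Set.finite_singleton _).union (Set.finite_range _))).trans ?_
  refine (Set.ncard_union_le _ _).trans ?_
  rw [Set.ncard_singleton, add_comm]
  refine Nat.add_le_add_right ?_ 1
  have := Set.ncard_image_le (f := (X : Fin d → MvPowerSeries (Fin d) O)) (Set.finite_univ)
  rw [Set.image_univ] at this
  simpa using this

end Local

section Normalization

variable {O : Type*} [CommRing O] {ϖ : O}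
variable {D : Type*} [CommRing D] [IsLocalRing D] [IsNoetherianRing D]

/-- Since `O` surjects onto the residue field of `D`, generators of the `i`-th power of the maximal
ideal over `D` generate it over the power series ring modulo the next power. Finitely many steps
reach the power `N`, and complete Nakayama finishes. -/
theorem finite_of_pow_le [Algebra O D] {d : ℕ} [IsAdicComplete (Ideal.span {ϖ}) O]
    (hres : Function.Surjective ((residue D).comp (algebraMap O D)))
    (e : MvPowerSeries (Fin d) O →+* D) (he : ∀ c, e (C c) = algebraMap O D c)
    (hm : (varIdeal (Fin d) ϖ).map e ≤ maximalIdeal D)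
    {N : ℕ} (hN : maximalIdeal D ^ N ≤ (varIdeal (Fin d) ϖ).map e) : e.Finite := by
  algebraize [e]
  let S := MvPowerSeries (Fin d) O
  have hH : IsHausdorff (varIdeal (Fin d) ϖ) D := by
    rw [← IsHausdorff.map_algebraMap_iff (S := D)]
    exact IsHausdorff.of_isLocalRing _ _ fun h => (maximalIdeal D).ne_top_iff_one.1
      (Ideal.IsPrime.ne_top inferInstance) (hm (show (1 : D) ∈ _ from h ▸ Submodule.mem_top))
  have step : ∀ i, ∃ t : Finset D, ((maximalIdeal D ^ i).restrictScalars S) ≤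
      Submodule.span S (t : Set D) ⊔ (maximalIdeal D ^ (i + 1)).restrictScalars S := fun i => by
    obtain ⟨t, ht⟩ := (IsNoetherian.noetherian (maximalIdeal D ^ i) : Submodule.FG _)
    refine ⟨t, fun y hy => ?_⟩
    have hy' : y ∈ Submodule.span D (t : Set D) := ht ▸ hy
    clear hy
    induction hy' using Submodule.span_induction with
    | mem y h => exact Submodule.mem_sup_left (Submodule.subset_span h)
    | zero => exact zero_mem _
    | add u v _ _ hu hv => exact add_mem hu hv
    | smul c y hy ih =>
      obtain ⟨o, ho⟩ := hres (residue D c)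
      have hc : c - algebraMap O D o ∈ maximalIdeal D := by
        rw [← residue_eq_zero_iff, map_sub, ← ho]
        simp
      have : c • y = (C o : S) • y + (c - algebraMap O D o) * y := by
        rw [Algebra.smul_def, ← he]
        change c * y = e (C o) * y + _
        ring
      rw [this]
      refine add_mem (Submodule.smul_mem _ _ ih) (Submodule.mem_sup_right ?_)
      rw [Submodule.restrictScalars_mem, pow_succ']
      exact Ideal.mul_mem_mul hc (ht ▸ hy)
  have key : ∀ i, ∃ t : Finset D, Submodule.span S (t : Set D) ⊔
      (maximalIdeal D ^ i).restrictScalars S = ⊤ := fun i => by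
    classical
    induction i with
    | zero => exact ⟨∅, by simp⟩
    | succ i ih =>
      obtain ⟨t, ht⟩ := ih
      obtain ⟨t', ht'⟩ := step i
      refine ⟨t ∪ t', top_le_iff.1 ?_⟩
      rw [← ht, Finset.coe_union, Submodule.span_union, sup_assoc]
      exact sup_le_sup_left ht' _
  obtain ⟨t, ht⟩ := key N
  refine Module.Finite.of_span_sup_eq_top (varIdeal (Fin d) ϖ) t (top_le_iff.1 ?_)
  rw [Ideal.smul_top_eq_map, ← ht]
  refine sup_le_sup_left (fun y hy => ?_) _
  exact hN hy

/-- A nonzero kernel would leave an image of dimension at most `d`. Its at most `d` parameters would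
generate an ideal of `D` primary to the maximal ideal, against `dim D ≥ d + 1`. -/
theorem injective_of_pow_le [IsLocalRing O] {d : ℕ} [IsDomain O] [IsNoetherianRing O]
    (hϖ : maximalIdeal O = Ideal.span {ϖ}) (e : MvPowerSeries (Fin d) O →+* D)
    (hm : (varIdeal (Fin d) ϖ).map e ≤ maximalIdeal D)
    {N : ℕ} (hN : maximalIdeal D ^ N ≤ (varIdeal (Fin d) ϖ).map e)
    (hd : ((d + 1 : ℕ) : WithBot ℕ∞) ≤ ringKrullDim D) : Function.Injective e := by
  rw [injective_iff_map_eq_zero]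
  by_contra! hcon
  obtain ⟨r, hr, hr0⟩ := hcon
  let S := MvPowerSeries (Fin d) O
  have : Nontrivial (S ⧸ RingHom.ker e) := Ideal.Quotient.nontrivial_iff.2 (RingHom.ker_ne_top e)
  have hsurj : Function.Surjective (Ideal.Quotient.mk (RingHom.ker e)) :=
    Ideal.Quotient.mk_surjective
  have := IsLocalRing.of_surjective' _ hsurj
  have hdim : ringKrullDim (S ⧸ RingHom.ker e) + 1 ≤ ((d + 1 : ℕ) : WithBot ℕ∞) :=
    (ringKrullDim_succ_le_of_surjective _ hsurj (mem_nonZeroDivisors_of_ne_zero hr0)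
      (Ideal.Quotient.eq_zero_iff_mem.2 hr)).trans (ringKrullDim_le_succ hϖ d)
  obtain ⟨s, hs, hcard⟩ := Ideal.exists_finset_card_eq_height_of_isNoetherianRing
    (maximalIdeal (S ⧸ RingHom.ker e))
  rw [← IsLocalRing.maximalIdeal_height_eq_ringKrullDim, ← hcard] at hdim
  have hsd : s.card ≤ d := by
    have : ((s.card + 1 : ℕ) : WithBot ℕ∞) ≤ ((d + 1 : ℕ) : WithBot ℕ∞) := by
      refine le_trans (le_of_eq ?_) hdim
      push_cast; rfl
    norm_cast at this
    omega
  obtain ⟨k, hk⟩ := IsLocalRing.exists_pow_le_of_mem_minimalPrimes hs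
  have hmax : maximalIdeal (S ⧸ RingHom.ker e) =
      (varIdeal (Fin d) ϖ).map (Ideal.Quotient.mk (RingHom.ker e)) := by
    rw [← maximalIdeal_eq_varIdeal hϖ]
    exact (IsLocalRing.map_maximalIdeal_of_surjective _ hsurj).symm
  let f : S ⧸ RingHom.ker e →+* D := RingHom.kerLift e
  have hfm : (maximalIdeal (S ⧸ RingHom.ker e)).map f = (varIdeal (Fin d) ϖ).map e := by
    rw [hmax, Ideal.map_map]
    congr 1
  have h1 : (Ideal.span (s : Set (S ⧸ RingHom.ker e))).map f ≤ maximalIdeal D :=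
    (Ideal.map_mono hs.1.2).trans (hfm.le.trans hm)
  have h2 : maximalIdeal D ^ (N * k) ≤ (Ideal.span (s : Set (S ⧸ RingHom.ker e))).map f := by
    rw [pow_mul]
    refine (Ideal.pow_right_mono hN k).trans ?_
    rw [← hfm, ← Ideal.map_pow]
    exact Ideal.map_mono hk
  have h3 := IsLocalRing.mem_minimalPrimes_of_pow_le h1 h2
  classical
  rw [Ideal.map_span, ← Finset.coe_image] at h3
  have h4 := Ideal.height_le_card_of_mem_minimalPrimes_span_finset h3
  rw [← IsLocalRing.maximalIdeal_height_eq_ringKrullDim] at hd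
  have h5 : ((d + 1 : ℕ) : ℕ∞) ≤ ((s.image f).card : ℕ∞) :=
    (WithBot.coe_le_coe.1 hd).trans h4
  have h6 := Finset.card_image_le (s := s) (f := f)
  norm_cast at h5
  omega

theorem exists_finite_injective [IsLocalRing O] [Algebra O D] [IsDomain O] [IsNoetherianRing O]
    (hϖ : maximalIdeal O = Ideal.span {ϖ}) [IsAdicComplete (Ideal.span {ϖ}) O]
    [IsAdicComplete (maximalIdeal D) D]
    (hres : Function.Surjective ((residue D).comp (algebraMap O D)))
    (hreg : algebraMap O D ϖ ∈ nonZeroDivisors D) (hmem : algebraMap O D ϖ ∈ maximalIdeal D) :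
    ∃ (d : ℕ) (e : MvPowerSeries (Fin d) O →+* D), Function.Injective e ∧ e.Finite ∧
      (∀ c, e (C c) = algebraMap O D c) ∧ (varIdeal (Fin d) ϖ).map e ≤ maximalIdeal D ∧
      ∃ N, maximalIdeal D ^ N ≤ (varIdeal (Fin d) ϖ).map e := by
  obtain ⟨d, x, hx, ⟨N, hN⟩, hd⟩ := IsLocalRing.exists_parameters hreg hmem
  obtain ⟨e, he, -⟩ := exists_eval (maximalIdeal D) (algebraMap O D) x hx
  have heC : ∀ c, e (C c) = algebraMap O D c := fun c => by
    simpa using he (MvPolynomial.C c)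
  have heX : ∀ i, e (X i) = x i := fun i => by
    simpa using he (MvPolynomial.X i)
  have hmap : (varIdeal (Fin d) ϖ).map e =
      Ideal.span {algebraMap O D ϖ} ⊔ Ideal.span (Set.range x) := by
    rw [varIdeal, Ideal.map_sup, Ideal.map_span, Ideal.map_span, Set.image_singleton, heC,
      ← Set.range_comp]
    congr 3
    ext i
    exact heX i
  have hm : (varIdeal (Fin d) ϖ).map e ≤ maximalIdeal D := by
    rw [hmap]
    refine sup_le ((Ideal.span_singleton_le_iff_mem _).2 hmem) (Ideal.span_le.2 ?_)
    rintro _ ⟨i, rfl⟩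
    exact hx i
  rw [← hmap] at hN
  exact ⟨d, e, injective_of_pow_le hϖ e hm hN hd, finite_of_pow_le hres e heC hm hN, heC, hm, N, hN⟩

end Normalization

end MvPowerSeries

end

section

/-! ### Points of the generic fibre -/

namespace RigidFibre

open Filter

section Points

variable {O : Type*} [CommRing O] {ϖ : O} {R : Type*} [CommRing R] [Algebra O R] {I : Ideal R} {π : R}
variable {K : Type*} [Field K] [Algebra O K] (ψ : R →ₐ[O] K) (hπ : algebraMap O R ϖ = π)
include hπ

theorem exists_blowup_hom (hϖ : algebraMap O K ϖ ≠ 0) {n : ℕ}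
    (hI : ∀ i ∈ I ^ (n + 1), ∃ t ∈ ψ.range, ψ i = ϖ • t) :
    ∃ g : blowup I π n →+* ψ.range,
      ∀ r, (g (algebraMap R _ r) : K) = ψ r := by
  have hψ : ψ π = algebraMap O K ϖ := by rw [← hπ, ψ.commutes]
  have hu : IsUnit ((ψ : R →+* K) π) := by
    rw [RingHom.coe_coe, hψ]
    exact hϖ.isUnit
  let g := IsLocalization.Away.lift (S := Localization.Away π) π hu
  have hg : ∀ r, g (algebraMap R _ r) = ψ r := fun r => IsLocalization.Away.lift_eq _ hu r
  have hmem : ∀ x ∈ blowup I π n, g x ∈ ψ.range.toSubring := by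
    intro x hx
    induction hx using Algebra.adjoin_induction with
    | mem x h =>
      obtain ⟨i, hi, hx⟩ := h
      obtain ⟨t, ht, hit⟩ := hI i hi
      have h1 : ψ π * g x = ψ i := by
        rw [← hg, ← map_mul, hx, hg]
      rw [hψ, hit, Algebra.smul_def] at h1
      rw [mul_left_cancel₀ hϖ h1]
      exact ht
    | algebraMap r => rw [hg]; exact ⟨r, rfl⟩
    | add u v _ _ hu hv => rw [map_add]; exact add_mem hu hv
    | mul u v _ _ hu hv => rw [map_mul]; exact mul_mem hu hv
  refine ⟨(g.comp (blowup I π n).val.toRingHom).codRestrict ψ.range.toSubring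
    fun x => hmem _ x.2, fun r => hg r⟩

/-- The image of `ψ` is finite over `O`, hence `ϖ`-adically complete, so the map from the blowup
algebra extends to its completion. -/
theorem exists_completion_hom [IsNoetherianRing O] [IsAdicComplete (Ideal.span {ϖ}) O]
    [Module.Finite O ψ.range] (hϖ : algebraMap O K ϖ ≠ 0) {n : ℕ}
    (hI : ∀ i ∈ I ^ (n + 1), ∃ t ∈ ψ.range, ψ i = ϖ • t) :
    ∃ g : B I π n →+* ψ.range, ∀ r, (g (algebraMap R _ r) : K) = ψ r := by
  obtain ⟨g, hg⟩ := exists_blowup_hom ψ hπ hϖ hI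
  have hcomp := IsAdicComplete.map_of_finite (Ideal.span {ϖ}) ψ.range
  set J := (Ideal.span {ϖ}).map (algebraMap O ψ.range) with hJ
  have hle : ∀ k, piIdeal I π n ^ k ≤ (J ^ k).comap g := fun k => by
    refine le_trans (Ideal.pow_right_mono ?_ k) (Ideal.le_comap_pow _ k)
    rw [piIdeal, Ideal.span_singleton_le_iff_mem, Ideal.mem_comap]
    have : g (algebraMap R _ π) = algebraMap O ψ.range ϖ :=
      Subtype.ext ((hg _).trans (by rw [← hπ, ψ.commutes]; rfl))
    rw [this]
    exact Ideal.mem_map_of_mem _ (Ideal.mem_span_singleton_self ϖ)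
  let f : (k : ℕ) → B I π n →+* ψ.range ⧸ J ^ k := fun k =>
    (Ideal.quotientMap (J ^ k) g (hle k)).comp
      (AdicCompletion.evalₐ (piIdeal I π n) k : _ →+* _)
  have hf : ∀ {k l : ℕ} (h : k ≤ l), (Ideal.Quotient.factorPow J h).comp (f l) = f k := by
    intro k l h
    ext x
    obtain ⟨y, rfl⟩ := AdicCompletion.mk_surjective _ _ x
    have h1 : Ideal.Quotient.mk (J ^ k) (g (y.val l)) = Ideal.Quotient.mk (J ^ k) (g (y.val k)) := by
      rw [Ideal.Quotient.eq, ← map_sub]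
      refine hle k ?_
      rw [← Ideal.Quotient.eq]
      exact AdicCompletion.Ideal.mk_eq_mk _ h y
    simpa [f] using h1
  refine ⟨IsAdicComplete.liftRingHom J f hf, fun r => ?_⟩
  have h2 : IsAdicComplete.liftRingHom J f hf (algebraMap R _ r) = g (algebraMap R _ r) := by
    rw [← sub_eq_zero]
    refine hcomp.haus' _ fun k => ?_
    rw [SModEq.zero, smul_eq_mul, Ideal.mul_top, ← Ideal.Quotient.eq,
      IsAdicComplete.mk_liftRingHom]
    have h3 : algebraMap R (B I π n) r =
      AdicCompletion.of (piIdeal I π n) _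
        (algebraMap R (blowup I π n) r) := rfl
    rw [h3]
    simp [f]
  rw [h2, hg]

theorem exists_affinoid_hom [IsNoetherianRing O] [IsAdicComplete (Ideal.span {ϖ}) O]
    [Module.Finite O ψ.range] (hϖ : algebraMap O K ϖ ≠ 0) {n : ℕ}
    (hI : ∀ i ∈ I ^ (n + 1), ∃ t ∈ ψ.range, ψ i = ϖ • t) :
    ∃ g : C I π n →+* K, (∀ r, g (algebraMap R _ r) = ψ r) ∧
      ∀ b : B I π n, g (algebraMap _ _ b) ∈ ψ.range := by
  obtain ⟨g, hg⟩ := exists_completion_hom ψ hπ hϖ hI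
  have hu : IsUnit ((ψ.range.val : ψ.range →+* K).comp g
      (algebraMap R (B I π n) π)) := by
    have : (ψ.range.val : ψ.range →+* K).comp g
      (algebraMap R (B I π n) π) = algebraMap O K ϖ :=
      (hg _).trans (by rw [← hπ, ψ.commutes])
    rw [this]
    exact hϖ.isUnit
  refine ⟨IsLocalization.Away.lift _ hu, fun r => ?_, fun b => ?_⟩
  · exact (congrArg _ (IsScalarTower.algebraMap_apply R (B I π n) (C I π n) r)).trans
      ((IsLocalization.Away.lift_eq _ hu _).trans (hg r))
  · rw [IsLocalization.Away.lift_eq]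
    exact (g b).2

/-- The image of `g` is a field. Up to a power of `ϖ`, a nonzero value lies in the image of `ψ`;
being integral over `O`, it divides a nonzero element of `O`, hence a power of `ϖ`, which is
invertible in the image. -/
theorem ker_isMaximal [IsDomain O] (hdvd : ∀ a : O, a ≠ 0 → ∃ k, a ∣ ϖ ^ k)
    [Module.Finite O ψ.range] (hϖ : algebraMap O K ϖ ≠ 0) {n : ℕ}
    (g : C I π n →+* K) (hg : ∀ r, g (algebraMap R _ r) = ψ r)
    (hgB : ∀ b : B I π n, g (algebraMap _ _ b) ∈ ψ.range) :
    (RingHom.ker g).IsMaximal := by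
  have hgπ : g (algebraMap R _ π) = algebraMap O K ϖ := by rw [hg, ← hπ, ψ.commutes]
  have hinv : ∀ x, g x ≠ 0 → ∃ z, g x * g z = 1 := by
    intro x hx
    obtain ⟨k, b, hb⟩ := IsLocalization.Away.surj (algebraMap R (B I π n) π) x
    have hgπ' : g (algebraMap (B I π n) (C I π n) (algebraMap R (B I π n) π)) = algebraMap O K ϖ :=
      (congrArg g (IsScalarTower.algebraMap_apply R (B I π n) (C I π n) π)).symm.trans hgπ
    have ht : g x * algebraMap O K ϖ ^ k = g (algebraMap _ _ b) := by
      rw [← hb, map_mul, map_pow, hgπ']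
    have ht0 : (⟨_, hgB b⟩ : ψ.range) ≠ 0 := fun h => by
      have : g (algebraMap _ _ b) = 0 := congrArg Subtype.val h
      rw [← ht] at this
      exact mul_ne_zero hx (pow_ne_zero _ hϖ) this
    have hne := Ideal.comap_ne_bot_of_integral_mem (R := O) ht0
      (Ideal.mem_span_singleton_self _) (Algebra.IsIntegral.isIntegral _)
    obtain ⟨a, ha, ha0⟩ := Submodule.exists_mem_ne_zero_of_ne_bot hne
    obtain ⟨⟨_, r', rfl⟩, hr'⟩ := Ideal.mem_span_singleton.1 (Ideal.mem_comap.1 ha)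
    have hr'' : algebraMap O K a = g (algebraMap _ _ b) * ψ r' := congrArg Subtype.val hr'
    obtain ⟨l, a', hl⟩ := hdvd a ha0
    have hul : IsUnit (algebraMap R (C I π n) π ^ l) := by
      have h1 : IsUnit (algebraMap (B I π n) (C I π n) (algebraMap R (B I π n) π)) :=
        IsLocalization.Away.algebraMap_isUnit _
      exact IsUnit.pow l ((IsScalarTower.algebraMap_apply R (B I π n) (C I π n) π) ▸ h1)
    obtain ⟨v, hv⟩ := hul.exists_right_inv
    refine ⟨algebraMap R _ r' * algebraMap R _ (algebraMap O R a') * algebraMap R _ π ^ k * v, ?_⟩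
    have hgv := congrArg g hv
    rw [map_mul, map_pow, hgπ, map_one] at hgv
    simp only [map_mul, map_pow, hgπ, hg, ψ.commutes]
    calc _ = (g x * algebraMap O K ϖ ^ k) * ψ r' * algebraMap O K a' * g v := by ring
      _ = 1 := by rw [ht, ← hr'', ← map_mul, ← hl, map_pow, hgv]
  refine Ideal.isMaximal_iff.2 ⟨fun h => ?_, fun J x hJ hx hxJ => ?_⟩
  · rw [RingHom.mem_ker, map_one] at h
    exact one_ne_zero h
  · obtain ⟨z, hz⟩ := hinv x hx
    have h1 : 1 - x * z ∈ RingHom.ker g := by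
      rw [RingHom.mem_ker, map_sub, map_one, map_mul, hz, sub_self]
    have := J.add_mem (hJ h1) (J.mul_mem_right z hxJ)
    rwa [sub_add_cancel] at this

theorem eventually_eq_smul_of_represents [IsDomain O] [IsNoetherianRing O]
    [IsAdicComplete (Ideal.span {ϖ}) O] (hdvd : ∀ a : O, a ≠ 0 → ∃ k, a ∣ ϖ ^ k)
    [Module.Finite O ψ.range] (hϖ : algebraMap O K ϖ ≠ 0) {n : ℕ}
    (hI : ∀ i ∈ I ^ (n + 1), ∃ t ∈ ψ.range, ψ i = ϖ • t) {F : ℕ → R}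
    {c : C I π n} (hF : Represents I π n F c)
    (hc : ∀ y : Ideal (C I π n), y.IsMaximal → c ∈ y) (s : ℕ) :
    ∀ᶠ j in atTop, ∃ t ∈ ψ.range, ψ (psum π F j) = ϖ ^ (s * j) • t := by
  obtain ⟨g, hg, hgB⟩ := exists_affinoid_hom ψ hπ hϖ hI
  have hc0 : g c = 0 := hc _ (ker_isMaximal ψ hπ hdvd hϖ g hg hgB)
  have hψ : ψ π = algebraMap O K ϖ := by rw [← hπ, ψ.commutes]
  have hsmul : ∀ (r : R) (x : C I π n), g (r • x) = ψ r * g x := fun r x => by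
    rw [Algebra.smul_def, map_mul, hg]
  filter_upwards [hF s] with j hj
  obtain ⟨b, hb⟩ := mem_ballC.1 hj
  have h1 := congrArg g hb
  rw [map_sub, hsmul, hsmul, hc0, hg, mul_zero, zero_sub, map_pow, hψ, ← map_pow,
    ← Algebra.smul_def] at h1
  exact ⟨-g (algebraMap _ _ b), neg_mem (hgB b), by rw [smul_neg, ← h1, neg_neg]⟩

end Points

end RigidFibre

end

section

/-! ### Traces and points of finite extensions -/

section FiniteExtension

open Polynomial

/-- The trace is the sum of the eigenvalues, which are the values of `q` at eigenvalues of `M`, and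
these are roots of `P`. No identification of `P` with the characteristic polynomial is needed. -/
theorem Matrix.map_trace_aeval_mem {S K ι : Type*} [CommRing S] [Field K] [IsAlgClosed K]
    [Fintype ι] [DecidableEq ι] (M : Matrix ι ι S) (s : S →+* K) {P : S[X]} (hP : aeval M P = 0)
    (U : AddSubmonoid K) (q : S[X])
    (hq : ∀ t, (P.map s).eval t = 0 → (q.map s).eval t ∈ U) : s (aeval M q).trace ∈ U := by
  have hmap : ∀ f : S[X], (aeval M f).map s = aeval (M.map s) (f.map s) := fun f => by
    have := Polynomial.map_aeval_eq_aeval_map (φ := s) (ψ := s.mapMatrix) (by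
      ext1 r
      simp [Matrix.algebraMap_eq_diagonal, Matrix.diagonal_map]) f M
    simpa using this
  rw [AddMonoidHom.map_trace s, hmap, Matrix.trace_eq_sum_roots_charpoly]
  refine AddSubmonoid.multiset_sum_mem _ _ fun μ hμ => ?_
  have h1 := Matrix.mem_spectrum_of_isRoot_charpoly (Polynomial.isRoot_of_mem_roots hμ)
  cases isEmpty_or_nonempty ι
  · have := Matrix.subsingleton_of_empty_left (m := ι) (n := ι) (α := K)
    rw [spectrum.of_subsingleton] at h1
    exact h1.elim
  rw [spectrum.map_polynomial_aeval_of_nonempty _ _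
    (spectrum.nonempty_of_isAlgClosed_of_finiteDimensional K _)] at h1
  obtain ⟨t, ht, rfl⟩ := h1
  refine hq t ?_
  have h2 := spectrum.subset_polynomial_aeval (M.map s) (P.map s) ⟨t, ht, rfl⟩
  rw [← hmap, hP, Matrix.map_zero _ (map_zero s), spectrum.zero_eq] at h2
  exact h2

theorem AdjoinRoot.map_trace_mem {S K : Type*} [CommRing S] [Field K] [IsAlgClosed K]
    {P : S[X]} (hP : P.Monic) (s : S →+* K) (U : AddSubmonoid K) (q : S[X])
    (hq : ∀ t, (P.map s).eval t = 0 → (q.map s).eval t ∈ U) :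
    s (Algebra.trace S (AdjoinRoot P) (AdjoinRoot.mk P q)) ∈ U := by
  classical
  let b := (AdjoinRoot.powerBasis' hP).basis
  have h1 : ∀ f, Algebra.leftMulMatrix b (AdjoinRoot.mk P f) =
      aeval (Algebra.leftMulMatrix b (AdjoinRoot.root P)) f := fun f => by
    rw [← AdjoinRoot.aeval_eq, aeval_algHom_apply]
  rw [Algebra.trace_eq_matrix_trace b, h1]
  refine Matrix.map_trace_aeval_mem _ s (P := P) ?_ U q hq
  rw [← h1, AdjoinRoot.mk_self, map_zero]

theorem exists_mul_eq_algebraMap {S A : Type*} [CommRing S] [CommRing A] [IsDomain A] [Algebra S A]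
    [Nontrivial S] [Algebra.IsIntegral S A] {x : A} (hx : x ≠ 0) :
    ∃ (s : S) (y : A), s ≠ 0 ∧ x * y = algebraMap S A s := by
  have hne := Ideal.comap_ne_bot_of_integral_mem (R := S) hx
    (Ideal.mem_span_singleton_self _) (Algebra.IsIntegral.isIntegral _)
  obtain ⟨s, hs, hs0⟩ := Submodule.exists_mem_ne_zero_of_ne_bot hne
  obtain ⟨y, hy⟩ := Ideal.mem_span_singleton.1 (Ideal.mem_comap.1 hs)
  exact ⟨s, y, hs0, hy.symm⟩

/-- If `x ≠ 0`, some multiple `x * y` is a nonzero `s ∈ S`, whose trace is the rank times `s`,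
nonzero in characteristic zero. -/
theorem AdjoinRoot.trace_mul_root_pow_injective {S : Type*} [CommRing S] [IsDomain S] [CharZero S]
    {P : S[X]} (hP : P.Monic) [IsDomain (AdjoinRoot P)] {x : AdjoinRoot P}
    (h : ∀ i : Fin P.natDegree,
      Algebra.trace S (AdjoinRoot P) (x * AdjoinRoot.root P ^ (i : ℕ)) = 0) : x = 0 := by
  by_contra hx
  have := hP.finite_adjoinRoot
  have := hP.free_adjoinRoot
  obtain ⟨s, y, hs, hxy⟩ := exists_mul_eq_algebraMap (S := S) hx
  let ℓ := (Algebra.trace S (AdjoinRoot P)) ∘ₗ LinearMap.mulLeft S x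
  have hℓ : ℓ = 0 := (AdjoinRoot.powerBasis' hP).basis.ext fun i => by
    simpa [ℓ] using h i
  have h1 : ℓ y = 0 := by rw [hℓ]; rfl
  change Algebra.trace S (AdjoinRoot P) (x * y) = 0 at h1
  rw [hxy, Algebra.trace_algebraMap, nsmul_eq_mul, mul_eq_zero, Nat.cast_eq_zero] at h1
  refine h1.elim (fun h1 => ?_) hs
  have := Module.finrank_pos (R := S) (M := AdjoinRoot P)
  omega

theorem exists_ringHom_extension_of_injective {A D K : Type*} [CommRing A] [CommRing D]
    [IsDomain D] [Algebra A D] [Algebra.IsIntegral A D]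
    (hinj : Function.Injective (algebraMap A D)) [Field K] [IsAlgClosed K] (f : A →+* K)
    (hf : Function.Injective f) : ∃ g : D →+* K, g.comp (algebraMap A D) = f := by
  have : IsDomain A := hinj.isDomain
  algebraize [f]
  have : FaithfulSMul A K := (faithfulSMul_iff_algebraMap_injective _ _).2 hf
  have : FaithfulSMul A D := (faithfulSMul_iff_algebraMap_injective _ _).2 hinj
  let g : D →ₐ[A] K := IsAlgClosed.lift
  exact ⟨g, RingHom.ext fun a => g.commutes a⟩

/-- Lying over provides a prime of `D` above the kernel of `f`; modulo these primes the extension is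
algebraic and embeds into `K`. -/
theorem exists_ringHom_extension {A D K : Type*} [CommRing A] [CommRing D] [Algebra A D]
    [Algebra.IsIntegral A D] (hinj : Function.Injective (algebraMap A D)) [Field K]
    [IsAlgClosed K] (f : A →+* K) : ∃ g : D →+* K, g.comp (algebraMap A D) = f := by
  have hp : (RingHom.ker f).IsPrime := RingHom.ker_isPrime f
  obtain ⟨Q, -, hQ, hQf⟩ := Ideal.exists_ideal_over_prime_of_isIntegral (RingHom.ker f)
    (⊥ : Ideal D) (by
      rw [← RingHom.ker_eq_comap_bot, (RingHom.injective_iff_ker_eq_bot _).1 hinj]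
      exact bot_le)
  have hover : Q.LiesOver (RingHom.ker f) := ⟨hQf.symm⟩
  obtain ⟨g, hg⟩ := exists_ringHom_extension_of_injective (A := A ⧸ RingHom.ker f) (D := D ⧸ Q)
    (by
      refine (injective_iff_map_eq_zero _).2 fun a => ?_
      obtain ⟨a, rfl⟩ := Ideal.Quotient.mk_surjective a
      intro ha
      rw [Ideal.Quotient.algebraMap_mk_of_liesOver, Ideal.Quotient.eq_zero_iff_mem] at ha
      rw [Ideal.Quotient.eq_zero_iff_mem, ← hQf]
      exact ha) (RingHom.kerLift f) (RingHom.kerLift_injective f)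
  refine ⟨g.comp (Ideal.Quotient.mk Q), ?_⟩
  ext a
  exact congrArg (fun h => h (Ideal.Quotient.mk _ a)) hg

end FiniteExtension


end

section

/-! ### Primitive elements of finite extensions of domains -/

section PrimitiveElement

open Polynomial

theorem Polynomial.exists_smul_lifts {S K : Type*} [CommRing S] [IsDomain S] [Field K]
    [Algebra S K] [IsFractionRing S K] (p : K[X]) :
    ∃ (c : S) (q : S[X]), c ≠ 0 ∧ q.map (algebraMap S K) = c • p := by
  obtain ⟨b, hb, h⟩ := IsLocalization.integerNormalization_spec (nonZeroDivisors S) p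
  exact ⟨b, _, nonZeroDivisors.ne_zero hb, h⟩

/-- A primitive element `α` of the fraction fields is scaled twice: by `s` to lie in `D`, and by `c`
to give it a minimal polynomial over `S`, which is not assumed integrally closed. `Δ` is a product
of denominators for generators of `D`. -/
theorem exists_isAdjoinRoot_of_finite (S D : Type*) [CommRing S] [IsDomain S] [CharZero S]
    [CommRing D] [IsDomain D] [Algebra S D] [Module.Finite S D]
    (hinj : Function.Injective (algebraMap S D)) :
    ∃ (θ : D) (P : S[X]) (Δ : S), P.Monic ∧ aeval θ P = 0 ∧ (∀ q : S[X], aeval θ q = 0 → P ∣ q) ∧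
      Δ ≠ 0 ∧ ∀ x : D, ∃ q : S[X], Δ • x = aeval θ q := by
  classical
  let K := FractionRing S
  let L := FractionRing D
  have : FaithfulSMul S D := (faithfulSMul_iff_algebraMap_injective _ _).2 hinj
  have hSL : Function.Injective (algebraMap S L) := by
    rw [IsScalarTower.algebraMap_eq S D L]
    exact (IsFractionRing.injective D L).comp hinj
  have : FaithfulSMul S L := (faithfulSMul_iff_algebraMap_injective _ _).2 hSL
  let : Algebra K L := FractionRing.liftAlgebra S L
  have : IsScalarTower S K L := FractionRing.isScalarTower_liftAlgebra S L
  have : CharZero K := charZero_of_injective_algebraMap (IsFractionRing.injective S K)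
  have hden : ∀ z : L, ∃ (s : S) (d : D), s ≠ 0 ∧ algebraMap S L s * z = algebraMap D L d := by
    intro z
    obtain ⟨a, b, hb, rfl⟩ := IsFractionRing.div_surjective (A := D) z
    have hb0 := nonZeroDivisors.ne_zero hb
    obtain ⟨s, y, hs, hy⟩ := exists_mul_eq_algebraMap (S := S) hb0
    refine ⟨s, y * a, hs, ?_⟩
    have : algebraMap D L b ≠ 0 := fun h => hb0 ((IsFractionRing.injective D L) (by simpa using h))
    rw [IsScalarTower.algebraMap_apply S D L, ← hy]
    rw [map_mul, map_mul, mul_comm (algebraMap D L b), mul_assoc, mul_div_cancel₀ _ this]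
  have : FiniteDimensional K L := by
    obtain ⟨t, ht⟩ := Module.Finite.fg_top (R := S) (M := D)
    refine ⟨⟨t.image (algebraMap D L), ?_⟩⟩
    rw [eq_top_iff]
    intro z _
    obtain ⟨s, d, hs, hz⟩ := hden z
    have hs' : algebraMap S K s ≠ 0 := fun h =>
      hs ((IsFractionRing.injective S K) (by simpa using h))
    have hd : algebraMap D L d ∈ Submodule.span K ((t.image (algebraMap D L) : Finset L) : Set L) := by
      have : d ∈ Submodule.span S (t : Set D) := by rw [ht]; trivial
      clear hz
      induction this using Submodule.span_induction with
      | mem x hx => exact Submodule.subset_span (Finset.mem_coe.2 (Finset.mem_image_of_mem _ hx))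
      | zero => simp
      | add x y _ _ hx hy => rw [map_add]; exact add_mem hx hy
      | smul a x _ hx =>
        have : algebraMap D L (a • x) = algebraMap S K a • algebraMap D L x := by
          rw [Algebra.smul_def, Algebra.smul_def, map_mul, ← IsScalarTower.algebraMap_apply,
            ← IsScalarTower.algebraMap_apply]
        rw [this]
        exact Submodule.smul_mem _ _ hx
    have : z = (algebraMap S K s)⁻¹ • algebraMap D L d := by
      rw [← hz, IsScalarTower.algebraMap_apply S K L, ← Algebra.smul_def, inv_smul_smul₀ hs']
    rw [this]
    exact Submodule.smul_mem _ _ hd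
  obtain ⟨α, hα⟩ := Field.exists_primitive_element K L
  obtain ⟨s, d, hs, hd⟩ := hden α
  obtain ⟨c, m, hc, hm⟩ := Polynomial.exists_smul_lifts (S := S) (minpoly K α)
  have hKS := IsFractionRing.injective S K
  have hcs : algebraMap S K (c * s) ≠ 0 := fun h =>
    mul_ne_zero hc hs (hKS (by simpa using h))
  have hα_int : IsIntegral K α := IsIntegral.of_finite K α
  have hθ : algebraMap D L (c • d) = algebraMap S K (c * s) • α := by
    rw [Algebra.smul_def, Algebra.smul_def, map_mul, ← hd, ← IsScalarTower.algebraMap_apply,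
      ← IsScalarTower.algebraMap_apply, map_mul, mul_assoc]
  obtain ⟨P, hPmap, hPdeg, hP⟩ := Polynomial.lifts_and_natDegree_eq_and_monic (f := algebraMap S K)
    (p := (minpoly K α).scaleRoots (algebraMap S K (c * s))) (by
      rw [Polynomial.lifts_iff_coeff_lifts]
      intro n
      rw [Polynomial.coeff_scaleRoots]
      rcases lt_trichotomy n (minpoly K α).natDegree with h | h | h
      -- Below the leading degree, scaling multiplies the coefficient by a positive power of `c *
      -- s`, and one factor `c` clears its denominator.
      · obtain ⟨k, hk⟩ := Nat.exists_eq_add_of_lt h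
        refine ⟨m.coeff n * s * (c * s) ^ k, ?_⟩
        have h1 : algebraMap S K (m.coeff n) = algebraMap S K c * (minpoly K α).coeff n := by
          rw [← Polynomial.coeff_map, hm, Polynomial.coeff_smul, Algebra.smul_def]
        have h2 : (minpoly K α).natDegree - n = k + 1 := by omega
        rw [h2, map_mul, map_mul, h1, map_pow, map_mul]
        ring
      · subst h
        exact ⟨1, by simp [(minpoly.monic hα_int).coeff_natDegree]⟩
      · exact ⟨0, by simp [Polynomial.coeff_eq_zero_of_natDegree_lt h]⟩)
    ((Polynomial.monic_scaleRoots_iff _).2 (minpoly.monic hα_int))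
  have hθtop : IntermediateField.adjoin K {algebraMap D L (c • d)} = ⊤ := by
    rw [eq_top_iff, ← hα, IntermediateField.adjoin_simple_le_iff]
    have h1 := IntermediateField.mem_adjoin_simple_self K (algebraMap D L (c • d))
    have h2 := (IntermediateField.adjoin K {algebraMap D L (c • d)}).smul_mem h1
      (x := (algebraMap S K (c * s))⁻¹)
    rwa [hθ, inv_smul_smul₀ hcs, ← hθ] at h2
  have hroot : aeval (algebraMap D L (c • d)) (P.map (algebraMap S K)) = 0 := by
    rw [hPmap, hθ, Algebra.smul_def]
    exact Polynomial.scaleRoots_aeval_eq_zero (minpoly.aeval K α)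
  have hmin : P.map (algebraMap S K) = minpoly K (algebraMap D L (c • d)) := by
    refine Polynomial.eq_of_monic_of_dvd_of_natDegree_le (minpoly.monic
      (IsIntegral.of_finite K _)) (hP.map _) (minpoly.dvd K _ hroot) ?_
    rw [(Field.primitive_element_iff_minpoly_natDegree_eq K _).1 hθtop,
      ← (Field.primitive_element_iff_minpoly_natDegree_eq K _).1 hα, hPmap,
      Polynomial.natDegree_scaleRoots]
  have haeval : ∀ q : S[X], algebraMap D L (aeval (c • d) q) =
      aeval (algebraMap D L (c • d)) (q.map (algebraMap S K)) := fun q => by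
    rw [Polynomial.aeval_map_algebraMap, Polynomial.aeval_algebraMap_apply]
  have hW : ∀ x : D, ∃ a : S, a ≠ 0 ∧ ∃ q : S[X], a • x = aeval (c • d) q := by
    intro x
    have hx : algebraMap D L x ∈ Algebra.adjoin K {algebraMap D L (c • d)} := by
      rw [← IntermediateField.adjoin_simple_toSubalgebra_of_isAlgebraic
        (Algebra.IsAlgebraic.isAlgebraic _), hθtop]
      trivial
    rw [Algebra.adjoin_singleton_eq_range_aeval] at hx
    obtain ⟨r, hr⟩ := hx
    obtain ⟨a, q, ha, hq⟩ := Polynomial.exists_smul_lifts (S := S) r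
    refine ⟨a, ha, q, IsFractionRing.injective D L ?_⟩
    have h1 : algebraMap D L (a • x) = algebraMap S K a • algebraMap D L x := by
      rw [Algebra.smul_def, Algebra.smul_def, map_mul, ← IsScalarTower.algebraMap_apply,
        ← IsScalarTower.algebraMap_apply]
    rw [haeval, hq, h1, ← hr, ← algebraMap_smul K a r]
    exact (map_smul (aeval (algebraMap D L (c • d))) _ _).symm
  choose a ha q hq using hW
  obtain ⟨t, ht⟩ := Module.Finite.fg_top (R := S) (M := D)
  refine ⟨c • d, P, ∏ x ∈ t, a x, hP, IsFractionRing.injective D L (by rw [haeval, hroot, map_zero]),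
    fun f hf => ?_, Finset.prod_ne_zero_iff.2 fun x _ => ha x, fun x => ?_⟩
  · rw [← Polynomial.map_dvd_map _ hKS hP, hmin]
    exact minpoly.dvd K _ (by rw [← haeval, hf, map_zero])
  · have : x ∈ Submodule.span S (t : Set D) := by rw [ht]; trivial
    induction this using Submodule.span_induction with
    | mem x hx =>
      refine ⟨Polynomial.C (∏ y ∈ t.erase x, a y) * q x, ?_⟩
      rw [← Finset.prod_erase_mul _ _ hx, mul_smul, hq, ← smul_eq_C_mul, map_smul]
    | zero => exact ⟨0, by simp⟩
    | add x y _ _ hx hy =>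
      obtain ⟨f, hf⟩ := hx
      obtain ⟨g, hg⟩ := hy
      exact ⟨f + g, by rw [smul_add, hf, hg, map_add]⟩
    | smul b x _ hx =>
      obtain ⟨f, hf⟩ := hx
      exact ⟨b • f, by rw [smul_comm, hf, map_smul]⟩

end PrimitiveElement


end

section

/-! ### Vanishing of entire sequences at all points -/

section Points

open Filter Polynomial

variable {O : Type*} [CommRing O] {ϖ : O} {K : Type*} [Field K] [Algebra O K]

theorem finite_range_of_algebraMap_mem {S D : Type*} [CommRing S] [CommRing D] [Algebra S D]
    [Module.Finite S D] [Algebra O D] {ev : S →+* O} (ψ : D →ₐ[O] K)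
    (hψ : ∀ r, ψ (algebraMap S D r) = algebraMap O K (ev r)) : Module.Finite O ψ.range := by
  classical
  obtain ⟨t, ht⟩ := Module.Finite.fg_top (R := S) (M := D)
  refine (Module.Finite.iff_fg (N := Subalgebra.toSubmodule ψ.range)).2 ⟨t.image ψ, le_antisymm ?_ ?_⟩
  · rw [Submodule.span_le]
    intro x hx
    obtain ⟨y, -, rfl⟩ := Finset.mem_image.1 (Finset.mem_coe.1 hx)
    exact ⟨y, rfl⟩
  · rintro _ ⟨x, rfl⟩
    have : x ∈ Submodule.span S (t : Set D) := by rw [ht]; trivial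
    change ψ x ∈ _
    induction this using Submodule.span_induction with
    | mem x hx => exact Submodule.subset_span (Finset.mem_coe.2 (Finset.mem_image_of_mem _ hx))
    | zero => rw [map_zero]; exact zero_mem _
    | add x y _ _ hx hy => rw [map_add]; exact add_mem hx hy
    | smul a x _ hx =>
      rw [Algebra.smul_def, map_mul, hψ, ← Algebra.smul_def]
      exact Submodule.smul_mem _ _ hx

theorem exists_eq_smul_of_mem_map {S D : Type*} [CommRing S] [CommRing D] [Algebra S D]
    [Algebra O D] {ev : S →+* O} (ψ : D →ₐ[O] K)
    (hψ : ∀ r, ψ (algebraMap S D r) = algebraMap O K (ev r)) {J : Ideal S}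
    (hJ : J ≤ (Ideal.span {ϖ}).comap ev) {x : D} (hx : x ∈ J.map (algebraMap S D)) :
    ∃ t ∈ ψ.range, ψ x = ϖ • t := by
  induction hx using Submodule.span_induction with
  | mem x hx =>
    obtain ⟨r, hr, rfl⟩ := hx
    obtain ⟨b, hb⟩ := Ideal.mem_span_singleton.1 (hJ hr)
    exact ⟨algebraMap O K b, ψ.range.algebraMap_mem b, by
      change ψ (algebraMap S D r) = _
      rw [hψ, hb, map_mul, Algebra.smul_def]⟩
  | zero => exact ⟨0, zero_mem _, by simp⟩
  | add x y _ _ hx hy =>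
    obtain ⟨a, ha, hxa⟩ := hx
    obtain ⟨b, hb, hyb⟩ := hy
    exact ⟨a + b, add_mem ha hb, by rw [map_add, hxa, hyb, smul_add]⟩
  | smul a x _ hx =>
    obtain ⟨b, hb, hxb⟩ := hx
    exact ⟨ψ a * b, mul_mem ⟨a, rfl⟩ hb, by rw [smul_eq_mul, map_mul, hxb, mul_smul_comm]⟩

theorem psum_algebraMap {S D : Type*} [CommRing S] [CommRing D] [Algebra S D] (r : S) (F : ℕ → D) :
    psum r F = psum (algebraMap S D r) F := by
  ext j
  induction j with
  | zero => rfl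
  | succ j ih => rw [psum, psum, ih, Algebra.smul_def, smul_eq_mul]

variable [IsDomain O] [FaithfulSMul O K]

/-- The quotient `x / a` in the fraction field is integral over `O`, so it lies in `O`. -/
theorem dvd_of_algebraMap_eq_smul [IsIntegrallyClosed O] {a x : O} (ha : a ≠ 0) {y : K}
    (hy : IsIntegral O y) (h : algebraMap O K x = a • y) : a ∣ x := by
  let : Algebra (FractionRing O) K := FractionRing.liftAlgebra O K
  have : IsScalarTower O (FractionRing O) K := FractionRing.isScalarTower_liftAlgebra O K
  let z : FractionRing O := algebraMap O _ x / algebraMap O _ a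
  have ha' : algebraMap O K a ≠ 0 := fun h =>
    ha (FaithfulSMul.algebraMap_injective O K (by simpa using h))
  have ha'' : algebraMap O (FractionRing O) a ≠ 0 := fun h =>
    ha (FaithfulSMul.algebraMap_injective O (FractionRing O) (by simpa using h))
  have hz : algebraMap (FractionRing O) K z = y := by
    rw [map_div₀, ← IsScalarTower.algebraMap_apply, ← IsScalarTower.algebraMap_apply, h,
      Algebra.smul_def, mul_div_cancel_left₀ _ ha']
  rw [← hz] at hy
  have hz' : IsIntegral O z := (isIntegral_algebraMap_iff
    (FaithfulSMul.algebraMap_injective (FractionRing O) K)).1 hy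
  obtain ⟨b, hb⟩ := IsIntegrallyClosed.isIntegral_iff.1 hz'
  refine ⟨b, FaithfulSMul.algebraMap_injective O (FractionRing O) ?_⟩
  rw [map_mul, hb, mul_div_cancel₀ _ ha'']

/-- Each root `t` of the specialized `P` gives a point of `S[θ]`, which extends to a point of `D`.
The specialized trace is a sum of values at such points, so it is `ϖ ^ (s * j)` times an integral
element. There are only finitely many roots, so one threshold for `j` serves all. -/
theorem eventually_dvd_trace [IsIntegrallyClosed O] [IsAlgClosed K] (hϖ : ϖ ≠ 0) {S D : Type*}
    [CommRing S] [CommRing D] [Algebra S D] [Algebra.IsIntegral S D] (ev : S →+* O) {P : S[X]}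
    (hP : P.Monic) (ι : AdjoinRoot P →ₐ[S] D) (hι : Function.Injective ι)
    (μ : D → AdjoinRoot P) {Δ : S} (hμ : ∀ x, ι (μ x) = Δ • x) {G : ℕ → D}
    (hG : ∀ ψ : D →+* K, (∀ r, ψ (algebraMap S D r) = algebraMap O K (ev r)) →
      ∀ s : ℕ, ∀ᶠ j in atTop, ∃ y, IsIntegral O y ∧ ψ (G j) = ϖ ^ (s * j) • y) (i s : ℕ) :
    ∀ᶠ j in atTop, ϖ ^ (s * j) ∣
      ev (Algebra.trace S (AdjoinRoot P) (μ (G j) * AdjoinRoot.root P ^ i)) := by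
  classical
  let f : S →+* K := (algebraMap O K).comp ev
  have hPf : P.map f ≠ 0 := (hP.map f).ne_zero
  have hext : ∀ t, (P.map f).eval t = 0 → ∃ ψ : D →+* K,
      (∀ r, ψ (algebraMap S D r) = f r) ∧ ∀ q, ψ (ι (AdjoinRoot.mk P q)) = (q.map f).eval t := by
    intro t ht
    rw [Polynomial.eval_map] at ht
    let : Algebra (AdjoinRoot P) D := ι.toRingHom.toAlgebra
    have : IsScalarTower S (AdjoinRoot P) D := IsScalarTower.of_algebraMap_eq fun r => by
      exact (ι.commutes r).symm
    have : Algebra.IsIntegral (AdjoinRoot P) D := Algebra.IsIntegral.tower_top S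
    obtain ⟨ψ, hψ⟩ := exists_ringHom_extension (A := AdjoinRoot P) (D := D) hι
      (AdjoinRoot.lift f t ht)
    have hψ' : ∀ q, ψ (ι (AdjoinRoot.mk P q)) = (q.map f).eval t := fun q => by
      have := congrArg (fun g => g (AdjoinRoot.mk P q)) hψ
      rw [Polynomial.eval_map, ← AdjoinRoot.lift_mk (h := ht)]
      exact this
    refine ⟨ψ, fun r => ?_, hψ'⟩
    have := hψ' (Polynomial.C r)
    rw [Polynomial.map_C, Polynomial.eval_C] at this
    rw [← this, ← ι.commutes]
    rfl
  have hall : ∀ᶠ j in atTop, ∀ t ∈ (P.map f).roots.toFinset, ∀ q,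
      AdjoinRoot.mk P q = μ (G j) * AdjoinRoot.root P ^ i →
        ∃ y, IsIntegral O y ∧ (q.map f).eval t = ϖ ^ (s * j) • y := by
    rw [Filter.eventually_all_finset]
    intro t ht
    have ht0 : (P.map f).eval t = 0 := by
      rw [Multiset.mem_toFinset, Polynomial.mem_roots hPf] at ht
      exact ht
    obtain ⟨ψ, hψS, hψ⟩ := hext t ht0
    have htint : IsIntegral O t := ⟨P.map ev, hP.map ev, by
      rw [← Polynomial.eval_map, Polynomial.map_map]; exact ht0⟩
    filter_upwards [hG ψ hψS s] with j hj q hq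
    obtain ⟨y, hy, hyG⟩ := hj
    refine ⟨algebraMap O K (ev Δ) * y * t ^ i,
      (isIntegral_algebraMap.mul hy).mul (htint.pow i), ?_⟩
    have hroot : ψ (ι (AdjoinRoot.root P)) = t := by
      have := hψ X
      rwa [Polynomial.map_X, Polynomial.eval_X] at this
    rw [← hψ, hq, map_mul, map_pow, map_mul, map_pow, hroot, hμ, Algebra.smul_def, map_mul, hψS,
      hyG]
    simp only [Algebra.smul_def, f, RingHom.comp_apply]
    ring
  filter_upwards [hall] with j hj
  let U : AddSubmonoid K := ((integralClosure O K).toSubmodule.map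
    (LinearMap.lsmul O K (ϖ ^ (s * j)))).toAddSubmonoid
  obtain ⟨q, hq⟩ := AdjoinRoot.mk_surjective (μ (G j) * AdjoinRoot.root P ^ i)
  have hU : f (Algebra.trace S (AdjoinRoot P) (AdjoinRoot.mk P q)) ∈ U := by
    refine AdjoinRoot.map_trace_mem hP f U q fun t ht => ?_
    obtain ⟨y, hy, h⟩ := hj t (by
      rw [Multiset.mem_toFinset, Polynomial.mem_roots hPf]
      exact ht) q hq
    exact ⟨y, hy, h.symm⟩
  obtain ⟨y, hy, h⟩ := hU
  rw [← hq]
  exact dvd_of_algebraMap_eq_smul (K := K) (pow_ne_zero _ hϖ) hy h.symm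

-- The trace embedding `Φ` of `D` into a free module over the power series ring reduces the claim to
-- the identity theorem.
open IsLocalRing in
theorem isNull_of_forall_point [IsLocalRing O] [IsNoetherianRing O] [IsIntegrallyClosed O]
    [CharZero O] [IsAlgClosed K] (hϖ : maximalIdeal O = Ideal.span {ϖ})
    [IsAdicComplete (Ideal.span {ϖ}) O] {D : Type*} [CommRing D] [IsDomain D] [IsLocalRing D]
    [IsNoetherianRing D] [IsAdicComplete (maximalIdeal D) D] [Algebra O D]
    (hres : Function.Surjective ((residue D).comp (algebraMap O D)))
    (hreg : algebraMap O D ϖ ≠ 0) (hmem : algebraMap O D ϖ ∈ maximalIdeal D)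
    {F : ℕ → D} (hF : IsEntire (maximalIdeal D) F)
    (hpt : ∀ ψ : D →ₐ[O] K, Module.Finite O ψ.range →
      (∃ N, ∀ i ∈ maximalIdeal D ^ N, ∃ t ∈ ψ.range, ψ i = ϖ • t) →
      ∀ s : ℕ, ∀ᶠ j in atTop, ∃ t ∈ ψ.range,
        ψ (psum (algebraMap O D ϖ) F j) = ϖ ^ (s * j) • t) :
    IsNull (maximalIdeal D) (algebraMap O D ϖ) F := by
  have hϖ0 : ϖ ≠ 0 := by rintro rfl; simp at hreg
  obtain ⟨d, e, he, hefin, heC, hele, N, hN⟩ := MvPowerSeries.exists_finite_injective hϖ hres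
    (mem_nonZeroDivisors_of_ne_zero hreg) hmem
  let S := MvPowerSeries (Fin d) O
  let : Algebra S D := e.toAlgebra
  have : Module.Finite S D := hefin
  have : IsDomain S := he.isDomain e
  have : CharZero S := charZero_of_injective_ringHom (f := (MvPowerSeries.C : O →+* S))
    MvPowerSeries.C_injective
  obtain ⟨θ, P, Δ, hP, hPθ, hPdvd, hΔ, hμ⟩ := exists_isAdjoinRoot_of_finite S D he
  let ι : AdjoinRoot P →ₐ[S] D := AdjoinRoot.liftAlgHom P (Algebra.ofId S D) θ hPθ
  have hιmk : ∀ q, ι (AdjoinRoot.mk P q) = aeval θ q := fun q => by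
    exact AdjoinRoot.lift_mk (i := algebraMap S D) (h := hPθ) q
  have hι : Function.Injective ι := by
    refine (injective_iff_map_eq_zero _).2 fun x hx => ?_
    obtain ⟨q, rfl⟩ := AdjoinRoot.mk_surjective x
    rw [hιmk] at hx
    exact AdjoinRoot.mk_eq_zero.2 (hPdvd q hx)
  have : IsDomain (AdjoinRoot P) := hι.isDomain ι.toRingHom
  have hμ' : ∀ x : D, ∃ a, ι a = Δ • x := fun x => by
    obtain ⟨q, hq⟩ := hμ x
    exact ⟨AdjoinRoot.mk P q, (hιmk q).trans hq.symm⟩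
  choose μ hμ using hμ'
  let μl : D →ₗ[S] AdjoinRoot P :=
    { toFun := μ
      map_add' := fun x y => hι (by rw [map_add, hμ, hμ, hμ, smul_add])
      map_smul' := fun r x => hι (by
        rw [RingHom.id_apply, map_smul, hμ, hμ, smul_comm]) }
  let Φ : D →ₗ[S] Fin P.natDegree → S := LinearMap.pi fun i =>
    Algebra.trace S (AdjoinRoot P) ∘ₗ LinearMap.mulRight S (AdjoinRoot.root P ^ (i : ℕ)) ∘ₗ μl
  have hΦ : Function.Injective Φ := by
    refine (injective_iff_map_eq_zero _).2 fun x hx => ?_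
    have h1 : μ x = 0 := AdjoinRoot.trace_mul_root_pow_injective hP fun i => congrFun hx i
    have h2 := hμ x
    rw [h1, map_zero, Algebra.smul_def] at h2
    exact (mul_eq_zero.1 h2.symm).resolve_left fun h => hΔ (he (h.trans (map_zero e).symm))
  -- The `N`-th power of the maximal ideal of `D` lies in `(ϖ, X) D`, so slope `N * s` for the
  -- former is slope `s` for the latter.
  have hFS : IsEntire (MvPowerSeries.varIdeal (Fin d) ϖ) F := fun s => by
    filter_upwards [hF (N * s)] with j hj
    rw [mem_pow_smul_top_self, mul_assoc, pow_mul] at hj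
    rw [Ideal.smul_top_eq_map, Ideal.map_pow]
    exact Ideal.pow_right_mono hN _ hj
  have hCϖ : algebraMap S D (MvPowerSeries.C ϖ) = algebraMap O D ϖ := heC ϖ
  have hnull : IsNull (MvPowerSeries.varIdeal (Fin d) ϖ) (MvPowerSeries.C ϖ : S) F := by
    refine IsNull.of_map Φ hΦ ?_
    rw [IsNull, psum_map]
    refine isEntire_pi fun i => ?_
    have h1 : (fun j => (Φ ∘ psum (MvPowerSeries.C ϖ : S) F) j i) =
        psum (MvPowerSeries.C ϖ : S) ((LinearMap.proj i ∘ₗ Φ) ∘ F) := by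
      rw [psum_map]; rfl
    rw [h1]
    refine MvPowerSeries.isNull_of_forall_eval hϖ0 (hFS.map _) fun ev hevC hevX => ?_
    have hev : MvPowerSeries.varIdeal (Fin d) ϖ ≤ (Ideal.span {ϖ}).comap ev := by
      refine sup_le ?_ ?_
      · rw [Ideal.span_singleton_le_iff_mem, Ideal.mem_comap, hevC]
        exact Ideal.mem_span_singleton_self _
      · rw [Ideal.span_le]
        rintro _ ⟨k, rfl⟩
        exact hevX k
    intro s
    filter_upwards [eventually_dvd_trace (K := K) hϖ0 ev hP ι hι μ hμ
      (G := psum (algebraMap O D ϖ) F) (fun ψ hψ s => by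
        let ψO : D →ₐ[O] K :=
          { ψ with
            commutes' := fun c => by
              change ψ (algebraMap O D c) = _
              rw [← heC]
              exact (hψ _).trans (congrArg _ (hevC c)) }
        have hfin : Module.Finite O ψO.range := finite_range_of_algebraMap_mem ψO hψ
        filter_upwards [hpt ψO hfin ⟨N, fun x hx =>
          exists_eq_smul_of_mem_map ψO hψ hev (hN hx)⟩ s] with j hj
        obtain ⟨t, ht, htj⟩ := hj
        refine ⟨t, ?_, htj⟩
        have := Algebra.IsIntegral.isIntegral (R := O) (⟨t, ht⟩ : ψO.range)
        exact this.map ψO.range.val) i s] with j hj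
    rw [mem_span_singleton_pow_smul_top (n := s * j)]
    have h2 := psum_comp_apply (π := (MvPowerSeries.C ϖ : S)) (π' := ϖ) (ev : S →+ O)
      (fun x => by
        change ev (_ * x) = ϖ * ev x
        rw [map_mul, hevC]) ((LinearMap.proj i ∘ₗ Φ) ∘ F) j
    rw [psum_map] at h2
    rw [← hCϖ, ← psum_algebraMap] at hj
    have h3 : psum ϖ (ev ∘ ((LinearMap.proj i ∘ₗ Φ) ∘ F)) j = _ := h2
    rw [h3]
    exact hj
  intro s
  filter_upwards [hnull s] with j hj
  rw [mem_pow_smul_top_self, ← hCϖ, ← psum_algebraMap]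
  rw [Ideal.smul_top_eq_map, Ideal.map_pow] at hj
  exact Ideal.pow_right_mono hele _ hj

end Points


end

section

/-! ### Functions that vanish at all points -/

theorem algebraMap_eq_zero_of_one_tmul_eq_zero {A K V : Type*} [CommSemiring A] [Semiring K]
    [Algebra A K] [AddCommMonoid V] [Module A V] (ℓ : V →ₗ[A] A) {z : V}
    (hz : (1 : K) ⊗ₜ[A] z = 0) : algebraMap A K (ℓ z) = 0 := by
  have h := congrArg (fun w => TensorProduct.rid A K (ℓ.lTensor K w)) hz
  simpa [Algebra.algebraMap_eq_smul_one] using h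

namespace RigidFibre

open Filter IsLocalRing

section

variable {O : Type*} [CommRing O] [IsDomain O] {ϖ : O} [IsLocalRing O] [IsNoetherianRing O]
  [IsIntegrallyClosed O] [CharZero O] [IsAdicComplete (Ideal.span {ϖ}) O]
  {R : Type*} [CommRing R] [IsLocalRing R] [IsNoetherianRing R]
  [IsAdicComplete (maximalIdeal R) R] [Algebra O R] {π : R}

theorem isNull_mk_of_forall_mem (hϖ : maximalIdeal O = Ideal.span {ϖ})
    (hdvd : ∀ a : O, a ≠ 0 → ∃ k, a ∣ ϖ ^ k)
    (hres : Function.Surjective ((residue R).comp (algebraMap O R)))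
    (hπ : algebraMap O R ϖ = π) (hmem : π ∈ maximalIdeal R) {F : ℕ → R}
    (hF : IsEntire (maximalIdeal R) F) {c : ∀ n, C (maximalIdeal R) π n}
    (hc : ∀ n, Represents (maximalIdeal R) π n F (c n))
    (hmax : ∀ n (y : Ideal (C (maximalIdeal R) π n)), y.IsMaximal → c n ∈ y)
    (p : Ideal R) [hp : p.IsPrime] (hπp : π ∉ p) :
    IsNull (maximalIdeal R) π (p.mkQ ∘ F) := by
  let K := AlgebraicClosure (FractionRing O)
  have hOK : Function.Injective (algebraMap O K) := by
    rw [IsScalarTower.algebraMap_eq O (FractionRing O) K]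
    exact (algebraMap (FractionRing O) K).injective.comp (IsFractionRing.injective O _)
  have : FaithfulSMul O K := (faithfulSMul_iff_algebraMap_injective _ _).2 hOK
  have : IsLocalRing (R ⧸ p) := .of_surjective' (Ideal.Quotient.mk p) Ideal.Quotient.mk_surjective
  have hmax' : maximalIdeal (R ⧸ p) = (maximalIdeal R).map (algebraMap R (R ⧸ p)) :=
    (map_maximalIdeal_of_surjective _ Ideal.Quotient.mk_surjective).symm
  have : IsAdicComplete (maximalIdeal (R ⧸ p)) (R ⧸ p) := by
    rw [hmax']
    exact IsAdicComplete.map_of_finite _ _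
  have hOD : algebraMap O (R ⧸ p) ϖ = Ideal.Quotient.mk p π := by rw [← hπ]; rfl
  have hpow : ∀ k, (maximalIdeal R ^ k • ⊤ : Submodule R (R ⧸ p)) =
      (maximalIdeal (R ⧸ p) ^ k).restrictScalars R := fun k => by
    rw [Ideal.smul_top_eq_map, Ideal.map_pow, hmax']
  have hps : psum (algebraMap O (R ⧸ p) ϖ) (p.mkQ ∘ F) = p.mkQ ∘ psum π F := by
    rw [hOD, ← psum_map]
    exact (psum_algebraMap π _).symm
  have hFD : IsEntire (maximalIdeal (R ⧸ p)) (p.mkQ ∘ F) := fun s => by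
    filter_upwards [hF.map p.mkQ s] with j hj
    rw [hpow] at hj
    rw [mem_pow_smul_top_self]
    exact hj
  have key := isNull_of_forall_point (K := K) hϖ (D := R ⧸ p)
    (fun x => by
      obtain ⟨y, rfl⟩ := residue_surjective x
      obtain ⟨r, rfl⟩ := Ideal.Quotient.mk_surjective y
      obtain ⟨a, ha⟩ := hres (residue R r)
      refine ⟨a, Ideal.Quotient.eq.2 ?_⟩
      rw [hmax']
      exact Ideal.mem_map_of_mem (Ideal.Quotient.mk p) (Ideal.Quotient.eq.1 ha))
    (by rwa [hOD, Ne, Ideal.Quotient.eq_zero_iff_mem])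
    (by rw [hOD, hmax']; exact Ideal.mem_map_of_mem _ hmem) hFD fun ψ hψ ⟨N, hN⟩ s => by
      let ψR : R →ₐ[O] K := ψ.comp (Ideal.Quotient.mkₐ O p)
      have hrange : ψR.range = ψ.range := by
        rw [AlgHom.range_comp, (AlgHom.range_eq_top _).2 (Ideal.Quotient.mkₐ_surjective O p),
          Algebra.map_top]
      have : Module.Finite O ψR.range := by rwa [hrange]
      have h1 := eventually_eq_smul_of_represents ψR hπ hdvd
        (fun h => hπp (by
          rw [(injective_iff_map_eq_zero _).1 hOK _ h, map_zero] at hπ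
          rw [← hπ]; exact zero_mem p))
        -- The point lies in `Sp C N`, since the power `N + 1` of the maximal ideal is contained in
        -- the power `N`.
        (n := N) (fun i hi => by
          rw [hrange]
          refine hN _ ?_
          rw [hmax', ← Ideal.map_pow]
          exact Ideal.mem_map_of_mem (Ideal.Quotient.mk p)
            (Ideal.pow_le_pow_right (Nat.le_succ N) hi)) (hc N) (hmax N) s
      rw [hrange] at h1
      rw [hps]
      exact h1
  intro s
  filter_upwards [key s] with j hj
  rw [mem_pow_smul_top_self, hps, ← psum_map] at hj
  rw [hpow]
  exact hj

/-- A reduced noetherian ring embeds into the finite product of its quotients by minimal primes, and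
a nonzerodivisor lies in none of these primes. -/
theorem isNull_of_forall_mem [IsReduced R] (hϖ : maximalIdeal O = Ideal.span {ϖ})
    (hdvd : ∀ a : O, a ≠ 0 → ∃ k, a ∣ ϖ ^ k)
    (hres : Function.Surjective ((residue R).comp (algebraMap O R)))
    (hπ : algebraMap O R ϖ = π) (hmem : π ∈ maximalIdeal R) (hreg : π ∈ nonZeroDivisors R)
    {F : ℕ → R} (hF : IsEntire (maximalIdeal R) F) {c : ∀ n, C (maximalIdeal R) π n}
    (hc : ∀ n, Represents (maximalIdeal R) π n F (c n))
    (hmax : ∀ n (y : Ideal (C (maximalIdeal R) π n)), y.IsMaximal → c n ∈ y) :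
    IsNull (maximalIdeal R) π F := by
  have : Finite (minimalPrimes R) :=
    (Ideal.finite_minimalPrimes_of_isNoetherianRing R ⊥).to_subtype
  let f : R →ₗ[R] ∀ p : minimalPrimes R, R ⧸ p.1 := LinearMap.pi fun p => p.1.mkQ
  refine IsNull.of_map f ((injective_iff_map_eq_zero f).2 fun x hx => ?_) ?_
  · have h1 : x ∈ sInf (minimalPrimes R) := Ideal.mem_sInf.2 fun {p} hp =>
      Ideal.Quotient.eq_zero_iff_mem.1 (congrFun hx ⟨p, hp⟩)
    rw [minimalPrimes, Ideal.sInf_minimalPrimes] at h1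
    exact IsReduced.eq_zero x (mem_nilradical.1 h1)
  · rw [IsNull, psum_map]
    refine isEntire_pi fun p => ?_
    have : p.1.IsPrime := p.2.1.1
    have h := isNull_mk_of_forall_mem hϖ hdvd hres hπ hmem hF hc hmax p.1
      fun hp => Set.disjoint_left.1 (Ideal.disjoint_nonZeroDivisors_of_mem_minimalPrimes p.2) hp hreg
    rw [IsNull, psum_map] at h
    exact h

end

section

variable {R : Type*} [CommRing R] {I : Ideal R} {π : R}

/-- The value is computed on a chosen affinoid, but its vanishing is invariant under `SamePoint` and
so holds on any affinoid containing the point. -/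
theorem restrict_mem_of_forall_evalAt {g : Rrig I π} (hg : ∀ x : Point I π, evalAt x g = 0)
    {n : ℕ} {y : Ideal (C I π n)} (hy : y.IsMaximal) : restrict I π n g ∈ y := by
  let Q : Point I π → Prop := Quot.lift (fun x => restrict I π x.1 g ∈ x.2.asIdeal) (by
    rintro ⟨m, x⟩ ⟨n, y⟩ ⟨h, hxy⟩
    change n ≤ m at h
    change x.asIdeal = y.asIdeal.comap (transition I π h) at hxy
    change (restrict I π m g ∈ x.asIdeal) = (restrict I π n g ∈ y.asIdeal)
    rw [hxy, Ideal.mem_comap, transition_restrict])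
  have hQ : ∀ x, Q x := fun x => by
    rw [← Quot.out_eq x]
    have h : Ideal.Quotient.mk (Quot.out x).2.asIdeal (restrict I π (Quot.out x).1 g) = 0 := hg x
    exact Ideal.Quotient.eq_zero_iff_mem.1 h
  exact hQ (Quot.mk _ ⟨n, ⟨y, hy⟩⟩)

theorem evalAt_eq_zero_of_toFibres_eq_zero {M : Type*} [AddCommGroup M] [Module R M]
    {z : Mrig I π M} (hz : toFibres I π M z = 0) (φ : M →ₗ[R] R) (x : Point I π) :
    evalAt x (TensorProduct.rid R (Rrig I π) (φ.lTensor (Rrig I π) z)) = 0 := by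
  let ℓ : Mrig I π M →ₗ[Rrig I π] Rrig I π :=
    (TensorProduct.AlgebraTensorModule.rid R (Rrig I π) (Rrig I π)).toLinearMap ∘ₗ
      φ.baseChange (Rrig I π)
  have h1 : (1 : Kappa x) ⊗ₜ[Rrig I π] z = 0 := congrFun hz x
  exact algebraMap_eq_zero_of_one_tmul_eq_zero ℓ h1

end

end RigidFibre


end

section

/-! ### Rings of integers of finite extensions of `ℚ_p` -/

section Integers

open IsLocalRing

theorem IsAdicComplete.of_pow {A : Type*} [CommRing A] {I : Ideal A} {e : ℕ} (he : e ≠ 0)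
    [h : IsAdicComplete (I ^ e) A] : IsAdicComplete I A where
  haus' x hx := h.haus' x fun n => by
    have := hx (e * n)
    rwa [pow_mul] at this
  prec' f hf := by
    obtain ⟨L, hL⟩ := h.prec' (fun n => f (e * n)) fun {m n} hmn => by
      have := hf (Nat.mul_le_mul_left e hmn)
      rwa [pow_mul] at this
    refine ⟨L, fun n => ?_⟩
    have h1 := hL n
    rw [← pow_mul] at h1
    have hle : n ≤ e * n := Nat.le_mul_of_pos_left n (Nat.pos_of_ne_zero he)
    exact (hf hle).trans (h1.mono (Submodule.smul_mono_left (Ideal.pow_le_pow_right hle)))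

variable {p : ℕ} [Fact p.Prime] {L : Type*} [Field L] [Algebra ℚ_[p] L] [FiniteDimensional ℚ_[p] L]
  [Algebra ℤ_[p] L] [IsScalarTower ℤ_[p] ℚ_[p] L]

/-- Both sides say that the minimal polynomial has coefficients in `ℤ_[p]`, which is integrally
closed. -/
theorem isIntegral_padicInt_iff {x : L} : IsIntegral ℤ_[p] x ↔ spectralNorm ℚ_[p] L x ≤ 1 := by
  have hx : IsIntegral ℚ_[p] x := IsIntegral.of_finite _ _
  rw [spectralNorm, spectralValue_le_one_iff (minpoly.monic hx)]
  constructor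
  · intro h n
    rw [minpoly.isIntegrallyClosed_eq_field_fractions' ℚ_[p] h, Polynomial.coeff_map]
    exact PadicInt.norm_le_one _
  · intro h
    obtain ⟨P, hP, -, hPm⟩ := Polynomial.lifts_and_natDegree_eq_and_monic
      (f := algebraMap ℤ_[p] ℚ_[p]) (p := minpoly ℚ_[p] x) ((Polynomial.lifts_iff_coeff_lifts _).2 fun n =>
        ⟨⟨_, h n⟩, rfl⟩) (minpoly.monic hx)
    refine ⟨P, hPm, ?_⟩
    have := minpoly.aeval ℚ_[p] x
    rwa [← hP, Polynomial.aeval_map_algebraMap] at this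

variable {O : Type*} [CommRing O] [Algebra O L] [IsIntegralClosure O ℤ_[p] L]

theorem isUnit_of_spectralNorm_eq_one {x : O} (hx : spectralNorm ℚ_[p] L (algebraMap O L x) = 1) :
    IsUnit x := by
  have hinj := IsIntegralClosure.algebraMap_injective O ℤ_[p] L
  have h0 : algebraMap O L x ≠ 0 := fun h => by
    rw [h, spectralNorm_zero] at hx
    exact zero_ne_one hx
  have h1 : IsIntegral ℤ_[p] (algebraMap O L x)⁻¹ := by
    rw [isIntegral_padicInt_iff]
    have h2 := spectralAlgNorm_mul (K := ℚ_[p]) (algebraMap O L x) (algebraMap O L x)⁻¹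
    rw [mul_inv_cancel₀ h0, spectralAlgNorm_one, spectralAlgNorm_def, spectralAlgNorm_def, hx,
      one_mul] at h2
    exact h2.symm.le
  obtain ⟨y, hy⟩ := IsIntegralClosure.isIntegral_iff (A := O).1 h1
  refine IsUnit.of_mul_eq_one y (hinj ?_)
  rw [map_mul, hy, mul_inv_cancel₀ h0, map_one]

/-- As the spectral norm is nonarchimedean, `x` or `1 - x` has norm one, and integral elements of
norm one are units. -/
theorem IsIntegralClosure.isLocalRing_padicInt (p : ℕ) [Fact p.Prime] (L : Type*) [Field L]
    [Algebra ℚ_[p] L] [FiniteDimensional ℚ_[p] L] [Algebra ℤ_[p] L]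
    [IsScalarTower ℤ_[p] ℚ_[p] L] (O : Type*) [CommRing O]
    [Algebra O L] [IsIntegralClosure O ℤ_[p] L] : IsLocalRing O := by
  have hinj := IsIntegralClosure.algebraMap_injective O ℤ_[p] L
  have : Nontrivial O := RingHom.domain_nontrivial (algebraMap O L)
  refine .of_isUnit_or_isUnit_one_sub_self fun x => ?_
  have hle : ∀ y : O, spectralNorm ℚ_[p] L (algebraMap O L y) ≤ 1 := fun y =>
    isIntegral_padicInt_iff.1 ((IsIntegralClosure.isIntegral_iff (A := O)).2 ⟨y, rfl⟩)
  have h1 := isNonarchimedean_spectralNorm (K := ℚ_[p]) (algebraMap O L x) (algebraMap O L (1 - x))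
  rw [← map_add, add_sub_cancel, map_one, spectralNorm_one] at h1
  rcases le_max_iff.1 h1 with h | h
  · exact .inl (isUnit_of_spectralNorm_eq_one (le_antisymm (hle _) h))
  · exact .inr (isUnit_of_spectralNorm_eq_one (le_antisymm (hle _) h))

variable (p L O) in
/-- The structure of `ℤ_[p]`-algebra of the ring of integers of a finite extension of `ℚ_[p]`. -/
@[reducible] def IsIntegralClosure.algebraPadicInt : Algebra ℤ_[p] O :=
  RingHom.toAlgebra
    { toFun := fun x => IsIntegralClosure.mk' O (algebraMap ℤ_[p] L x) isIntegral_algebraMap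
      map_one' := IsIntegralClosure.algebraMap_injective O ℤ_[p] L (by simp)
      map_zero' := IsIntegralClosure.algebraMap_injective O ℤ_[p] L (by simp)
      map_mul' := fun x y => IsIntegralClosure.algebraMap_injective O ℤ_[p] L (by simp)
      map_add' := fun x y => IsIntegralClosure.algebraMap_injective O ℤ_[p] L (by simp) }

/-- `O` is a local Dedekind domain and not a field, hence a discrete valuation ring. It is finite
over `ℤ_[p]`, so `p`-adically complete, and `p` is a unit times `ϖ ^ e`. -/
theorem IsIntegralClosure.padicInt_properties (p : ℕ) [Fact p.Prime] (L : Type*) [Field L]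
    [Algebra ℚ_[p] L] [FiniteDimensional ℚ_[p] L] [Algebra ℤ_[p] L]
    [IsScalarTower ℤ_[p] ℚ_[p] L] {O : Type*} [CommRing O]
    [Algebra O L] [IsIntegralClosure O ℤ_[p] L] {ϖ : O} (hϖ : Irreducible ϖ) :
    ∃ (_ : IsDomain O) (_ : IsLocalRing O), IsNoetherianRing O ∧ IsIntegrallyClosed O ∧
      CharZero O ∧ maximalIdeal O = Ideal.span {ϖ} ∧ IsAdicComplete (Ideal.span {ϖ}) O ∧
      ∀ a : O, a ≠ 0 → ∃ k, a ∣ ϖ ^ k := by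
  have hinj := IsIntegralClosure.algebraMap_injective O ℤ_[p] L
  have hdom : IsDomain O := hinj.isDomain
  have hloc : IsLocalRing O := IsIntegralClosure.isLocalRing_padicInt p L O
  let : Algebra ℤ_[p] O := IsIntegralClosure.algebraPadicInt p L O
  have : IsScalarTower ℤ_[p] O L := .of_algebraMap_eq fun x =>
    (IsIntegralClosure.algebraMap_mk' O (algebraMap ℤ_[p] L x) isIntegral_algebraMap).symm
  have : CharZero L := charZero_of_injective_algebraMap (algebraMap ℚ_[p] L).injective
  have hchar : CharZero O := by
    refine ⟨fun a b h => ?_⟩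
    have := congrArg (algebraMap O L) h
    simpa using this
  have hded : IsDedekindDomain O := IsIntegralClosure.isDedekindDomain ℤ_[p] ℚ_[p] L O
  have hfin : Module.Finite ℤ_[p] O := IsIntegralClosure.finite ℤ_[p] ℚ_[p] L O
  have hfield : ¬ IsField O := fun h => by
    let := h.toField
    exact hϖ.not_isUnit (isUnit_iff_ne_zero.2 hϖ.ne_zero)
  have : IsDiscreteValuationRing O :=
    ((IsDiscreteValuationRing.TFAE O hfield).out 2 0).1 hded
  have hmax := (IsDiscreteValuationRing.irreducible_iff_uniformizer ϖ).1 hϖ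
  refine ⟨hdom, hloc, inferInstance, inferInstance, hchar, hmax, ?_, fun a ha => ?_⟩
  · have hp : (algebraMap ℤ_[p] O p) ≠ 0 := by
      rw [map_natCast, Nat.cast_ne_zero]
      exact (Fact.out : p.Prime).ne_zero
    have h1 := IsAdicComplete.map_of_finite (maximalIdeal ℤ_[p]) O
    rw [PadicInt.maximalIdeal_eq_span_p, Ideal.map_span, Set.image_singleton] at h1
    obtain ⟨e, he⟩ := IsDiscreteValuationRing.associated_pow_irreducible hp hϖ
    rw [Ideal.span_singleton_eq_span_singleton.2 he, ← Ideal.span_singleton_pow] at h1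
    refine IsAdicComplete.of_pow (e := e) ?_
    -- For `e = 0` the ideal would be everything, and `O` would not be Hausdorff.
    rintro rfl
    rw [pow_zero, Ideal.one_eq_top] at h1
    have := h1.haus' (1 : O) fun n => by simp [Ideal.top_pow]
    exact one_ne_zero this
  · obtain ⟨k, hk⟩ := IsDiscreteValuationRing.associated_pow_irreducible ha hϖ
    exact ⟨k, hk.dvd⟩

end Integers


end

/-! ### Assembly of the proof -/

section

open IsLocalRing in
theorem RigidFibre.eq_zero_of_toFibres_eq_zero {O : Type*} [CommRing O] [IsDomain O] [IsLocalRing O]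
    [IsNoetherianRing O] [IsIntegrallyClosed O] [CharZero O] {ϖ : O} (hϖ : Irreducible ϖ)
    (hmax : maximalIdeal O = Ideal.span {ϖ}) [IsAdicComplete (Ideal.span {ϖ}) O]
    (hdvd : ∀ a : O, a ≠ 0 → ∃ k, a ∣ ϖ ^ k) {R : Type*} [CommRing R] [IsLocalRing R]
    [IsNoetherianRing R] [IsAdicComplete (maximalIdeal R) R] [Algebra O R]
    (hres : Function.Surjective ((residue R).comp (algebraMap O R)))
    [Module.IsTorsionFree O R] [IsReduced R] {M : Type*} [AddCommGroup M] [Module R M]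
    [Module.Finite R M] [FaithfulSMul R M] (hM : IsCohenMacaulayModule R M)
    {z : Mrig (maximalIdeal R) (algebraMap O R ϖ) M}
    (hz : toFibres (maximalIdeal R) (algebraMap O R ϖ) M z = 0) : z = 0 := by
  -- `O` surjects onto the residue field of `R`, so the kernel is the maximal ideal of `O`, which
  -- contains `ϖ`.
  have hmem : algebraMap O R ϖ ∈ IsLocalRing.maximalIdeal R := by
    have hker := RingHom.ker_isMaximal_of_surjective _ hres
    rw [← IsLocalRing.residue_eq_zero_iff]
    have h : ϖ ∈ RingHom.ker ((IsLocalRing.residue R).comp (algebraMap O R)) := by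
      rw [IsLocalRing.eq_maximalIdeal hker, hmax]
      exact Ideal.mem_span_singleton_self ϖ
    exact h
  have hreg : algebraMap O R ϖ ∈ nonZeroDivisors R := by
    rw [mem_nonZeroDivisors_iff_right]
    intro x hx
    rw [mul_comm, ← Algebra.smul_def] at hx
    exact (smul_eq_zero.1 hx).resolve_left hϖ.ne_zero
  obtain ⟨N, ψ, hψ⟩ := hM.exists_injective_pi
  refine RigidFibre.eq_zero_of_forall_lTensor hreg hmem ψ hψ z fun φ F hF hrep => ?_
  exact RigidFibre.isNull_of_forall_mem hmax hdvd hres rfl hmem hreg hF hrep fun n y hy =>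
    RigidFibre.restrict_mem_of_forall_evalAt
      (RigidFibre.evalAt_eq_zero_of_toFibres_eq_zero hz φ) hy


end

end

theorem proposition5p1 (p : ℕ) [Fact p.Prime]
    -- `L` is a finite extension of `ℚ_p` with ring of integers `O` and uniformizer `ϖ`
    (L : Type*) [Field L] [Algebra ℚ_[p] L] [FiniteDimensional ℚ_[p] L]
    [Algebra ℤ_[p] L] [IsScalarTower ℤ_[p] ℚ_[p] L]
    (O : Type*) [CommRing O] [Algebra O L] [IsIntegralClosure O ℤ_[p] L]
    (ϖ : O) (hϖ : Irreducible ϖ)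
    -- `R` is a complete local noetherian `O`-algebra with the same residue field as `O`
    (R : Type*) [CommRing R] [IsLocalRing R] [IsNoetherianRing R]
    [IsAdicComplete (IsLocalRing.maximalIdeal R) R] [Algebra O R]
    (hres : Function.Surjective ((IsLocalRing.residue R).comp (algebraMap O R)))
    [Module.IsTorsionFree O R] [IsReduced R]
    (M : Type*) [AddCommGroup M] [Module R M] [Module.Finite R M] [FaithfulSMul R M]
    (hM : IsCohenMacaulayModule R M) :
    Function.Injective
      (RigidFibre.toFibres (IsLocalRing.maximalIdeal R) (algebraMap O R ϖ) M) := by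
  refine (injective_iff_map_eq_zero _).2 fun z hz => ?_
  obtain ⟨_, _, _, _, _, hmax, _, hdvd⟩ := IsIntegralClosure.padicInt_properties p L hϖ
  exact RigidFibre.eq_zero_of_toFibres_eq_zero hϖ hmax hdvd hres hM hz
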